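/- Let $M$ be a smooth manifold and $E\to M$ a smooth real line bundle. Notation. Let $\mathfrak{D}E$ be the gauge Lie algebroid of $E$: its fibre at $m$ consists of the $\mathbb{R}$-linear maps $\mathfrak{d}:\Gamma(E)\to E_m$ together with a vector $\alpha(\mathfrak{d})=x\in T_mM$ (the anchor) such that $\mathfrak{d}(fu)=f(m)\,\mathfrak{d}(u)+x(f)\,u(m)$ for all $f\in C^\infty(M)$, $u\in\Gamma(E)$; $\Gamma(\mathfrak{D}E)$ carries the commutator bracket $[\cdot,\cdot]_{\mathfrak D}$, and $\mathfrak{gl}(E)\subset\mathfrak{D}E$ acts by $u\mapsto\Phi(u(m))$. Let $\mathfrak{J}E$ be the first jet bundle of $E$, realized as $\{\nu\in\mathrm{Hom}(\mathfrak{D}E,E)\mid \nu(\Phi)=\Phi(\nu(\mathbf 1_E))\ \forall\,\Phi\in\mathfrak{gl}(E)\}$, with pairing $\langle\nu,\mathfrak{d}\rangle_E=\nu(\mathfrak{d})$; for $u\in\Gamma(E)$ let $\mathbf{d}u\in\Gamma(\mathfrak{J}E)$ be the jet $\langle\mathbf{d}u,\mathfrak{d}\rangle_E=\mathfrak{d}(u)$,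 and let $\mathbf{e}:\mathrm{Hom}(TM,E)\to\mathfrak{J}E$ be $\mathbf{e}(\mathfrak y)(\mathfrak d)=\mathfrak y(\alpha(\mathfrak d))$. On $\mathcal{E}=\mathfrak{D}E\oplus\mathfrak{J}E$ take the $E$-valued form $(\mathfrak d+\mu,\mathfrak r+\nu)_E=\tfrac12(\langle\nu,\mathfrak d\rangle_E+\langle\mu,\mathfrak r\rangle_E)$ and, on sections, the Dorfman bracket $$\{\mathfrak d+\mu,\mathfrak r+\nu\}=[\mathfrak d,\mathfrak r]_{\mathfrak D}+\mathfrak L_{\mathfrak d}\nu-\mathfrak L_{\mathfrak r}\mu+\mathbf{d}\langle\mu,\mathfrak r\rangle_E,\qquad \langle\mathfrak L_{\mathfrak d}\mu,\mathfrak t\rangle_E=\mathfrak d\langle\mu,\mathfrak t\rangle_E-\langle\mu,[\mathfrak d,\mathfrak t]_{\mathfrak D}\rangle_E .$$ A Dirac structure is a maximal isotropic subbundle $L\subset\mathcal E$ such that $\Gamma(L)$ is closed under the Dorfman bracket; it comes from a bundle map $\pi:\mathfrak{J}E\to\mathfrak{D}E$ if $L=L_\pi=\{\pi(\mu)+\mu\mid\mu\in\mathfrak{J}E\}$.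 A local Lie algebra structure on $E$ is an $\mathbb R$-Lie algebra bracket $[\cdot,\cdot]_E$ on $\Gamma(E)$ with $\mathrm{supp}[u,v]_E\subset\mathrm{supp}\,u\cap\mathrm{supp}\,v$ for all $u,v$. A Lie algebroid structure on $E$ is an $\mathbb R$-Lie algebra bracket on $\Gamma(E)$ together with a bundle map $\rho:E\to TM$ such that $[u,fv]=f[u,v]+(\rho(u)f)v$ and $\rho[u,v]=[\rho(u),\rho(v)]$. Theorem. There is a bijection between the set of local Lie algebra structures on $E$ and the set of Dirac structures in $\mathcal E$ that come from bundle maps $\mathfrak{J}E\to\mathfrak{D}E$, under which $[\cdot,\cdot]_E$ corresponds to the Dirac structure $L_\pi$ with $$[u,v]_E=\pi(\mathbf{d}u)\,v\qquad\text{for all }u,v\in\Gamma(E).$$ Moreover, if $[\cdot,\cdot]_E$ corresponds to $L_\pi$, then $[\cdot,\cdot]_E$ is the bracket of a Lie algebroid structure on $E$ if and only if $\alpha\circ\pi\circ\mathbf{e}=0$. -/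

import Mathlib

open Bundle VectorField
open scoped Manifold ContDiff

noncomputable section

namespace OmniLie

section Functions

variable {n : ℕ} {M : Type*} [TopologicalSpace M] [ChartedSpace (EuclideanSpace ℝ (Fin n)) M]
  [IsManifold (𝓡 n) ∞ M]

/-- The function `X(f)` is smooth. -/
theorem contMDiff_deriv {f : M → ℝ} (hf : ContMDiff (𝓡 n) 𝓘(ℝ, ℝ) ∞ f)
    {X : ∀ m : M, TangentSpace (𝓡 n) m}
    (hX : ContMDiff (𝓡 n) (𝓡 n).tangent ∞
      (fun m => (TotalSpace.mk' (EuclideanSpace ℝ (Fin n)) m (X m) : TangentBundle (𝓡 n) M))) :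
    ContMDiff (𝓡 n) 𝓘(ℝ, ℝ) ∞ (fun m => mvfderiv (𝓡 n) f m (X m)) := by
  have h1 : ContMDiff (𝓡 n).tangent 𝓘(ℝ, ℝ).tangent ∞ (tangentMap (𝓡 n) 𝓘(ℝ, ℝ) f) :=
    hf.contMDiff_tangentMap (by simp)
  exact (contMDiff_snd_tangentBundle_modelSpace ℝ 𝓘(ℝ, ℝ)).comp (h1.comp hX)

/-- `[X, Y](f) = X(Y(f)) - Y(X(f))`. -/
theorem mlieBracket_deriv {f : M → ℝ} (hf : ContMDiff (𝓡 n) 𝓘(ℝ, ℝ) ∞ f)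
    {X Y : ∀ m : M, TangentSpace (𝓡 n) m}
    (hX : ContMDiff (𝓡 n) (𝓡 n).tangent ∞
      (fun m => (TotalSpace.mk' (EuclideanSpace ℝ (Fin n)) m (X m) : TangentBundle (𝓡 n) M)))
    (hY : ContMDiff (𝓡 n) (𝓡 n).tangent ∞
      (fun m => (TotalSpace.mk' (EuclideanSpace ℝ (Fin n)) m (Y m) : TangentBundle (𝓡 n) M)))
    (m : M) :
    mvfderiv (𝓡 n) f m (mlieBracket (𝓡 n) X Y m) =
      mvfderiv (𝓡 n) (fun p => mvfderiv (𝓡 n) f p (Y p)) m (X m) -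
        mvfderiv (𝓡 n) (fun p => mvfderiv (𝓡 n) f p (X p)) m (Y m) := by
  have hM : IsManifold (𝓡 n) (minSmoothness ℝ 3) M := by
    have : IsManifold (𝓡 n) ∞ M := inferInstance
    exact this.of_le (by simp; exact WithTop.coe_le_coe.2 (le_top : (3 : ℕ∞) ≤ ⊤))
  have hM2 : IsManifold (𝓡 n) 2 M := by
    have : IsManifold (𝓡 n) ∞ M := inferInstance
    exact this.of_le (WithTop.coe_le_coe.2 (le_top : (2 : ℕ∞) ≤ ⊤))
  by_cases hz : ∃ v : TangentSpace (𝓡 n) m, v ≠ 0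
  swap
  · push Not at hz
    rw [hz (mlieBracket (𝓡 n) X Y m), hz (X m), hz (Y m)]
    simp
  obtain ⟨v, hv⟩ := hz
  obtain ⟨s, hs, hZs⟩ := FiberBundle.exists_contMDiffOn_extend (k := ∞) (𝓡 n)
    (EuclideanSpace ℝ (Fin n)) v
  set Z : ∀ p : M, TangentSpace (𝓡 n) p := FiberBundle.extend (EuclideanSpace ℝ (Fin n)) v
    with hZdef
  have hZm : Z m = v := by simp [hZdef]
  have hZ : ∀ᶠ p in nhds m, ContMDiffAt (𝓡 n) (𝓡 n).tangent ∞
      (fun m => (TotalSpace.mk' (EuclideanSpace ℝ (Fin n)) m (Z m) : TangentBundle (𝓡 n) M)) p := by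
    filter_upwards [eventually_mem_nhds_iff.2 hs] with p hp
    exact (hZs p (mem_of_mem_nhds hp)).contMDiffAt hp
  have hXf := contMDiff_deriv hf hX
  have hYf := contMDiff_deriv hf hY
  have md : ∀ {g : M → ℝ}, ContMDiff (𝓡 n) 𝓘(ℝ, ℝ) ∞ g → ∀ p,
      MDifferentiableAt (𝓡 n) 𝓘(ℝ, ℝ) g p := fun hg p => (hg p).mdifferentiableAt (by simp)
  have vd : ∀ {W : ∀ m : M, TangentSpace (𝓡 n) m} {p : M}, ContMDiffAt (𝓡 n) (𝓡 n).tangent ∞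
      (fun m => (TotalSpace.mk' (EuclideanSpace ℝ (Fin n)) m (W m) : TangentBundle (𝓡 n) M)) p →
      MDifferentiableAt (𝓡 n) (𝓡 n).tangent
      (fun m => (TotalSpace.mk' (EuclideanSpace ℝ (Fin n)) m (W m) : TangentBundle (𝓡 n) M)) p :=
    fun hW => hW.mdifferentiableAt (by simp)
  have br : ∀ {V W : ∀ m : M, TangentSpace (𝓡 n) m} {p : M}, ContMDiffAt (𝓡 n) (𝓡 n).tangent ∞
      (fun m => (TotalSpace.mk' (EuclideanSpace ℝ (Fin n)) m (V m) : TangentBundle (𝓡 n) M)) p →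
      ContMDiffAt (𝓡 n) (𝓡 n).tangent ∞
      (fun m => (TotalSpace.mk' (EuclideanSpace ℝ (Fin n)) m (W m) : TangentBundle (𝓡 n) M)) p →
      ContMDiffAt (𝓡 n) (𝓡 n).tangent ∞
      (fun m => (TotalSpace.mk' (EuclideanSpace ℝ (Fin n)) m (mlieBracket (𝓡 n) V W m) :
        TangentBundle (𝓡 n) M)) p := fun hV hW => by
    have : IsManifold (𝓡 n) (((⊤ : ℕ∞) : WithTop ℕ∞) + 1) M := by simpa
    exact ContMDiffAt.mlieBracket_vectorField (m := ⊤) (n := ⊤) hV hW (by simp)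
  have hZ0 := hZ.self_of_nhds
  have key : ∀ {W : ∀ m : M, TangentSpace (𝓡 n) m},
      mlieBracket (𝓡 n) W (f • Z) =ᶠ[nhds m]
        (fun p => mvfderiv (𝓡 n) f p (W p)) • Z + f • mlieBracket (𝓡 n) W Z := by
    intro W
    filter_upwards [hZ] with p hp
    exact mlieBracket_smul_right (md hf p) (vd hp)
  have le2 : minSmoothness ℝ 2 ≤ ∞ := by simp; exact WithTop.coe_le_coe.2 (le_top : (2 : ℕ∞) ≤ ⊤)
  have fZ : ContMDiffAt (𝓡 n) (𝓡 n).tangent ∞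
      (fun m => (TotalSpace.mk' (EuclideanSpace ℝ (Fin n)) m ((f • Z) m) : TangentBundle (𝓡 n) M))
      m := ContMDiffAt.smul_section (hf m) hZ0
  have exp : ∀ {V W : ∀ m : M, TangentSpace (𝓡 n) m},
      ContMDiffAt (𝓡 n) (𝓡 n).tangent ∞
      (fun m => (TotalSpace.mk' (EuclideanSpace ℝ (Fin n)) m (W m) : TangentBundle (𝓡 n) M)) m →
      ContMDiff (𝓡 n) 𝓘(ℝ, ℝ) ∞ (fun m => mvfderiv (𝓡 n) f m (W m)) →
      mlieBracket (𝓡 n) V (mlieBracket (𝓡 n) W (f • Z)) m =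
        mvfderiv (𝓡 n) (fun p => mvfderiv (𝓡 n) f p (W p)) m (V m) • Z m
        + mvfderiv (𝓡 n) f m (W m) • mlieBracket (𝓡 n) V Z m
        + (mvfderiv (𝓡 n) f m (V m) • mlieBracket (𝓡 n) W Z m
        + f m • mlieBracket (𝓡 n) V (mlieBracket (𝓡 n) W Z) m) := by
    intro V W hW hWf
    rw [Filter.EventuallyEq.mlieBracket_vectorField_eq (Filter.EventuallyEq.refl (nhds m) V) (key (W := W)),
      mlieBracket_add_right, mlieBracket_smul_right (md hWf m) (vd hZ0),
      mlieBracket_smul_right (md hf m) (vd (br hW hZ0))]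
    · exact vd (ContMDiffAt.smul_section (hWf m) hZ0)
    · exact vd (ContMDiffAt.smul_section (hf m) (br hW hZ0))
  have J1 := leibniz_identity_mlieBracket_apply (U := X) (V := Y) (W := f • Z) (x := m)
    ((hX m).of_le le2) ((hY m).of_le le2) (fZ.of_le le2)
  have J2 := leibniz_identity_mlieBracket_apply (U := X) (V := Y) (W := Z) (x := m)
    ((hX m).of_le le2) ((hY m).of_le le2) (hZ0.of_le le2)
  rw [exp (hY m) hYf, exp (hX m) hXf, mlieBracket_smul_right (md hf m) (vd hZ0), J2] at J1
  have J3 : (mvfderiv (𝓡 n) f m (mlieBracket (𝓡 n) X Y m) -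
      (mvfderiv (𝓡 n) (fun p => mvfderiv (𝓡 n) f p (Y p)) m (X m) -
        mvfderiv (𝓡 n) (fun p => mvfderiv (𝓡 n) f p (X p)) m (Y m))) • Z m = 0 := by
    rw [sub_smul, sub_smul]
    have := sub_eq_zero.2 J1
    rw [← neg_eq_zero, ← this]
    module
  rw [hZm] at J3
  exact sub_eq_zero.1 ((smul_eq_zero.1 J3).resolve_right hv)

end Functions

variable (n : ℕ) {M : Type*} [TopologicalSpace M] [ChartedSpace (EuclideanSpace ℝ (Fin n)) M]
  (F : Type*) [NormedAddCommGroup F] [NormedSpace ℝ F]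
  (E : M → Type*) [TopologicalSpace (TotalSpace F E)] [∀ m, TopologicalSpace (E m)]
  [∀ m, AddCommGroup (E m)] [∀ m, Module ℝ (E m)] [FiberBundle F E] [VectorBundle ℝ F E]

/-! ### Sections of `E`, and the fibres of `𝔇E` and `𝔍E` -/

/-- `Γ(E)`: the smooth sections of the vector bundle `E → M`. -/
abbrev Sec : Type _ := Cₛ^∞⟮𝓡 n; F, E⟯

variable {n F E} in
/-- The product `f u` of a smooth function and a smooth section. -/
def smulSec (f : C^∞⟮𝓡 n, M; 𝓘(ℝ, ℝ), ℝ⟯) (u : Sec n F E) : Sec n F E :=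
  ⟨fun m => f m • u m, ContMDiff.smul_section f.contMDiff u.contMDiff⟩

/-- The fibre `(𝔇E)_m` of the gauge algebroid (bundle of covariant differential operators): its
elements are the `ℝ`-linear maps `𝔡 : Γ(E) → E_m` together with a vector `x ∈ T_m M`, the anchor,
such that `𝔡(f u) = f(m) 𝔡(u) + x(f) u(m)`. -/
def DFiber (m : M) : Submodule ℝ ((Sec n F E →ₗ[ℝ] E m) × TangentSpace (𝓡 n) m) where
  carrier := {δ | ∀ (f : C^∞⟮𝓡 n, M; 𝓘(ℝ, ℝ), ℝ⟯) (u : Sec n F E),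
    δ.1 (smulSec f u) = f m • δ.1 u + mvfderiv (𝓡 n) f m δ.2 • u m}
  add_mem' := by
    intro a b ha hb f u
    have h1 := ha f u
    have h2 := hb f u
    simp only [Prod.fst_add, Prod.snd_add, LinearMap.add_apply, map_add, h1, h2]
    module
  zero_mem' := by intro f u; simp
  smul_mem' := by
    intro c a ha f u
    have h1 := ha f u
    simp only [Prod.smul_fst, Prod.smul_snd, LinearMap.smul_apply, map_smul, h1, smul_eq_mul]
    module

variable {n F E}

/-- The operator `Γ(E) → E_m` underlying `𝔡 ∈ (𝔇E)_m`. -/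
def op {m : M} : DFiber n F E m →ₗ[ℝ] (Sec n F E →ₗ[ℝ] E m) :=
  (LinearMap.fst ℝ _ _).comp (DFiber n F E m).subtype

/-- The anchor `α : (𝔇E)_m → T_m M`. -/
def anchor {m : M} : DFiber n F E m →ₗ[ℝ] TangentSpace (𝓡 n) m :=
  (LinearMap.snd ℝ _ _).comp (DFiber n F E m).subtype

theorem op_smulSec {m : M} (δ : DFiber n F E m) (f : C^∞⟮𝓡 n, M; 𝓘(ℝ, ℝ), ℝ⟯) (u : Sec n F E) :
    op δ (smulSec f u) = f m • op δ u + mvfderiv (𝓡 n) f m (anchor δ) • u m :=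
  δ.2 f u

variable [IsManifold (𝓡 n) ∞ M]

variable (n F) in
/-- The inclusion `𝕚 : gl(E_m) → (𝔇E)_m`, where `Φ` acts by `u ↦ Φ(u(m))` and has anchor `0`. -/
def glInc {m : M} (Φ : E m →ₗ[ℝ] E m) : DFiber n F E m :=
  ⟨({ toFun := fun u => Φ (u m)
      map_add' := by intro u v; simp
      map_smul' := by intro c u; simp }, 0), by
    intro f u
    simp [smulSec]⟩

variable (n F E) in
/-- The fibre `(𝔍E)_m` of the first jet bundle, as the standard `E`-dual of `(𝔇E)_m`:
`(𝔍E)_m = {ν ∈ Hom((𝔇E)_m, E_m) | ν(Φ) = Φ(ν(1)) for all Φ ∈ gl(E_m)}`. -/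
def JFiber (m : M) : Submodule ℝ (DFiber n F E m →ₗ[ℝ] E m) where
  carrier := {ν | ∀ Φ : E m →ₗ[ℝ] E m, ν (glInc n F Φ) = Φ (ν (glInc n F LinearMap.id))}
  add_mem' := by
    intro a b ha hb Φ
    simp only [LinearMap.add_apply, map_add, ha Φ, hb Φ]
  zero_mem' := by intro Φ; simp
  smul_mem' := by
    intro c a ha Φ
    simp only [LinearMap.smul_apply, map_smul, ha Φ]

/-- The `E`-valued pairing `⟨μ, 𝔡⟩_E` between `(𝔍E)_m` and `(𝔇E)_m`. -/
def pairing {m : M} : JFiber n F E m →ₗ[ℝ] (DFiber n F E m →ₗ[ℝ] E m) :=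
  (JFiber n F E m).subtype

/-- The embedding `𝕖 : Hom(T_m M, E_m) → (𝔍E)_m`, `𝕖(y)(𝔡) = y(α(𝔡))`. -/
def jetInc {m : M} (y : TangentSpace (𝓡 n) m →ₗ[ℝ] E m) : JFiber n F E m :=
  ⟨y.comp anchor, by
    intro Φ
    simp [anchor, glInc]⟩

/-- The `1`-jet `[u]_m ∈ (𝔍E)_m` at `m` of a section `u`: `[u]_m(𝔡) = 𝔡(u)`. -/
def jet (u : Sec n F E) (m : M) : JFiber n F E m :=
  ⟨(LinearMap.applyₗ u).comp op, by
    intro Φ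
    simp [op, glInc]⟩

/-! ### Smooth sections of `𝔇E` and `𝔍E` and the operations on them -/

variable (n F E) in
/-- `Γ(𝔇E)`: the families `𝔡_m ∈ (𝔇E)_m` such that the anchor is a smooth vector field and
`m ↦ 𝔡_m(u)` is a smooth section of `E` for each `u ∈ Γ(E)`. This determines the smooth
structure of the vector bundle `𝔇E`. -/
def SecD : Submodule ℝ (∀ m : M, DFiber n F E m) where
  carrier := {𝔡 | ContMDiff (𝓡 n) (𝓡 n).tangent ∞
      (fun m => (TotalSpace.mk' (EuclideanSpace ℝ (Fin n)) m (anchor (𝔡 m)) :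
        TangentBundle (𝓡 n) M)) ∧
    ∀ u : Sec n F E, ContMDiff (𝓡 n) ((𝓡 n).prod 𝓘(ℝ, F)) ∞
      (fun m => TotalSpace.mk' F m (op (𝔡 m) u))}
  add_mem' := by
    rintro a b ⟨ha, ha'⟩ ⟨hb, hb'⟩
    exact ⟨ContMDiff.add_section ha hb, fun u => ContMDiff.add_section (ha' u) (hb' u)⟩
  zero_mem' := ⟨(0 : Cₛ^∞⟮𝓡 n; EuclideanSpace ℝ (Fin n), (TangentSpace (𝓡 n) : M → Type _)⟯).contMDiff,
    fun _ => (0 : Sec n F E).contMDiff⟩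
  smul_mem' := by
    rintro c a ⟨ha, ha'⟩
    exact ⟨ContMDiff.const_smul_section ha, fun u => ContMDiff.const_smul_section (ha' u)⟩

variable (n F E) in
/-- `Γ(𝔍E)`: the families `μ_m ∈ (𝔍E)_m` such that `⟨μ, 𝔡⟩_E` is a smooth section of `E` for each
`𝔡 ∈ Γ(𝔇E)`, that is, the smooth sections of `Hom(𝔇E, E)` with values in `𝔍E`. This determines
the smooth structure of the vector bundle `𝔍E`. -/
def SecJ : Submodule ℝ (∀ m : M, JFiber n F E m) where
  carrier := {μ | ∀ 𝔡 : SecD n F E, ContMDiff (𝓡 n) ((𝓡 n).prod 𝓘(ℝ, F)) ∞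
      (fun m => TotalSpace.mk' F m (pairing (μ m) (𝔡.1 m)))}
  add_mem' := fun ha hb 𝔡 => ContMDiff.add_section (ha 𝔡) (hb 𝔡)
  zero_mem' := fun _ => (0 : Sec n F E).contMDiff
  smul_mem' := fun _ _ ha 𝔡 => ContMDiff.const_smul_section (ha 𝔡)

/-- The action of `𝔡 ∈ Γ(𝔇E)` on `Γ(E)`. -/
def act (𝔡 : SecD n F E) : Sec n F E →ₗ[ℝ] Sec n F E where
  toFun u := ⟨fun m => op (𝔡.1 m) u, 𝔡.2.2 u⟩
  map_add' u v := by ext m; simp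
  map_smul' c u := by ext m; simp

/-- The function `α(𝔡)(f)`. -/
def anchorDeriv (𝔡 : SecD n F E) (f : C^∞⟮𝓡 n, M; 𝓘(ℝ, ℝ), ℝ⟯) : C^∞⟮𝓡 n, M; 𝓘(ℝ, ℝ), ℝ⟯ :=
  ⟨fun m => mvfderiv (𝓡 n) f m (anchor (𝔡.1 m)), contMDiff_deriv f.contMDiff 𝔡.2.1⟩

theorem act_smulSec (𝔡 : SecD n F E) (f : C^∞⟮𝓡 n, M; 𝓘(ℝ, ℝ), ℝ⟯) (u : Sec n F E) :
    act 𝔡 (smulSec f u) = smulSec f (act 𝔡 u) + smulSec (anchorDeriv 𝔡 f) u := by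
  ext m
  exact op_smulSec (𝔡.1 m) f u

/-- The commutator bracket `[𝔡, 𝔯]_𝔇` on `Γ(𝔇E)`; its anchor is the Lie bracket of the anchors. -/
def bracketD (𝔡 𝔯 : SecD n F E) : SecD n F E :=
  ⟨fun m => ⟨({ toFun := fun u => act 𝔡 (act 𝔯 u) m - act 𝔯 (act 𝔡 u) m
                map_add' := by intro u v; simp; abel
                map_smul' := by intro c u; simp [smul_sub] },
      mlieBracket (𝓡 n) (fun p => anchor (𝔡.1 p)) (fun p => anchor (𝔯.1 p)) m), by
    intro f u
    have h := mlieBracket_deriv f.contMDiff 𝔡.2.1 𝔯.2.1 m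
    have h1 : mvfderiv (𝓡 n) (anchorDeriv 𝔯 f) m (anchor (𝔡.1 m)) -
        mvfderiv (𝓡 n) (anchorDeriv 𝔡 f) m (anchor (𝔯.1 m)) =
        mvfderiv (𝓡 n) f m (mlieBracket (𝓡 n) (fun p => anchor (𝔡.1 p))
          (fun p => anchor (𝔯.1 p)) m) := h.symm
    have e1 := op_smulSec (𝔡.1 m) f (act 𝔯 u)
    have e2 := op_smulSec (𝔯.1 m) f (act 𝔡 u)
    have e3 := op_smulSec (𝔡.1 m) (anchorDeriv 𝔯 f) u
    have e4 := op_smulSec (𝔯.1 m) (anchorDeriv 𝔡 f) u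
    have a3 : anchorDeriv 𝔯 f m = mvfderiv (𝓡 n) f m (anchor (𝔯.1 m)) := rfl
    have a4 : anchorDeriv 𝔡 f m = mvfderiv (𝓡 n) f m (anchor (𝔡.1 m)) := rfl
    have c : ∀ (𝔱 : SecD n F E) (w : Sec n F E), act 𝔱 w m = op (𝔱.1 m) w := fun _ _ => rfl
    simp only [LinearMap.coe_mk, AddHom.coe_mk, ← h1, act_smulSec, c, map_add, e1, e2, e3, e4,
      a3, a4]
    module⟩, by
    have : IsManifold (𝓡 n) (((⊤ : ℕ∞) : WithTop ℕ∞) + 1) M := by simpa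
    have hM : IsManifold (𝓡 n) (minSmoothness ℝ 2) M := by
      have : IsManifold (𝓡 n) ∞ M := inferInstance
      exact this.of_le (by simp; exact WithTop.coe_le_coe.2 (le_top : (2 : ℕ∞) ≤ ⊤))
    exact ⟨fun m => ContMDiffAt.mlieBracket_vectorField (m := ⊤) (n := ⊤) (𝔡.2.1 m) (𝔯.2.1 m)
      (by simp), fun u => (act 𝔡 (act 𝔯 u) - act 𝔯 (act 𝔡 u)).contMDiff⟩⟩

/-- The pairing `⟨μ, 𝔡⟩_E ∈ Γ(E)` of sections. -/
def pairSec (μ : SecJ n F E) : SecD n F E →ₗ[ℝ] Sec n F E where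
  toFun 𝔡 := ⟨fun m => pairing (μ.1 m) (𝔡.1 m), μ.2 𝔡⟩
  map_add' a b := by ext m; simp
  map_smul' c a := by ext m; simp

/-- The differential `𝕕 : Γ(E) → Γ(𝔍E)`, `𝕕u = [u]`. -/
def dd (u : Sec n F E) : SecJ n F E :=
  ⟨fun m => jet u m, fun 𝔡 => 𝔡.2.2 u⟩

/-- The Lie derivative `𝔏_𝔡 μ`, given by its pairing with sections `𝔱` of `𝔇E`:
`⟨𝔏_𝔡 μ, 𝔱⟩_E = 𝔡⟨μ, 𝔱⟩_E - ⟨μ, [𝔡, 𝔱]_𝔇⟩_E`. -/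
def lieDerivative (𝔡 : SecD n F E) (μ : SecJ n F E) (𝔱 : SecD n F E) : Sec n F E :=
  act 𝔡 (pairSec μ 𝔱) - pairSec μ (bracketD 𝔡 𝔱)

/-! ### The omni-Lie algebroid `ℰ = 𝔇E ⊕ 𝔍E` -/

variable (n F E) in
/-- The fibre `ℰ_m = (𝔇E)_m ⊕ (𝔍E)_m`. -/
abbrev Omni (m : M) : Type _ := DFiber n F E m × JFiber n F E m

variable (n F E) in
/-- `Γ(ℰ) = Γ(𝔇E) ⊕ Γ(𝔍E)`. -/
abbrev SecOmni : Type _ := SecD n F E × SecJ n F E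

/-- The value at `m` of a section of `ℰ`. -/
def SecOmni.eval (X : SecOmni n F E) (m : M) : Omni n F E m := (X.1.1 m, X.2.1 m)

/-- The symmetric form `(𝔡 + μ, 𝔯 + ν)_E = ½ (⟨ν, 𝔡⟩_E + ⟨μ, 𝔯⟩_E)` on `ℰ_m`. -/
def symmForm {m : M} (a b : Omni n F E m) : E m :=
  (1 / 2 : ℝ) • (pairing b.2 a.1 + pairing a.2 b.1)

/-- `Z` is the Dorfman bracket of `X = 𝔡 + μ` and `Y = 𝔯 + ν`, that is,
`Z = [𝔡, 𝔯]_𝔇 + 𝔏_𝔡 ν - 𝔏_𝔯 μ + 𝕕⟨μ, 𝔯⟩_E`. The identity of the components in `Γ(𝔍E)` is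
expressed by pairing both sides with an arbitrary section of `𝔇E`; this determines `Z`, as every
element of `(𝔇E)_m` is the value of a section. -/
def IsDorfmanBracket (X Y Z : SecOmni n F E) : Prop :=
  Z.1 = bracketD X.1 Y.1 ∧
  ∀ 𝔱 : SecD n F E, pairSec Z.2 𝔱 =
    lieDerivative X.1 Y.2 𝔱 - lieDerivative Y.1 X.2 𝔱 + pairSec (dd (pairSec X.2 Y.1)) 𝔱

/-- A family of subspaces `L_m ⊆ ℰ_m` is a (smooth) subbundle: near each point it has a frame of
smooth sections of `ℰ`. -/
def IsSubbundle (L : ∀ m : M, Submodule ℝ (Omni n F E m)) : Prop :=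
  ∀ m : M, ∃ U ∈ nhds m, ∃ (k : ℕ) (s : Fin k → SecOmni n F E), ∀ p ∈ U,
    LinearIndependent ℝ (fun i => (s i).eval p) ∧
    Submodule.span ℝ (Set.range fun i => (s i).eval p) = L p

/-- A subspace of `ℰ_m` is isotropic if the form `(·, ·)_E` vanishes on it. -/
def IsIsotropic {m : M} (N : Submodule ℝ (Omni n F E m)) : Prop :=
  ∀ a ∈ N, ∀ b ∈ N, symmForm a b = 0

/-- `X ∈ Γ(L)`. -/
def IsSectionOf (L : ∀ m : M, Submodule ℝ (Omni n F E m)) (X : SecOmni n F E) : Prop :=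
  ∀ m, X.eval m ∈ L m

/-- A Dirac structure in `ℰ`: a maximal isotropic subbundle `L ⊆ ℰ` such that `Γ(L)` is closed
under the Dorfman bracket. -/
structure IsDirac (L : ∀ m : M, Submodule ℝ (Omni n F E m)) : Prop where
  subbundle : IsSubbundle L
  maximal_isotropic : ∀ m, Maximal IsIsotropic (L m)
  closed : ∀ X Y : SecOmni n F E, IsSectionOf L X → IsSectionOf L Y →
    ∃ Z : SecOmni n F E, IsDorfmanBracket X Y Z ∧ IsSectionOf L Z

variable (n F E) in
/-- A smooth bundle map `P : 𝔍E → 𝔇E` over the identity of `M`: a family of linear maps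
`(𝔍E)_m → (𝔇E)_m` taking smooth sections to smooth sections. -/
structure BundleMap where
  toFun : ∀ m : M, JFiber n F E m →ₗ[ℝ] DFiber n F E m
  smooth : ∀ μ : SecJ n F E, (fun m => toFun m (μ.1 m)) ∈ SecD n F E

/-- The graph `L_P = {(P(μ), μ) | μ ∈ 𝔍E}`. -/
def BundleMap.graph (P : BundleMap n F E) (m : M) : Submodule ℝ (Omni n F E m) :=
  LinearMap.range ((P.toFun m).prod LinearMap.id)

/-! ### Local Lie algebras and Lie algebroids -/

variable (n F E) in
/-- An `ℝ`-Lie algebra structure on `Γ(E)`. -/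
structure SectionLieBracket where
  bracket : Sec n F E →ₗ[ℝ] Sec n F E →ₗ[ℝ] Sec n F E
  self : ∀ u, bracket u u = 0
  jacobi : ∀ u v w, bracket u (bracket v w) = bracket (bracket u v) w + bracket v (bracket u w)

/-- The support of a section of `E`. -/
def supp (u : Sec n F E) : Set M := closure {m | u m ≠ 0}

variable (n F E) in
/-- A local Lie algebra structure on `E` (a Jacobi line bundle when `E` has rank one): an `ℝ`-Lie
algebra structure on `Γ(E)` such that `supp [u, v] ⊆ supp u ∩ supp v`. -/
structure LocalLieAlgebra extends SectionLieBracket n F E where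
  isLocal : ∀ u v, supp (bracket u v) ⊆ supp u ∩ supp v

variable (n F E) in
/-- A Lie algebroid structure on `E`: an `ℝ`-Lie algebra structure on `Γ(E)` and a smooth bundle
map `ρ : E → TM` such that `[u, f v] = f [u, v] + (ρ(u) f) v` and `ρ[u, v] = [ρ(u), ρ(v)]`. -/
structure LieAlgebroid extends SectionLieBracket n F E where
  rho : ∀ m : M, E m →ₗ[ℝ] TangentSpace (𝓡 n) m
  smooth_rho : ContMDiff ((𝓡 n).prod 𝓘(ℝ, F)) (𝓡 n).tangent ∞
    (fun e : TotalSpace F E =>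
      (TotalSpace.mk' (EuclideanSpace ℝ (Fin n)) e.1 (rho e.1 e.2) : TangentBundle (𝓡 n) M))
  leibniz : ∀ (u v : Sec n F E) (f : C^∞⟮𝓡 n, M; 𝓘(ℝ, ℝ), ℝ⟯) (m : M),
    bracket u (smulSec f v) m = f m • bracket u v m + mvfderiv (𝓡 n) f m (rho m (u m)) • v m
  rho_bracket : ∀ (u v : Sec n F E) (m : M), rho m (bracket u v m) =
    mlieBracket (𝓡 n) (fun p => rho p (u p)) (fun p => rho p (v p)) m

end OmniLie

end

/-! ### Lie brackets on commutative algebras which are differential operators -/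

section Algebra

/-! The core is Kirillov's theorem: a local Lie bracket on the sections of a line bundle is a
differential operator of order at most one in each argument (`apply_eq_zero_of_fderiv_eq_zero`). In
a trivialization the bracket acts on smooth functions. A Peetre argument (`peetre`,
`exists_order_of_isLocal`) bounds its order near a point x₀, except possibly at x₀ itself. The
algebraic theorem `mulComm_mulComm_eq_zero` then brings the order down to one: comparing principal
symbols in [[u, ·], [v, ·]] = [[u, v], ·] shows that the leading coefficients of a symbol of degree
at least two are nilpotent, and a ring of functions is reduced. Continuity recovers x₀.

Consequently [u, v](m) depends only on the 1-jets of u and v at m. In rank one every element of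
(𝔍E)_m is such a jet (`jet_surjective`), so 𝕕u ↦ [u, ·] defines the bundle map π. Skew-symmetry of
the bracket is skewness of π, hence isotropy of the graph, and the graph is maximal since the
pairing of 𝔍E with 𝔇E is nondegenerate. The Jacobi identity says that π is compatible with brackets
on the sections 𝕕u. The defect of compatibility (`bracketDefect`) is tensorial, because π is skew,
so it vanishes on all of Γ(𝔍E), and Γ(L_π) is closed under the Dorfman bracket.

Conversely, for a Dirac graph the Dorfman bracket of π(𝕕u) + 𝕕u and π(𝕕v) + 𝕕v has jet component
𝕕(π(𝕕u)v). Closedness then gives π𝕕[u, v] = [π𝕕u, π𝕕v], which is the Jacobi identity; locality holds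
because jets are local.

Finally, the image of 𝕖 at m consists of the jets of sections vanishing at m. So α ∘ π ∘ 𝕖 = 0 means
that the anchor of [u, ·] at m depends only on u(m), that is, comes from a map ρ : E → TM. -/

theorem coeff_eq_zero_of_forall_nat {k M : Type*} [Field k] [CharZero k] [AddCommGroup M]
    [Module k M] (d : ℕ) (c : ℕ → M)
    (h : ∀ t : ℕ, t ≠ 0 → ∑ i ∈ Finset.range d, (t : k) ^ i • c i = 0) (i : ℕ) (hi : i < d) :
    c i = 0 := by
  -- A linear functional turns the hypothesis into the vanishing of a scalar polynomial at 1, 2, 3,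
  -- ...
  rw [← Module.forall_dual_apply_eq_zero_iff k]
  intro f
  set p : Polynomial k := ∑ i ∈ Finset.range d, Polynomial.monomial i (f (c i)) with hp
  have hp0 : p = 0 := by
    refine Polynomial.eq_zero_of_infinite_isRoot p
      (Set.Infinite.mono (s := Set.range fun t : ℕ => ((t + 1 : ℕ) : k)) ?_ ?_)
    · rintro _ ⟨t, rfl⟩
      have := congrArg f (h (t + 1) (by omega))
      simp only [map_sum, map_smul, smul_eq_mul, map_zero] at this
      simp only [Set.mem_ofPred_eq, Polynomial.IsRoot, hp, Polynomial.eval_finsetSum,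
        Polynomial.eval_monomial]
      rw [← this]
      exact Finset.sum_congr rfl fun i _ => mul_comm _ _
    · refine Set.infinite_range_of_injective fun a b hab => ?_
      have := Nat.cast_injective (R := k) hab
      omega
  have := congrArg (fun q => Polynomial.coeff q i) hp0
  simpa [hp, Polynomial.finsetSum_coeff, Polynomial.coeff_monomial, hi] using this

/-! ### Polarization of identities that are powers of a linear expression -/

section Polarization

variable {k S M : Type*} [Field k] [Ring S] [Algebra k S] [AddCommGroup M]
  [Module k M] (G : S →ₗ[k] M) {X Y : S}

theorem sum_of_add_smul_pow (h : Commute X Y) (m t : ℕ) :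
    G ((X + (t : k) • Y) ^ m) = ∑ i ∈ Finset.range (m + 1),
      (t : k) ^ i • ((m.choose i : k) • G (Y ^ i * X ^ (m - i))) := by
  rw [add_comm, (h.symm.smul_left (t : k)).add_pow, map_sum]
  refine Finset.sum_congr rfl fun i _ => ?_
  rw [smul_pow, smul_mul_assoc, smul_mul_assoc, map_smul, ← nsmul_eq_mul', map_nsmul,
    ← Nat.cast_smul_eq_nsmul k]

/-- This is the constant coefficient in t. The value t = 0 is not assumed, since the identities in
question arise after division by t. -/
theorem polarization_zero [CharZero k] (h : Commute X Y) (m : ℕ)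
    (h0 : ∀ t : ℕ, t ≠ 0 → G ((X + (t : k) • Y) ^ m) = 0) : G (X ^ m) = 0 := by
  have := coeff_eq_zero_of_forall_nat (k := k) (m + 1)
    (fun i => (m.choose i : k) • G (Y ^ i * X ^ (m - i)))
    (fun t ht => by rw [← sum_of_add_smul_pow G h, h0 t ht]) 0 (by omega)
  simpa using this

/-- This is the linear coefficient in t, which carries the factor m + 1, invertible in
characteristic zero. -/
theorem polarization_one [CharZero k] (h : Commute X Y) (m : ℕ)
    (h0 : ∀ t : ℕ, t ≠ 0 → G ((X + (t : k) • Y) ^ (m + 1)) = 0) : G (Y * X ^ m) = 0 := by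
  have := coeff_eq_zero_of_forall_nat (k := k) (m + 2)
    (fun i => ((m + 1).choose i : k) • G (Y ^ i * X ^ (m + 1 - i)))
    (fun t ht => by rw [← sum_of_add_smul_pow G h, h0 t ht]) 1 (by omega)
  simpa [smul_eq_zero, Nat.cast_add_one_ne_zero] using this

end Polarization

/-! ### Differential operators on a commutative algebra, via commutators with multiplications -/

section Operators

variable {k A : Type*} [Field k] [CommRing A] [Algebra k A]

theorem lmul_apply_apply (a b : A) : Algebra.lmul k A a b = a * b := rfl

variable (k) in
/-- The commutator of a `k`-linear operator on the algebra `A` with the multiplication by `φ`. -/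
def mulComm : A →ₗ[k] Module.End k (Module.End k A) where
  toFun φ := LinearMap.mulLeft k (Algebra.lmul k A φ) - LinearMap.mulRight k (Algebra.lmul k A φ)
  map_add' φ ψ := by
    refine LinearMap.ext fun D => ?_
    simp only [map_add, LinearMap.sub_apply, LinearMap.mulLeft_apply, LinearMap.mulRight_apply,
      LinearMap.add_apply, add_mul, mul_add]
    abel
  map_smul' c φ := by
    refine LinearMap.ext fun D => ?_
    simp [smul_sub]

local notation "δ" => mulComm k

theorem mulComm_apply (φ : A) (D : Module.End k A) (w : A) :
    δ φ D w = φ * D w - D (φ * w) := by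
  simp [mulComm]

/-- This commutation is what allows powers of `δ (φ + t ψ)` to be expanded binomially and polarized.
-/
theorem mulComm_commute (φ ψ : A) : Commute (δ φ) (δ ψ) := by
  refine LinearMap.ext fun D => LinearMap.ext fun w => ?_
  simp only [Module.End.mul_apply, mulComm_apply]
  rw [mul_left_comm φ ψ w]
  ring

theorem mulComm_mul (η : A) (D B : Module.End k A) :
    δ η (D * B) = δ η D * B + D * δ η B := by
  refine LinearMap.ext fun w => ?_
  simp [mulComm_apply]

theorem mulComm_lmul (η c : A) : δ η (Algebra.lmul k A c) = 0 := by
  refine LinearMap.ext fun w => ?_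
  simp [mulComm_apply, mul_left_comm]

theorem mulComm_pow_lmul_mul (η c : A) (m : ℕ) (B : Module.End k A) :
    (δ η ^ m) (Algebra.lmul k A c * B) = Algebra.lmul k A c * (δ η ^ m) B := by
  induction m with
  | zero => simp
  | succ m ih => rw [pow_succ', Module.End.mul_apply, ih, mulComm_mul, mulComm_lmul]; simp

/-- The Leibniz formula stops after two terms, because D has order at most one in the direction η.
-/
theorem mulComm_pow_mul {η : A} {D : Module.End k A} (hD : δ η (δ η D) = 0) (m : ℕ)
    (B : Module.End k A) :
    (δ η ^ (m + 1)) (D * B) = (m + 1) • (δ η D * (δ η ^ m) B) + D * (δ η ^ (m + 1)) B := by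
  induction m with
  | zero => simp [mulComm_mul]
  | succ m ih =>
    rw [pow_succ', Module.End.mul_apply, ih, map_add, map_nsmul, mulComm_mul, mulComm_mul, hD,
      zero_mul, zero_add, ← add_assoc, ← Module.End.mul_apply (δ η), ← pow_succ',
      ← Module.End.mul_apply (δ η), ← pow_succ', ← succ_nsmul]

theorem mulComm_pow_mul_eq_sum (η : A) (D B : Module.End k A) (m : ℕ) :
    (δ η ^ m) (D * B) = ∑ i ∈ Finset.range (m + 1),
      m.choose i • ((δ η ^ i) D * (δ η ^ (m - i)) B) := by
  rw [← Finset.Nat.sum_antidiagonal_eq_sum_range_succ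
    (fun i j => m.choose i • ((δ η ^ i) D * (δ η ^ j) B))]
  induction m with
  | zero => simp
  | succ m ih =>
    rw [Finset.sum_antidiagonal_choose_succ_nsmul (fun i j => (δ η ^ i) D * (δ η ^ j) B) m]
    simp only [pow_succ', Module.End.mul_apply, ih, map_sum, map_nsmul, mulComm_mul, smul_add,
      Finset.sum_add_distrib]
    rw [add_comm, add_left_cancel_iff]
    refine Finset.sum_congr rfl fun ⟨i, j⟩ hij => ?_
    rw [m.choose_symm_of_eq_add (Finset.HasAntidiagonal.mem_antidiagonal.1 hij).symm]

/-- An operator commuting with all multiplications is A-linear, hence determined by its value at 1.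
In this way principal symbols become elements of A. -/
theorem eq_lmul_of_mulComm_eq_zero {D : Module.End k A} (h : ∀ ψ, δ ψ D = 0) :
    D = Algebra.lmul k A (D 1) := by
  refine LinearMap.ext fun w => ?_
  have := LinearMap.congr_fun (h w) 1
  rw [mulComm_apply, mul_one, LinearMap.zero_apply, sub_eq_zero] at this
  rw [← this, lmul_apply_apply, mul_comm]

/-- If D has order at most m, then the m-fold commutator with φ is a multiplication operator: the
principal symbol of D at φ, up to a constant factor. -/
theorem mulComm_polarize [CharZero k] {D : Module.End k A} {m : ℕ} (h : ∀ φ, (δ φ ^ (m + 1)) D = 0)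
    (φ ψ : A) : δ ψ ((δ φ ^ m) D) = 0 := by
  have := polarization_one (k := k) (S := Module.End k (Module.End k A)) (LinearMap.applyₗ D :
      Module.End k (Module.End k A) →ₗ[k] _)
    (mulComm_commute φ ψ) m
    (fun t _ => by
      have := h (φ + (t : k) • ψ)
      rw [map_add, map_smul] at this
      exact this)
  simpa using this

/-- Expanding the commutators turns Q into a combination of operators u ↦ c · P u w'. By
skew-symmetry these are -c · P w', and left multiplication does not raise the order. So the
coefficients of P u depend on u through operators of bounded order. -/
theorem mulComm_pow_comp_apply {P : A →ₗ[k] A →ₗ[k] A} (hP : ∀ u, P u u = 0) {N : ℕ}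
    (hN : ∀ φ u, (δ φ ^ N) (P u) = 0) (η φ : A) (j : ℕ) : ∀ (w : A) (Q : Module.End k A),
    (∀ u, Q u = (δ φ ^ j) (P u) w) → (δ η ^ N) Q = 0 := by
  have skew : ∀ u v, P u v = - P v u := fun u v => by
    have := hP (u + v)
    simp only [map_add, LinearMap.add_apply, hP, zero_add, add_zero] at this
    rw [eq_neg_iff_add_eq_zero, add_comm]; exact this
  induction j with
  | zero =>
    intro w Q hQ
    have : Q = - P w := LinearMap.ext fun u => by rw [hQ]; simpa using skew u w
    rw [this, map_neg, hN, neg_zero]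
  | succ j ih =>
    intro w Q hQ
    let ev : A → Module.End k A := fun w =>
      { toFun := fun u => (δ φ ^ j) (P u) w
        map_add' := by intro a b; simp
        map_smul' := by intro a b; simp }
    have : Q = Algebra.lmul k A φ * ev w - ev (φ * w) := LinearMap.ext fun u => by
      rw [hQ, pow_succ', Module.End.mul_apply, mulComm_apply]
      rfl
    rw [this, map_sub, mulComm_pow_lmul_mul, ih w (ev w) (fun _ => rfl),
      ih (φ * w) (ev (φ * w)) (fun _ => rfl)]
    simp

/-- If a Lie bracket is a bidifferential operator of order at most `L + 2`, then it is of order at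
most `L + 1`. -/
theorem mulComm_pow_descent [CharZero k] [IsReduced A] {P : A →ₗ[k] A →ₗ[k] A} (hP : ∀ u, P u u = 0)
    (hJ : ∀ u v w, P (P u v) w = P u (P v w) - P v (P u w)) (L : ℕ)
    (hN : ∀ φ u, (δ φ ^ (L + 3)) (P u) = 0) (φ u : A) : (δ φ ^ (L + 2)) (P u) = 0 := by
  let ev : Module.End k (Module.End k A) →ₗ[k] Module.End k A :=
    { toFun := fun Z =>
        { toFun := fun u => Z (P u) 1
          map_add' := by intro a b; simp
          map_smul' := by intro a b; simp }
      map_add' := by intro a b; rfl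
      map_smul' := by intro a b; rfl }
  have hev : ∀ Z u, ev Z u = Z (P u) 1 := fun _ _ => rfl
  -- `a φ u` is the symbol of degree L + 2 of P u at φ, regarded as an operator in u; `X φ ψ u`
  -- below is its polarization, with one φ replaced by ψ, so that `X φ φ = a φ`.
  set a : A → Module.End k A := fun φ => ev (δ φ ^ (L + 2)) with ha
  have ha1 : ∀ φ u, (δ φ ^ (L + 2)) (P u) = Algebra.lmul k A (a φ u) := fun φ u =>
    eq_lmul_of_mulComm_eq_zero (mulComm_polarize (fun φ => hN φ u) φ)
  set X : A → A → A → A := fun φ ψ u => ev (δ ψ * δ φ ^ (L + 1)) u with hX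
  have hX1 : ∀ φ ψ u, δ ψ ((δ φ ^ (L + 1)) (P u)) = Algebra.lmul k A (X φ ψ u) := by
    intro φ ψ u
    refine eq_lmul_of_mulComm_eq_zero fun χ => ?_
    have h1 : ∀ φ, (δ φ ^ (L + 2)) (δ ψ (P u)) = 0 := fun φ => by
      have := mulComm_polarize (fun φ => hN φ u) φ ψ
      rw [← Module.End.mul_apply, ← ((mulComm_commute φ ψ).pow_left _).eq] at this
      exact this
    have h2 := mulComm_polarize h1 φ χ
    rw [← Module.End.mul_apply (δ ψ), ← ((mulComm_commute φ ψ).pow_left _).eq]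
    exact h2
  -- The Jacobi identity in degree 2L + 3. The left side P (P u v) has no symbol in that degree, as
  -- 2L + 3 ≥ L + 3; on the right the commutator of P u and P v contributes the Poisson bracket of
  -- their symbols.
  have key : ∀ φ u v, X φ (a φ u) v = X φ (a φ v) u := by
    intro φ u v
    have e : P (P u v) = P u * P v - P v * P u := LinearMap.ext fun w => by simp [hJ]
    have z : (δ φ ^ (2 * L + 3)) (P (P u v)) = 0 := by
      rw [show 2 * L + 3 = L + (L + 3) by ring, pow_add, Module.End.mul_apply, hN, map_zero]
    have hz : ∀ i, L + 3 ≤ i → ∀ u, (δ φ ^ i) (P u) = 0 := fun i hi u => by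
      obtain ⟨j, rfl⟩ := Nat.exists_eq_add_of_le' hi
      rw [pow_add, Module.End.mul_apply, hN, map_zero]
    -- In the Leibniz sum both exponents must be at most L + 2, which leaves only the splittings (L
    -- + 1, L + 2) and (L + 2, L + 1), with equal binomial coefficients.
    have prod : ∀ u v, (δ φ ^ (2 * L + 3)) (P u * P v) = ((2 * L + 3).choose (L + 2) : k) •
        ((δ φ ^ (L + 1)) (P u) * Algebra.lmul k A (a φ v) +
          Algebra.lmul k A (a φ u) * (δ φ ^ (L + 1)) (P v)) := by
      intro u v
      rw [mulComm_pow_mul_eq_sum, Finset.sum_eq_add_of_mem (L + 1) (L + 2) (by simp; omega)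
        (by simp; omega) (by omega)]
      · rw [show 2 * L + 3 - (L + 1) = L + 2 by omega, show 2 * L + 3 - (L + 2) = L + 1 by omega,
          Nat.choose_symm_of_eq_add (show 2 * L + 3 = (L + 1) + (L + 2) by ring), ← smul_add, ha1,
          ha1, Nat.cast_smul_eq_nsmul k]
      · intro i hi hne
        rcases lt_or_ge i (L + 1) with h | h
        · rw [hz (2 * L + 3 - i) (by omega)]; simp
        · rw [hz i (by omega)]; simp
    rw [e, map_sub, prod, prod] at z
    have z4 := LinearMap.congr_fun z 1
    rw [LinearMap.sub_apply, LinearMap.smul_apply, LinearMap.smul_apply, ← smul_sub,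
      LinearMap.zero_apply, smul_eq_zero] at z4
    replace z4 := z4.resolve_left
      (by exact_mod_cast (Nat.choose_pos (show L + 2 ≤ 2 * L + 3 by omega)).ne')
    have y1 := LinearMap.congr_fun (hX1 φ (a φ u) v) 1
    have y2 := LinearMap.congr_fun (hX1 φ (a φ v) u) 1
    simp only [mulComm_apply, lmul_apply_apply, mul_one, LinearMap.add_apply,
      Module.End.mul_apply] at y1 y2 z4
    linear_combination z4 - y1 + y2
  -- In its single argument ψ the polarized symbol is a derivation of A, hence an operator of first
  -- order.
  have hXder : ∀ φ v, ∃ D : Module.End k A, (∀ ψ, D ψ = X φ ψ v) ∧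
      ∀ η, δ η D = - Algebra.lmul k A (D η) := by
    intro φ v
    refine ⟨{ toFun := fun ψ => X φ ψ v
              map_add' := by intro a b; simp [hX, hev]
              map_smul' := by intro a b; simp [hX, hev] }, fun _ => rfl, fun η => ?_⟩
    refine LinearMap.ext fun w => ?_
    simp only [mulComm_apply, LinearMap.coe_mk, AddHom.coe_mk, LinearMap.neg_apply,
      lmul_apply_apply]
    have e1 : X φ η v * w = δ η ((δ φ ^ (L + 1)) (P v)) w := by
      rw [hX1]; simp
    rw [e1]
    simp only [hX, hev, Module.End.mul_apply, mulComm_apply, mul_one]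
    ring
  -- A second descent, now on the order of `a φ` as an operator in u: `b η` is its symbol of degree
  -- p at η, which must vanish.
  have step : ∀ p : ℕ, (∀ φ η, (δ η ^ (p + 1)) (a φ) = 0) → ∀ φ η, (δ η ^ p) (a φ) = 0 := by
    intro p hp φ η
    set b : A → A := fun η => (δ η ^ p) (a φ) 1 with hb
    have hb1 : ∀ η, (δ η ^ p) (a φ) = Algebra.lmul k A (b η) := fun η =>
      eq_lmul_of_mulComm_eq_zero (mulComm_polarize (hp φ) η)
    -- The bound on the order of `a φ`, valid for all φ, passes to its polarization.
    have hX0 : ∀ ψ η, (δ η ^ (p + 1)) (ev (δ ψ * δ φ ^ (L + 1))) = 0 := by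
      intro ψ η
      refine polarization_one (k := k) (S := Module.End k (Module.End k A)) ((δ η ^ (p + 1)).comp
          ev) (mulComm_commute φ ψ) (L + 1)
        (fun t _ => ?_)
      have := hp (φ + (t : k) • ψ) η
      simp only [ha, map_add, map_smul] at this
      exact this
    have h3 : ∀ v η, X φ η v * b η = 0 := by
      intro v η
      obtain ⟨D, hD, hD2⟩ := hXder φ v
      -- This is `key` read as an identity of operators in u. The right side has order at most p,
      -- while the composite on the left has symbol of degree p + 1 proportional to `D η * b η`.
      have e : D * a φ = ev (δ (a φ v) * δ φ ^ (L + 1)) := LinearMap.ext fun u => by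
        rw [Module.End.mul_apply, hD]; exact key φ u v
      have e2 : δ η (δ η D) = 0 := by rw [hD2, map_neg, mulComm_lmul, neg_zero]
      have e3 := mulComm_pow_mul e2 p (a φ)
      rw [e, hX0, hp, mul_zero, add_zero, eq_comm, ← Nat.cast_smul_eq_nsmul k, smul_eq_zero] at e3
      have e4 := LinearMap.congr_fun (e3.resolve_left (by exact_mod_cast p.succ_ne_zero)) 1
      rw [hD2, hb1, hD] at e4
      simpa using e4
    -- Replace η by η + tφ in `h3`. Since X φ φ = a φ, multiplication by `b η` kills the part
    -- independent of φ and leaves a factor t, which is cancelled; the constant coefficient in t of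
    -- the rest is the claim.
    have h4 : ∀ v, a φ v * b η * b η = 0 := by
      intro v
      refine polarization_zero (k := k) (S := Module.End k (Module.End k A)) ((Algebra.lmul k A (a
          φ v * b η)).comp
        ((LinearMap.applyₗ (1 : A)).comp (LinearMap.applyₗ (a φ)))) (mulComm_commute η φ) p ?_
      intro t ht
      have h5 := h3 v (η + (t : k) • φ)
      have h6 : X φ (η + (t : k) • φ) v = X φ η v + (t : k) • a φ v := by
        simp only [hX, ha, map_add, map_smul, add_mul, smul_mul_assoc, LinearMap.add_apply,
          LinearMap.smul_apply, ← pow_succ']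
      have h7 : (t : k) • (a φ v * b η * b (η + (t : k) • φ)) = 0 := by
        have := congrArg (· * b η) h5
        simp only [h6, zero_mul, add_mul] at this
        rw [mul_right_comm, h3 v η, zero_mul, zero_add] at this
        rw [← this]
        simp only [smul_mul_assoc]
        rw [mul_right_comm]
      have h8 := (smul_eq_zero.1 h7).resolve_left (by exact_mod_cast ht)
      simp only [hb, map_add, map_smul] at h8
      exact h8
    -- Since v is arbitrary, the symbol at η can be taken in v as well; it turns the remaining
    -- factor into `b η`, and reducedness applies to `b η ^ 3 = 0`.
    have h9 : Algebra.lmul k A (b η * b η) * a φ = 0 := LinearMap.ext fun v => by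
      rw [Module.End.mul_apply, lmul_apply_apply, mul_comm, ← mul_assoc, h4, LinearMap.zero_apply]
    have h10 := congrArg (fun Z => (δ η ^ p) Z 1) h9
    simp only [mulComm_pow_lmul_mul, hb1, map_zero, LinearMap.zero_apply, Module.End.mul_apply,
      lmul_apply_apply, mul_one] at h10
    have h11 : b η = 0 := by
      have : b η ^ 3 = 0 := by rw [← h10]; ring
      exact pow_eq_zero_iff (by norm_num) |>.1 this
    rw [hb1, h11, map_zero]
  -- The descent on p needs a finite starting order, which skew-symmetry provides.
  have start : ∀ φ η, (δ η ^ (L + 3)) (a φ) = 0 := fun φ η =>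
    mulComm_pow_comp_apply hP hN η φ (L + 2) 1 (a φ) (fun _ => rfl)
  have all : ∀ p : ℕ, (∀ φ η, (δ η ^ p) (a φ) = 0) → ∀ φ, a φ = 0 := by
    intro p
    induction p with
    | zero => intro h φ; simpa using h φ 0
    | succ p ih => exact fun h => ih (step p h)
  rw [ha1, all _ start φ]
  simp

/-- A Lie bracket on a reduced commutative algebra which is a bidifferential operator is of order
at most one. -/
theorem mulComm_mulComm_eq_zero [CharZero k] [IsReduced A] {P : A →ₗ[k] A →ₗ[k] A} (hP : ∀ u, P u u
    = 0)
    (hJ : ∀ u v w, P (P u v) w = P u (P v w) - P v (P u w)) (N : ℕ)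
    (hN : ∀ φ u, (δ φ ^ N) (P u) = 0) (φ ψ u : A) : δ φ (δ ψ (P u)) = 0 := by
  have h2 : ∀ L : ℕ, (∀ φ u, (δ φ ^ (L + 2)) (P u) = 0) → ∀ φ u, (δ φ ^ 2) (P u) = 0 := by
    intro L
    induction L with
    | zero => exact fun h => h
    | succ L ih => exact fun h => ih (mulComm_pow_descent hP hJ L h)
  have h3 := h2 N (fun φ u => by rw [add_comm, pow_add, Module.End.mul_apply, hN, map_zero])
  simpa using mulComm_polarize (fun φ => h3 φ u) ψ φ

/-- The Jacobi identity and the bound on the order will be available only over an open set, so the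
theorem is applied to a quotient B of A. The bracket descends to B because the kernel of θ is stable
in both arguments; a linear section of θ suffices to define the quotient bracket. -/
theorem map_mulComm_mulComm_eq_zero {B : Type*} [CommRing B] [Algebra k B] [CharZero k]
    [IsReduced B] {θ : A →ₐ[k] B} (hθ : Function.Surjective θ) {P : A →ₗ[k] A →ₗ[k] A}
    (hP : ∀ u, P u u = 0) (hker : ∀ u v, θ v = 0 → θ (P u v) = 0)
    (hJ : ∀ u v w, θ (P (P u v) w) = θ (P u (P v w) - P v (P u w))) (N : ℕ)
    (hN : ∀ φ u w, θ ((δ φ ^ N) (P u) w) = 0) (φ ψ u w : A) :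
    θ (δ φ (δ ψ (P u)) w) = 0 := by
  obtain ⟨σ, hσ⟩ := θ.toLinearMap.exists_rightInverse_of_surjective (LinearMap.range_eq_top.2 hθ)
  have hσ' : ∀ a, θ (σ a) = a := fun a => LinearMap.congr_fun hσ a
  let Q : B →ₗ[k] B →ₗ[k] B := (P.compl₁₂ σ σ).compr₂ θ.toLinearMap
  have skew : ∀ u v, P u v = - P v u := fun u v => by
    have := hP (u + v)
    simp only [map_add, LinearMap.add_apply, hP, zero_add, add_zero] at this
    rw [eq_neg_iff_add_eq_zero, add_comm]; exact this
  have h2 : ∀ u v v', θ v = θ v' → θ (P u v) = θ (P u v') := by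
    intro u v v' h
    have := hker u (v - v') (by rw [map_sub, h, sub_self])
    rwa [map_sub, map_sub, sub_eq_zero] at this
  have h1 : ∀ u u' v, θ u = θ u' → θ (P u v) = θ (P u' v) := by
    intro u u' v h
    rw [skew u, skew u', map_neg, map_neg, h2 v u u' h]
  have hQ : ∀ u v, Q (θ u) (θ v) = θ (P u v) := fun u v =>
    (h1 _ _ _ (hσ' _)).trans (h2 _ _ _ (hσ' _))
  clear_value Q
  have hpow : ∀ (φ u : A) (N : ℕ) (w : A),
      (mulComm k (θ φ) ^ N) (Q (θ u)) (θ w) = θ ((δ φ ^ N) (P u) w) := by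
    intro φ u N
    induction N with
    | zero => exact fun w => hQ u w
    | succ N ih =>
      intro w
      rw [pow_succ', Module.End.mul_apply, mulComm_apply, ← map_mul, ih, ih, ← map_mul, ← map_sub,
        pow_succ', Module.End.mul_apply, mulComm_apply]
  have main := mulComm_mulComm_eq_zero (P := Q) (hθ.forall.2 fun u => ?_)
    (hθ.forall.2 fun u => hθ.forall.2 fun v => hθ.forall.2 fun w => ?_) N
    (hθ.forall.2 fun φ => hθ.forall.2 fun u => ?_) (θ φ) (θ ψ) (θ u)
  · have := LinearMap.congr_fun main (θ w)
    have e : mulComm k (θ φ) (mulComm k (θ ψ) (Q (θ u))) (θ w) = θ (δ φ (δ ψ (P u)) w) := by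
      simp only [mulComm_apply, map_sub, map_mul, ← hQ]
    rw [← e, this, LinearMap.zero_apply]
  · rw [hQ, hP, map_zero]
  · simp only [hQ, hJ, map_sub]
  · refine LinearMap.ext (hθ.forall.2 fun w => ?_)
    rw [hpow, hN, LinearMap.zero_apply]

end Operators

end Algebra

/-! ### Smooth functions with prescribed germs along a sequence -/

section Flat

variable {E : Type*} [NormedAddCommGroup E] [NormedSpace ℝ E]

/-- The derivatives of order less than `k` of the function `f` vanish at `x`. -/
def FlatAt (k : ℕ) (f : E → ℝ) (x : E) : Prop := ∀ i < k, iteratedFDeriv ℝ i f x = 0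

theorem FlatAt.mono {k l : ℕ} {f : E → ℝ} {x : E} (h : FlatAt k f x) (hl : l ≤ k) :
    FlatAt l f x := fun i hi => h i (hi.trans_le hl)

/-- In each term of the Leibniz formula of order i < k + l, either j < k or i - j < l. -/
theorem FlatAt.mul {k l : ℕ} {f g : E → ℝ} {x : E} (hf : FlatAt k f x) (hg : FlatAt l g x)
    (hf' : ContDiff ℝ ∞ f) (hg' : ContDiff ℝ ∞ g) : FlatAt (k + l) (fun y => f y * g y) x := by
  intro i hi
  rw [← norm_le_zero_iff]
  refine (norm_iteratedFDeriv_mul_le hf' hg' x (n := i)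
    (WithTop.coe_le_coe.2 (le_top : (i : ℕ∞) ≤ ⊤))).trans (Finset.sum_nonpos fun j hj => ?_)
  rcases lt_or_ge j k with h | h
  · rw [hf j h]; simp
  · rw [hg (i - j) (by rw [Finset.mem_range] at hj; omega)]; simp

theorem flatAt_one {f : E → ℝ} {x : E} (h : f x = 0) : FlatAt 1 f x := by
  intro i hi
  obtain rfl : i = 0 := by omega
  ext v
  simpa using h

theorem FlatAt.pow {f : E → ℝ} {x : E} (hf : ContDiff ℝ ∞ f) (h : f x = 0) (k : ℕ) :
    FlatAt k (fun y => f y ^ k) x := by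
  induction k with
  | zero => intro i hi; omega
  | succ k ih =>
    simp only [pow_succ]
    exact ih.mul (flatAt_one h) (hf.pow k) hf

theorem FlatAt.add {k : ℕ} {f g : E → ℝ} {x : E} (hf : FlatAt k f x) (hg : FlatAt k g x)
    (hf' : ContDiff ℝ ∞ f) (hg' : ContDiff ℝ ∞ g) : FlatAt k (f + g) x := by
  intro i hi
  have hi' : ((i : ℕ) : WithTop ℕ∞) ≤ ∞ := WithTop.coe_le_coe.2 (le_top : (i : ℕ∞) ≤ ⊤)
  rw [iteratedFDeriv_add_apply (hf'.contDiffAt.of_le hi') (hg'.contDiffAt.of_le hi'), hf i hi,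
    hg i hi, add_zero]

theorem FlatAt.const_smul {k : ℕ} {f : E → ℝ} {x : E} (hf : FlatAt k f x)
    (hf' : ContDiff ℝ ∞ f) (c : ℝ) : FlatAt k (c • f) x := by
  intro i hi
  have hi' : ((i : ℕ) : WithTop ℕ∞) ≤ ∞ := WithTop.coe_le_coe.2 (le_top : (i : ℕ∞) ≤ ⊤)
  rw [iteratedFDeriv_const_smul_apply (hf'.contDiffAt.of_le hi'), hf i hi, smul_zero]

theorem FlatAt.eq_zero {k : ℕ} {f : E → ℝ} {x : E} (hf : FlatAt (k + 1) f x) : f x = 0 := by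
  have := congrArg (fun D => D 0) (hf 0 (by omega))
  simpa using this

variable [FiniteDimensional ℝ E]

/-- The derivative of order k is bounded on the unit ball, and each step down in the order gains a
factor ‖y - x‖ by the mean value inequality, as the lower derivatives vanish at x. -/
theorem FlatAt.exists_bound {k : ℕ} {f : E → ℝ} {x : E} (hf : FlatAt k f x)
    (hf' : ContDiff ℝ ∞ f) : ∃ M : ℝ, 0 ≤ M ∧ ∀ b ≤ k, ∀ y, ‖y - x‖ ≤ 1 →
      ‖iteratedFDeriv ℝ b f y‖ ≤ M * ‖y - x‖ ^ (k - b) := by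
  have hle : ∀ i : ℕ, ((i : ℕ) : WithTop ℕ∞) ≤ ∞ := fun i =>
    WithTop.coe_le_coe.2 (le_top : (i : ℕ∞) ≤ ⊤)
  obtain ⟨M, hM⟩ := (isCompact_closedBall x 1).exists_bound_of_continuousOn
    (hf'.continuous_iteratedFDeriv (hle k)).continuousOn
  have hM0 : 0 ≤ M := (norm_nonneg _).trans (hM x (by simp))
  have key : ∀ j ≤ k, ∀ y, ‖y - x‖ ≤ 1 → ‖iteratedFDeriv ℝ (k - j) f y‖ ≤ M * ‖y - x‖ ^ j := by
    intro j
    induction j with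
    | zero =>
      intro _ y hy
      simpa using hM y (by simpa [dist_eq_norm] using hy)
    | succ j ih =>
      intro hj y hy
      have hd : ∀ z, DifferentiableAt ℝ (iteratedFDeriv ℝ (k - (j + 1)) f) z := fun z =>
        hf'.contDiffAt.differentiableAt_iteratedFDeriv
          (WithTop.coe_lt_coe.2 (ENat.natCast_lt_top _))
      have h1 := (convex_closedBall x ‖y - x‖).norm_image_sub_le_of_norm_fderiv_le
        (f := iteratedFDeriv ℝ (k - (j + 1)) f) (C := M * ‖y - x‖ ^ j) (𝕜 := ℝ)
        (fun z _ => hd z) (fun z hz => ?_) (Metric.mem_closedBall_self (norm_nonneg _))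
        (show y ∈ _ by simp [dist_eq_norm])
      · rw [hf _ (by omega), sub_zero] at h1
        rw [pow_succ, ← mul_assoc]
        exact h1
      · have hz' : ‖z - x‖ ≤ ‖y - x‖ := by simpa [dist_eq_norm] using hz
        rw [norm_fderiv_iteratedFDeriv, show k - (j + 1) + 1 = k - j by omega]
        refine (ih (by omega) z (hz'.trans hy)).trans ?_
        gcongr
  refine ⟨M, hM0, fun b hb y hy => ?_⟩
  have := key (k - b) (by omega) y hy
  rwa [show k - (k - b) = b by omega] at this

/-- A function which is flat at `x` can be modified away from `x` to be small and supported in a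
small ball. -/
theorem FlatAt.exists_small {k : ℕ} {f : E → ℝ} {x : E} (hf : FlatAt k f x)
    (hf' : ContDiff ℝ ∞ f) {r ε : ℝ} (hr : 0 < r) (hε : 0 < ε) :
    ∃ h : E → ℝ, ContDiff ℝ ∞ h ∧ h =ᶠ[nhds x] f ∧ (∀ y, r ≤ ‖y - x‖ → h y = 0) ∧
      ∀ i < k, ∀ y, ‖iteratedFDeriv ℝ i h y‖ ≤ ε := by
  have hle : ∀ i : ℕ, ((i : ℕ) : WithTop ℕ∞) ≤ ∞ := fun i =>
    WithTop.coe_le_coe.2 (le_top : (i : ℕ∞) ≤ ⊤)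
  obtain ⟨M, hM0, hM⟩ := hf.exists_bound hf'
  let χ : ContDiffBump (0 : E) := ⟨1, 2, by norm_num, by norm_num⟩
  have hχ : ContDiff ℝ ∞ χ := χ.contDiff
  obtain ⟨C, hC0, hC⟩ : ∃ C : ℝ, 0 ≤ C ∧ ∀ a ≤ k, ∀ y, ‖iteratedFDeriv ℝ a χ y‖ ≤ C := by
    choose C hC using fun a : ℕ => (χ.hasCompactSupport.iteratedFDeriv (𝕜 := ℝ)
        a).exists_bound_of_continuous
      (hχ.continuous_iteratedFDeriv (hle a))
    have h0 : ∀ a, 0 ≤ C a := fun a => (norm_nonneg _).trans (hC a 0)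
    exact ⟨∑ a ∈ Finset.range (k + 1), C a, Finset.sum_nonneg fun a _ => h0 a, fun a ha y =>
      (hC a y).trans (Finset.single_le_sum (f := C) (fun a _ => h0 a) (by simp; omega))⟩
  -- One factor 2 ^ k bounds the sum of the binomial coefficients, the other comes from the radius
  -- 2ρ of the support of the cutoff.
  obtain ⟨ρ, hρ0, hρ1, hρr, hρε⟩ : ∃ ρ : ℝ, 0 < ρ ∧ 2 * ρ ≤ 1 ∧ 2 * ρ < r ∧
      2 ^ k * C * M * 2 ^ k * ρ ≤ ε := by
    have h0 : 0 ≤ 2 ^ k * C * M * 2 ^ k := by positivity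
    refine ⟨min (1 / 2) (min (r / 3) (ε / (2 ^ k * C * M * 2 ^ k + 1))), ?_, ?_, ?_, ?_⟩
    · positivity
    · linarith [min_le_left (1 / 2 : ℝ) (min (r / 3) (ε / (2 ^ k * C * M * 2 ^ k + 1)))]
    · have := (min_le_right (1 / 2 : ℝ) (min (r / 3) (ε / (2 ^ k * C * M * 2 ^ k + 1)))).trans
        (min_le_left _ _)
      linarith
    · have := (min_le_right (1 / 2 : ℝ) (min (r / 3) (ε / (2 ^ k * C * M * 2 ^ k + 1)))).trans
        (min_le_right _ _)
      refine (mul_le_mul_of_nonneg_left this h0).trans ?_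
      rw [mul_div_assoc', div_le_iff₀ (by positivity)]
      nlinarith
  set c : E → ℝ := fun y => χ (ρ⁻¹ • (y - x)) with hc
  have hc' : ContDiff ℝ ∞ c := hχ.comp ((contDiff_id.sub contDiff_const).const_smul _)
  have hcd : ∀ a y, ‖iteratedFDeriv ℝ a c y‖ = ρ⁻¹ ^ a * ‖iteratedFDeriv ℝ a χ (ρ⁻¹ • (y - x))‖ :=
      by
    intro a y
    have h1 := iteratedFDeriv_comp_sub (𝕜 := ℝ) (f := fun z => χ (ρ⁻¹ • z)) a x y
    rw [show iteratedFDeriv ℝ a c y = _ from h1, iteratedFDeriv_comp_const_smul _ (hχ.of_le (hle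
        a))]
    rw [norm_smul, norm_pow, Real.norm_of_nonneg (by positivity)]
  have hc0 : ∀ y, 2 * ρ ≤ ‖y - x‖ → c y = 0 := by
    intro y hy
    refine χ.zero_of_le_dist ?_
    rw [dist_zero_right, norm_smul, Real.norm_of_nonneg (by positivity), inv_mul_eq_div,
      le_div_iff₀ hρ0]
    exact hy
  refine ⟨fun y => c y * f y, hc'.mul hf', ?_, fun y hy => by
    simp only; rw [hc0 y (by linarith), zero_mul], fun i hi y => ?_⟩
  · filter_upwards [Metric.closedBall_mem_nhds x hρ0] with y hy
    have : c y = 1 := by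
      refine χ.one_of_mem_closedBall ?_
      rw [mem_closedBall_zero_iff, norm_smul, Real.norm_of_nonneg (by positivity), inv_mul_eq_div,
        div_le_iff₀ hρ0]
      simpa [dist_eq_norm, χ] using hy
    rw [this, one_mul]
  · rcases le_or_gt ‖y - x‖ (2 * ρ) with hy | hy
    · refine (norm_iteratedFDeriv_mul_le hc' hf' y (n := i) (hle i)).trans ?_
      -- Differentiating the cutoff j times costs ρ⁻¹ ^ j, whereas flatness of f yields ρ ^ (k - i +
      -- j). At least one factor ρ is left because i < k.
      have h1 : ∀ j ∈ Finset.range (i + 1), (i.choose j : ℝ) * ‖iteratedFDeriv ℝ j c y‖ *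
          ‖iteratedFDeriv ℝ (i - j) f y‖ ≤ (i.choose j : ℝ) * (C * M * 2 ^ k * ρ) := by
        intro j hj
        have hj' : j ≤ i := by simpa [Nat.lt_succ_iff] using hj
        rw [mul_assoc]
        refine mul_le_mul_of_nonneg_left ?_ (by positivity)
        rw [hcd]
        have h2 : ‖iteratedFDeriv ℝ (i - j) f y‖ ≤ M * (2 * ρ) ^ (k - (i - j)) :=
          (hM (i - j) (by omega) y (hy.trans hρ1)).trans (by gcongr)
        calc ρ⁻¹ ^ j * ‖iteratedFDeriv ℝ j χ (ρ⁻¹ • (y - x))‖ * ‖iteratedFDeriv ℝ (i - j) f y‖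
            ≤ ρ⁻¹ ^ j * C * (M * (2 * ρ) ^ (k - (i - j))) := by
              gcongr
              exact hC j (by omega) _
          _ = C * M * 2 ^ (k - (i - j)) * (ρ⁻¹ ^ j * ρ ^ j * ρ ^ (k - i)) := by
              rw [show k - (i - j) = j + (k - i) by omega, mul_pow, pow_add ρ]
              ring
          _ = C * M * 2 ^ (k - (i - j)) * ρ ^ (k - i) := by
              rw [← mul_pow, inv_mul_cancel₀ hρ0.ne', one_pow, one_mul]
          _ ≤ C * M * 2 ^ k * ρ := by
              gcongr
              · norm_num
              · omega
              · exact pow_le_of_le_one hρ0.le (by linarith) (by omega)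
      refine (Finset.sum_le_sum h1).trans ?_
      rw [← Finset.sum_mul]
      have h3 : (∑ j ∈ Finset.range (i + 1), (i.choose j : ℝ)) ≤ 2 ^ k := by
        have : (∑ j ∈ Finset.range (i + 1), (i.choose j : ℝ)) = 2 ^ i := by
          exact_mod_cast Nat.sum_range_choose i
        rw [this]
        exact pow_le_pow_right₀ (by norm_num) hi.le
      refine (mul_le_mul_of_nonneg_right h3 (by positivity)).trans ?_
      rw [← mul_assoc, ← mul_assoc, ← mul_assoc]
      exact hρε
    · have : (fun y => c y * f y) =ᶠ[nhds y] fun _ => 0 := by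
        have : ∀ᶠ z in nhds y, 2 * ρ < ‖z - x‖ :=
          (continuous_id.sub continuous_const).norm.continuousAt.eventually_const_lt hy
        filter_upwards [this] with z hz
        rw [hc0 z hz.le, zero_mul]
      rw [(this.iteratedFDeriv ℝ i).eq_of_nhds]
      simpa [iteratedFDeriv_fun_zero] using hε.le

/-- Along a convergent sequence of distinct points there is a smooth function with prescribed
germs, provided that these are flat of increasing order. -/
theorem exists_contDiff_eventuallyEq_of_flatAt {x : ℕ → E} {x₀ : E} (hx : Function.Injective x)
    (hx₀ : ∀ j, x j ≠ x₀) (hlim : Filter.Tendsto x Filter.atTop (nhds x₀)) (f : ℕ → E → ℝ)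
    (hf : ∀ j, ContDiff ℝ ∞ (f j)) (hflat : ∀ j, FlatAt j (f j) (x j)) :
    ∃ F : E → ℝ, ContDiff ℝ ∞ F ∧ ∀ j, F =ᶠ[nhds (x j)] f j := by
  -- The tail of the sequence is close to x₀, hence far from x j; only finitely many other points
  -- remain. The factor 2 makes the balls of radii r i and r j disjoint.
  have sep : ∀ j, ∃ r : ℝ, 0 < r ∧ ∀ i, i ≠ j → 2 * r ≤ dist (x i) (x j) := by
    intro j
    have h1 : ∀ᶠ i in Filter.atTop, dist (x j) x₀ / 2 ≤ dist (x i) (x j) := by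
      have hd : 0 < dist (x j) x₀ := dist_pos.2 (hx₀ j)
      have h2 := (hlim.dist (tendsto_const_nhds (x := x j))).eventually_const_lt
        (show dist (x j) x₀ / 2 < dist x₀ (x j) by rw [dist_comm x₀]; linarith)
      exact h2.mono fun i hi => hi.le
    obtain ⟨N, hN⟩ := Filter.eventually_atTop.1 h1
    have h3 : ∀ s : Finset ℕ, ∃ r : ℝ, 0 < r ∧ ∀ i ∈ s, i ≠ j → r ≤ dist (x i) (x j) := by
      intro s
      induction s using Finset.induction_on with
      | empty => exact ⟨1, one_pos, by simp⟩
      | insert a s _ ih =>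
        obtain ⟨r, hr, h⟩ := ih
        by_cases ha : a = j
        · refine ⟨r, hr, fun i hi hij => h i ((Finset.mem_insert.1 hi).resolve_left ?_) hij⟩
          rintro rfl; exact hij ha
        · refine ⟨min r (dist (x a) (x j)), lt_min hr (dist_pos.2 (hx.ne ha)), fun i hi hij => ?_⟩
          rcases Finset.mem_insert.1 hi with rfl | hi
          · exact min_le_right _ _
          · exact (min_le_left _ _).trans (h i hi hij)
    obtain ⟨r, hr, h⟩ := h3 (Finset.range N)
    have hd : 0 < dist (x j) x₀ := dist_pos.2 (hx₀ j)
    refine ⟨min (r / 2) (dist (x j) x₀ / 4), by positivity, fun i hij => ?_⟩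
    rcases lt_or_ge i N with hi | hi
    · linarith [min_le_left (r / 2) (dist (x j) x₀ / 4), h i (by simpa using hi) hij]
    · linarith [min_le_right (r / 2) (dist (x j) x₀ / 4), hN i hi]
  choose r hr hsep using sep
  choose h hh hhf hh0 hhb using fun j =>
    (hflat j).exists_small (hf j) (hr j) (ε := (1 / 2) ^ j) (by positivity)
  have disj : ∀ i j, i ≠ j → ∀ y, dist y (x j) < r j → h i y = 0 := by
    intro i j hij y hy
    refine hh0 i y ?_
    by_contra hlt
    push Not at hlt
    rw [← dist_eq_norm] at hlt
    have h1 := hsep j i hij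
    have h2 := hsep i j hij.symm
    rw [dist_comm] at h2
    have := dist_triangle_left (x i) (x j) y
    linarith
  refine ⟨fun y => ∑' i, h i y, ?_, fun j => ?_⟩
  -- The bound on derivatives of order k holds for all terms with i > k, so the series of
  -- derivatives of each order converges uniformly after finitely many terms are dropped.
  · refine contDiff_tsum_of_eventually (N := ⊤) (v := fun _ i => (1 / 2 : ℝ) ^ i) hh
      (fun k _ => summable_geometric_two) (fun k _ => ?_)
    rw [Nat.cofinite_eq_atTop]
    filter_upwards [Filter.eventually_gt_atTop k] with i hi y
    exact hhb i k hi y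
  · refine Filter.EventuallyEq.trans ?_ (hhf j)
    filter_upwards [Metric.ball_mem_nhds (x j) (hr j)] with y hy
    exact tsum_eq_single j fun i hij => disj i j hij y hy

end Flat

/-! ### Hadamard's lemma -/

section Hadamard

/-- Differentiation under the integral sign, iterated. The target F is quantified inside the
induction because the derivative takes values in E →L[ℝ] F. -/
theorem contDiff_intervalIntegral_of_contDiff {E : Type} [NormedAddCommGroup E]
    [NormedSpace ℝ E] [FiniteDimensional ℝ E] (k : ℕ) : ∀ {F : Type} [NormedAddCommGroup F]
    [NormedSpace ℝ F] {G : E → ℝ → F},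
    ContDiff ℝ ∞ (fun p : E × ℝ => G p.1 p.2) → ContDiff ℝ k (fun x => ∫ t in (0 : ℝ)..1, G x t) :=
        by
  induction k with
  | zero =>
    intro F _ _ G hG
    exact contDiff_zero.2
      (intervalIntegral.continuous_parametric_intervalIntegral_of_continuous' hG.continuous 0 1)
  | succ k ih =>
    intro F _ _ G hG
    set G' : E → ℝ → E →L[ℝ] F := fun x t =>
      (fderiv ℝ (fun p : E × ℝ => G p.1 p.2) (x, t)).comp (ContinuousLinearMap.inl ℝ E ℝ) with hG'
    have hG's : ContDiff ℝ ∞ (fun p : E × ℝ => G' p.1 p.2) :=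
      (hG.fderiv_right (m := ∞) (by simp)).clm_comp contDiff_const
    have hd : ∀ x t, HasFDerivAt (fun x => G x t) (G' x t) x := fun x t =>
      HasFDerivAt.comp (g := fun p : E × ℝ => G p.1 p.2) (f := fun e => (e, t)) x
        (hG.differentiable (by simp) (x, t)).hasFDerivAt (hasFDerivAt_prodMk_left x t)
    have hint : ∀ x, HasFDerivAt (fun x => ∫ t in (0 : ℝ)..1, G x t)
        (∫ t in (0 : ℝ)..1, G' x t) x := by
      intro x
      obtain ⟨M, hM⟩ := ((isCompact_closedBall x 1).prod
        (isCompact_Icc (a := (0 : ℝ)) (b := 1))).exists_bound_of_continuousOn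
        hG's.continuous.continuousOn
      have hGc : ∀ y, Continuous (G y) := fun y =>
        hG.continuous.comp (Continuous.prodMk_right y)
      have hGc' : ∀ y, Continuous (G' y) := fun y =>
        hG's.continuous.comp (Continuous.prodMk_right y)
      refine intervalIntegral.hasFDerivAt_integral_of_dominated_of_fderiv_le
        (bound := fun _ => M) (Metric.closedBall_mem_nhds x one_pos)
        (Filter.Eventually.of_forall fun y => (hGc y).aestronglyMeasurable)
        ((hGc x).intervalIntegrable _ _) (hGc' x).aestronglyMeasurable
        (Filter.Eventually.of_forall fun t ht y hy => hM (y, t) ⟨hy, ?_⟩)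
        (intervalIntegrable_const) (Filter.Eventually.of_forall fun t _ y _ => hd y t)
      rw [Set.uIoc_of_le zero_le_one] at ht
      exact ⟨ht.1.le, ht.2⟩
    have he : fderiv ℝ (fun x => ∫ t in (0 : ℝ)..1, G x t) = fun x => ∫ t in (0 : ℝ)..1, G' x t :=
      funext fun x => (hint x).fderiv
    rw [Nat.cast_succ, contDiff_succ_iff_fderiv]
    refine ⟨fun x => (hint x).differentiableAt, by simp, ?_⟩
    rw [he]
    exact ih hG's

/-- Integrate the derivative of f along the segment from a to y. -/
theorem exists_hadamard {n : ℕ} {f : EuclideanSpace ℝ (Fin n) → ℝ} (hf : ContDiff ℝ ∞ f)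
    (a : EuclideanSpace ℝ (Fin n)) :
    ∃ g : Fin n → EuclideanSpace ℝ (Fin n) → ℝ, (∀ i, ContDiff ℝ ∞ (g i)) ∧
      (∀ y, f y = f a + ∑ i, (y i - a i) * g i y) ∧
      ∀ i, g i a = fderiv ℝ f a (EuclideanSpace.single i 1) := by
  have hsm : ∀ i, ContDiff ℝ ∞ (fun p : EuclideanSpace ℝ (Fin n) × ℝ =>
      fderiv ℝ f (a + p.2 • (p.1 - a)) (EuclideanSpace.single i 1)) := fun i =>
    ((hf.fderiv_right (m := ∞) (by simp)).comp (by fun_prop)).clm_apply contDiff_const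
  refine ⟨fun i y => ∫ t in (0 : ℝ)..1,
    fderiv ℝ f (a + t • (y - a)) (EuclideanSpace.single i 1), fun i => ?_, fun y => ?_,
    fun i => ?_⟩
  · refine contDiff_iff_forall_nat_le.2 fun m _ => ?_
    exact contDiff_intervalIntegral_of_contDiff m
      (G := fun y t => fderiv ℝ f (a + t • (y - a)) (EuclideanSpace.single i 1)) (hsm i)
  · have hder : ∀ t : ℝ, HasDerivAt (fun t : ℝ => f (a + t • (y - a)))
        (fderiv ℝ f (a + t • (y - a)) (y - a)) t := by
      intro t
      have h1 : HasDerivAt (fun t : ℝ => a + t • (y - a)) (y - a) t := by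
        simpa using ((hasDerivAt_id t).smul_const (y - a)).const_add a
      exact (hf.differentiable (by simp) _).hasFDerivAt.comp_hasDerivAt t h1
    have hcont : ∀ v, Continuous fun t : ℝ => fderiv ℝ f (a + t • (y - a)) v := fun v =>
      ((hf.continuous_fderiv (by simp)).comp (by fun_prop)).clm_apply continuous_const
    have := intervalIntegral.integral_eq_sub_of_hasDerivAt (a := 0) (b := 1) (fun t _ => hder t)
      ((hcont _).intervalIntegrable _ _)
    simp only [one_smul, zero_smul, add_zero, add_sub_cancel] at this
    rw [← sub_eq_iff_eq_add', ← this]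
    have hsum : ∀ t : ℝ, fderiv ℝ f (a + t • (y - a)) (y - a) =
        ∑ i, (y i - a i) * fderiv ℝ f (a + t • (y - a)) (EuclideanSpace.single i 1) := by
      intro t
      have hy : y - a = ∑ i, (y i - a i) • EuclideanSpace.single i (1 : ℝ) := by
        ext j
        simp [Finset.sum_apply, Pi.single_apply]
      generalize fderiv ℝ f (a + t • (y - a)) = D
      rw [hy, map_sum]
      simp
    simp_rw [hsum]
    rw [intervalIntegral.integral_finsetSum fun i _ =>
      ((hcont _).const_mul _).intervalIntegrable _ _]
    exact Finset.sum_congr rfl fun i _ => intervalIntegral.integral_const_mul _ _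
  · simp

end Hadamard

/-! ### Local bilinear operators on smooth functions -/

noncomputable section Peetre

/-- The algebra of smooth functions on a normed space. -/
abbrev SmoothFn (E : Type*) [NormedAddCommGroup E] [NormedSpace ℝ E] : Type _ :=
  C^∞⟮𝓘(ℝ, E), E; 𝓘(ℝ, ℝ), ℝ⟯

section

variable {E : Type*} [NormedAddCommGroup E]

theorem SmoothFn.contDiff [NormedSpace ℝ E] (u : SmoothFn E) : ContDiff ℝ ∞ u :=
    u.contMDiff.contDiff

/-- Each point is chosen strictly closer to x₀ than its predecessor, which makes the sequence
injective, and within 1 / (j + 2), which makes it converge. -/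
theorem exists_seq_of_frequently_punctured {x₀ : E} {q : ℕ → E → Prop}
    (h : ∀ j, ∃ᶠ x in nhdsWithin x₀ {x₀}ᶜ, q j x) :
    ∃ x : ℕ → E, Function.Injective x ∧ (∀ j, x j ≠ x₀) ∧
      Filter.Tendsto x Filter.atTop (nhds x₀) ∧ ∀ j, q j (x j) := by
  have h1 : ∀ (j : ℕ) (ε : ℝ), 0 < ε → ∃ x, x ≠ x₀ ∧ dist x x₀ < ε ∧ q j x := by
    intro j ε hε
    obtain ⟨x, hq, hx, hd⟩ := ((h j).and_eventually
      (Filter.eventually_and.2 ⟨self_mem_nhdsWithin,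
        mem_nhdsWithin_of_mem_nhds (Metric.ball_mem_nhds x₀ hε)⟩)).exists
    exact ⟨x, hx, hd, hq⟩
  choose X hX hXd hXq using h1
  let next : ℕ → {x : E // x ≠ x₀} → {x : E // x ≠ x₀} := fun j y =>
    ⟨X (j + 1) (min (dist y.1 x₀) (1 / (j + 2))) (lt_min (dist_pos.2 y.2) (by positivity)), hX _ _
        _⟩
  let Z : ℕ → {x : E // x ≠ x₀} := fun j =>
    Nat.rec ⟨X 0 1 one_pos, hX _ _ _⟩ (fun j y => next j y) j
  have hZ : ∀ j, Z (j + 1) = next j (Z j) := fun j => rfl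
  have hanti : StrictAnti fun j => dist (Z j).1 x₀ := strictAnti_nat_of_succ_lt fun j => by
    rw [hZ]
    exact (hXd _ _ _).trans_le (min_le_left _ _)
  refine ⟨fun j => (Z j).1, fun i j hij => hanti.injective (by simp only at hij ⊢; rw [hij]),
    fun j => (Z j).2, ?_, fun j => ?_⟩
  · rw [tendsto_iff_dist_tendsto_zero, ← Filter.tendsto_add_atTop_iff_nat 1]
    refine squeeze_zero (fun _ => dist_nonneg) (fun j => ?_) tendsto_one_div_add_atTop_nhds_zero_nat
    rw [hZ]
    refine ((hXd _ _ _).trans_le (min_le_right _ _)).le.trans ?_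
    gcongr
    norm_num
  · cases j with
    | zero => exact hXq 0 1 one_pos
    | succ j => exact hXq (j + 1) _ _

variable [NormedSpace ℝ E] [FiniteDimensional ℝ E]

/-- A form of Peetre's theorem. -/
theorem peetre {T : SmoothFn E → SmoothFn E → SmoothFn E}
    (hsmul : ∀ (c : ℝ) u v, T (c • u) v = c • T u v)
    (hloc : ∀ (u u' v v' : SmoothFn E) (x : E), u =ᶠ[nhds x] u' → v =ᶠ[nhds x] v' →
      T u v x = T u' v' x) (x₀ : E) :
    ∃ k : ℕ, ∀ᶠ x in nhdsWithin x₀ {x₀}ᶜ, ∀ u v : SmoothFn E, FlatAt k u x → FlatAt k v x →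
      T u v x = 0 := by
  by_contra hcon
  push Not at hcon
  obtain ⟨x, hinj, hne, hlim, hq⟩ := exists_seq_of_frequently_punctured hcon
  choose u v hu hv huv using hq
  -- The counterexamples are flat of increasing order along a sequence, so they can be glued.
  -- Rescaling makes the value of T at x j equal to j, against the continuity of T F' G' at x₀.
  obtain ⟨F, hF, hFu⟩ := exists_contDiff_eventuallyEq_of_flatAt hinj hne hlim
    (fun j => ((j : ℝ) / T (u j) (v j) (x j)) • (u j : E → ℝ))
    (fun j => contDiff_const.smul (u j).contDiff)
    (fun j => (hu j).const_smul (u j).contDiff _)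
  obtain ⟨G, hG, hGv⟩ := exists_contDiff_eventuallyEq_of_flatAt hinj hne hlim
    (fun j => v j) (fun j => (v j).contDiff) hv
  let F' : SmoothFn E := ⟨F, hF.contMDiff⟩
  let G' : SmoothFn E := ⟨G, hG.contMDiff⟩
  have h1 : ∀ j, T F' G' (x j) = j := by
    intro j
    rw [hloc F' (((j : ℝ) / T (u j) (v j) (x j)) • u j) G' (v j) (x j) (hFu j) (hGv j), hsmul]
    exact div_mul_cancel₀ _ (huv j)
  have h2 : Filter.Tendsto (fun j => T F' G' (x j)) Filter.atTop (nhds (T F' G' x₀)) :=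
    (T F' G').contDiff.continuous.continuousAt.tendsto.comp hlim
  simp only [h1] at h2
  exact not_tendsto_nhds_of_tendsto_atTop tendsto_natCast_atTop_atTop _ h2

end

variable {n : ℕ}

local notation "V" => EuclideanSpace ℝ (Fin n)

/-- The `i`-th coordinate function. -/
def coordFn (i : Fin n) : SmoothFn V :=
  ⟨fun y => y i, (contDiff_euclidean.1 contDiff_id i).contMDiff⟩

theorem SmoothFn.exists_hadamard (f : SmoothFn V) (a : V) :
    ∃ g : Fin n → SmoothFn V,
      f = algebraMap ℝ _ (f a) + ∑ i, (coordFn i - algebraMap ℝ _ (a i)) * g i ∧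
      ∀ i, g i a = fderiv ℝ f a (EuclideanSpace.single i 1) := by
  obtain ⟨g, hg, h1, h2⟩ := _root_.exists_hadamard f.contDiff a
  refine ⟨fun i => ⟨g i, (hg i).contMDiff⟩, ?_, h2⟩
  have hs : ∀ (s : Finset (Fin n)) (F : Fin n → SmoothFn V) (y : V),
      (∑ i ∈ s, F i) y = ∑ i ∈ s, F i y := fun s F y => by
    classical
    induction s using Finset.induction_on with
    | empty => simp
    | insert a s ha ih => rw [Finset.sum_insert ha, Finset.sum_insert ha, ← ih]; rfl
  ext y
  rw [ContMDiffMap.coe_add, Pi.add_apply, hs]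
  exact h1 y

variable (n) in
/-- The affine functions. -/
def affineFn : Submodule ℝ (SmoothFn V) :=
  Submodule.span ℝ (insert 1 (Set.range coordFn))

theorem one_mem_affineFn : (1 : SmoothFn V) ∈ affineFn n :=
  Submodule.subset_span (Set.mem_insert _ _)

theorem coordFn_sub_mem_affineFn (i : Fin n) (c : ℝ) :
    coordFn i - algebraMap ℝ (SmoothFn V) c ∈ affineFn n := by
  refine sub_mem (Submodule.subset_span (Set.mem_insert_of_mem _ ⟨i, rfl⟩)) ?_
  rw [Algebra.algebraMap_eq_smul_one]
  exact Submodule.smul_mem _ _ one_mem_affineFn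

theorem affineFn_fg : (affineFn n).FG :=
  Submodule.fg_span ((Set.finite_range _).insert _)

/-- The submodule of the functions which are flat at `x`. -/
def flatFn (k : ℕ) (x : V) : Submodule ℝ (SmoothFn V) where
  carrier := {u | FlatAt k u x}
  add_mem' {a b} ha hb := ha.add hb a.contDiff b.contDiff
  zero_mem' := fun i _ => by
    have : ((0 : SmoothFn V) : V → ℝ) = fun _ => 0 := rfl
    rw [this, iteratedFDeriv_fun_zero]; rfl
  smul_mem' c a ha := ha.const_smul a.contDiff c

/-- Hadamard's lemma iterated. The space `affineFn n ^ k` of polynomials is finitely generated and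
does not depend on x, which is what the reduction to finitely many operators needs. -/
theorem exists_taylor (k : ℕ) (x : V) : ∀ u : SmoothFn V,
    ∃ q ∈ affineFn n ^ k, u - q ∈ flatFn (k + 1) x := by
  induction k with
  | zero =>
    intro u
    refine ⟨algebraMap ℝ _ (u x), ?_, ?_⟩
    · rw [pow_zero]; exact Submodule.algebraMap_mem _
    · refine flatAt_one ?_
      exact sub_self (u x)
  | succ k ih =>
    intro u
    obtain ⟨g, hg, -⟩ := u.exists_hadamard x
    choose q hq hr using ih
    refine ⟨algebraMap ℝ _ (u x) + ∑ i, (coordFn i - algebraMap ℝ _ (x i)) * q (g i), ?_, ?_⟩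
    · refine add_mem ?_ (sum_mem fun i _ => ?_)
      · rw [Algebra.algebraMap_eq_smul_one]
        refine Submodule.smul_mem _ _ ?_
        simpa using Submodule.pow_mem_pow _ (one_mem_affineFn (n := n)) (k + 1)
      · rw [pow_succ']
        exact Submodule.mul_mem_mul (coordFn_sub_mem_affineFn i _) (hq _)
    · have : u - (algebraMap ℝ _ (u x) + ∑ i, (coordFn i - algebraMap ℝ _ (x i)) * q (g i)) =
          ∑ i, (coordFn i - algebraMap ℝ (SmoothFn V) (x i)) * (g i - q (g i)) := by
        rw [← sub_sub, sub_eq_iff_eq_add'.2 hg, ← Finset.sum_sub_distrib]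
        exact Finset.sum_congr rfl fun i _ => (mul_sub _ _ _).symm
      rw [this]
      refine sum_mem fun i _ => ?_
      have h1 : FlatAt 1 (coordFn i - algebraMap ℝ (SmoothFn V) (x i) : SmoothFn V) x :=
        flatAt_one (sub_self (x i))
      have h2 := h1.mul (hr (g i)) (SmoothFn.contDiff _) (SmoothFn.contDiff _)
      rw [add_comm] at h2
      exact h2

variable {P : SmoothFn (EuclideanSpace ℝ (Fin n)) →ₗ[ℝ]
  SmoothFn (EuclideanSpace ℝ (Fin n)) →ₗ[ℝ] SmoothFn (EuclideanSpace ℝ (Fin n))}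

/-- Near a point, except possibly at the point itself, a local alternating bilinear operator is a
bidifferential operator. -/
theorem exists_order_of_isLocal (hP : ∀ u : SmoothFn V, P u u = 0)
    (hloc : ∀ (u v : SmoothFn V) (x : V), v =ᶠ[nhds x] 0 → P u v x = 0) (x₀ : V) :
    ∃ K : ℕ, ∀ᶠ x in nhdsWithin x₀ {x₀}ᶜ, ∀ u v : SmoothFn V, FlatAt K v x → P u v x = 0 := by
  have skew : ∀ u v : SmoothFn V, P u v = - P v u := fun u v => by
    have := hP (u + v)
    simp only [map_add, LinearMap.add_apply, hP, zero_add, add_zero] at this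
    rw [eq_neg_iff_add_eq_zero, add_comm]; exact this
  have loc2 : ∀ (u v v' : SmoothFn V) (x : V), v =ᶠ[nhds x] v' → P u v x = P u v' x := by
    intro u v v' x h
    have h1 : P u (v - v') x = 0 := hloc u (v - v') x (by
      filter_upwards [h] with y hy
      exact sub_eq_zero.2 hy)
    rw [(P u).map_sub] at h1
    exact sub_eq_zero.1 h1
  have loc1 : ∀ (u u' v : SmoothFn V) (x : V), u =ᶠ[nhds x] u' → P u v x = P u' v x := by
    intro u u' v x h
    rw [skew u, skew u']
    exact congrArg Neg.neg (loc2 v u u' x h)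
  obtain ⟨k, hk⟩ := peetre (T := fun u v => P u v) (fun c u v => by simp)
    (fun u u' v v' x h h' => (loc1 u u' v x h).trans (loc2 u' v v' x h')) x₀
  -- With the first argument of P frozen, Peetre's theorem applies to a linear operator; the second
  -- argument of T is a dummy.
  have lin : ∀ w : SmoothFn V, ∃ K : ℕ, ∀ᶠ x in nhdsWithin x₀ {x₀}ᶜ, ∀ v : SmoothFn V,
      FlatAt K v x → P w v x = 0 := by
    intro w
    obtain ⟨K, hK⟩ := peetre (T := fun u _ => P w u) (fun c u v => by simp)
      (fun u u' v v' x h h' => loc2 w u u' x h) x₀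
    exact ⟨K, hK.mono fun x hx v hv => hx v v hv hv⟩
  obtain ⟨S, hS⟩ := (affineFn_fg (n := n)).pow k
  choose κ hκ using lin
  -- Modulo a remainder handled by the bilinear bound k, u may be replaced by its Taylor polynomial.
  -- The latter is a combination of the finitely many generators in S, whose orders κ s are bounded
  -- near x₀.
  refine ⟨k + ∑ s ∈ S, κ s, ?_⟩
  filter_upwards [hk, (Filter.eventually_all_finset S).2 fun s _ => hκ s] with x h1 h2 u v hv
  obtain ⟨q, hq, hr⟩ := exists_taylor k x u
  have e : P u v x = P q v x + P (u - q) v x := by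
    conv_lhs => rw [← add_sub_cancel q u, map_add, LinearMap.add_apply]
    rfl
  rw [e, h1 (u - q) v (FlatAt.mono hr (by omega)) (hv.mono (by omega)), add_zero]
  let N : Submodule ℝ (SmoothFn V) :=
    { carrier := {w | P w v x = 0}
      add_mem' := by
        intro a b (ha : P a v x = 0) (hb : P b v x = 0)
        simp [ha, hb]
      zero_mem' := by simp
      smul_mem' := by
        intro c a (ha : P a v x = 0)
        simp [ha] }
  have hle : affineFn n ^ k ≤ N := by
    rw [← hS, Submodule.span_le]
    intro s hs
    refine h2 s hs v (hv.mono ?_)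
    have := Finset.single_le_sum (f := κ) (fun _ _ => Nat.zero_le _) hs
    omega
  exact hle hq

end Peetre

/-! ### Local Lie brackets on smooth functions are of first order -/

noncomputable section LocalBracket

variable {n : ℕ}

local notation "V" => EuclideanSpace ℝ (Fin n)

/-- Every term in which a factor φ stands outside D vanishes at x; only the term with all factors
inside survives. -/
theorem mulComm_pow_apply_of_eq_zero {D : Module.End ℝ (SmoothFn V)} {φ : SmoothFn V} {x : V}
    (hφ : φ x = 0) (N : ℕ) : ∀ w : SmoothFn V,
    (mulComm ℝ φ ^ N) D w x = (-1) ^ N * D (φ ^ N * w) x := by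
  induction N with
  | zero => intro w; simp
  | succ N ih =>
    intro w
    rw [pow_succ', Module.End.mul_apply, mulComm_apply]
    have : (φ * (mulComm ℝ φ ^ N) D w - (mulComm ℝ φ ^ N) D (φ * w)) x =
      φ x * (mulComm ℝ φ ^ N) D w x - (mulComm ℝ φ ^ N) D (φ * w) x := rfl
    rw [this, hφ, ih (φ * w), ← mul_assoc (φ ^ N), ← pow_succ, pow_succ (-1 : ℝ)]
    ring

theorem mulComm_algebraMap (c : ℝ) : mulComm ℝ (algebraMap ℝ (SmoothFn V) c) = 0 := by
  refine LinearMap.ext fun D => LinearMap.ext fun w => ?_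
  simp [mulComm_apply, Algebra.algebraMap_eq_smul_one]

/-- Constants commute with every linear operator, so φ can be normalized to vanish at a given point.
-/
theorem mulComm_sub_const (φ : SmoothFn V) (c : ℝ) :
    mulComm ℝ (φ - algebraMap ℝ (SmoothFn V) c) = mulComm ℝ φ := by
  rw [map_sub, mulComm_algebraMap]
  exact sub_zero (mulComm ℝ φ)

theorem mulComm_mulComm_apply_of_eq_zero {D : Module.End ℝ (SmoothFn V)} {φ ψ : SmoothFn V} {x : V}
    (hφ : φ x = 0) (hψ : ψ x = 0) (w : SmoothFn V) :
    mulComm ℝ φ (mulComm ℝ ψ D) w x = D (φ * ψ * w) x := by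
  rw [mulComm_apply, mulComm_apply, mulComm_apply]
  have : (φ * (ψ * D w - D (ψ * w)) - (ψ * D (φ * w) - D (ψ * (φ * w)))) x =
    φ x * (ψ * D w - D (ψ * w)) x - (ψ x * D (φ * w) x - D (ψ * (φ * w)) x) := rfl
  rw [this, hφ, hψ, mul_comm φ ψ, mul_assoc]
  ring

variable {P : SmoothFn (EuclideanSpace ℝ (Fin n)) →ₗ[ℝ]
  SmoothFn (EuclideanSpace ℝ (Fin n)) →ₗ[ℝ] SmoothFn (EuclideanSpace ℝ (Fin n))}

/-- The algebraic theorem is applied to the algebra of restrictions to W, which is reduced as a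
subalgebra of the real-valued functions. The bracket descends to it by locality. -/
theorem mulComm_mulComm_apply_eq_zero_of_isOpen (hP : ∀ u : SmoothFn V, P u u = 0)
    (hloc : ∀ (u v : SmoothFn V) (x : V), v =ᶠ[nhds x] 0 → P u v x = 0) {W : Set V} (hW : IsOpen W)
    (hJ : ∀ u v w : SmoothFn V, ∀ x ∈ W, P (P u v) w x = P u (P v w) x - P v (P u w) x) {K : ℕ}
    (hK : ∀ x ∈ W, ∀ u v : SmoothFn V, FlatAt K v x → P u v x = 0) (φ ψ u w : SmoothFn V)
    {x : V} (hx : x ∈ W) : mulComm ℝ φ (mulComm ℝ ψ (P u)) w x = 0 := by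
  let res : SmoothFn V →ₐ[ℝ] (W → ℝ) :=
    { toFun := fun f y => f y
      map_one' := rfl
      map_mul' := fun _ _ => rfl
      map_zero' := rfl
      map_add' := fun _ _ => rfl
      commutes' := fun _ => rfl }
  let θ : SmoothFn V →ₐ[ℝ] res.range := res.rangeRestrict
  have hθ : ∀ {f g : SmoothFn V}, θ f = θ g ↔ ∀ y ∈ W, f y = g y := by
    intro f g
    rw [Subtype.ext_iff]
    change (fun y : W => f y) = (fun y : W => g y) ↔ _
    rw [funext_iff]
    simp
  have hred : IsReduced res.range :=
    isReduced_of_injective res.range.subtype Subtype.val_injective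
  have main := map_mulComm_mulComm_eq_zero (θ := θ) res.rangeRestrict_surjective hP
    (fun u v h => ?_) (fun u v w => hθ.2 (hJ u v w)) K (fun φ u w => ?_) φ ψ u w
  · rw [← map_zero θ, hθ] at main
    exact main x hx
  · rw [← map_zero θ, hθ] at h ⊢
    intro y hy
    exact hloc u v y (by filter_upwards [hW.mem_nhds hy] with z hz using h z hz)
  · rw [← map_zero θ, hθ]
    intro y hy
    -- At each point the order condition becomes an evaluation of P u on a function divisible by the
    -- K-th power of a function vanishing there, which is K-flat.
    rw [← mulComm_sub_const φ (φ y), mulComm_pow_apply_of_eq_zero (sub_self (φ y))]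
    rw [hK y hy, mul_zero]; · rfl
    have h3 := (FlatAt.pow (f := (φ - algebraMap ℝ (SmoothFn V) (φ y) : SmoothFn V))
      (SmoothFn.contDiff _) (sub_self (φ y)) K).mul (l := 0) (g := w) (fun i hi => by omega)
      ((SmoothFn.contDiff _).pow K) (SmoothFn.contDiff _)
    exact h3

/-- A local Lie bracket on smooth functions is a first order differential operator in each
argument. -/
theorem apply_eq_zero_of_fderiv_eq_zero (hP : ∀ u : SmoothFn V, P u u = 0)
    (hloc : ∀ (u v : SmoothFn V) (x : V), v =ᶠ[nhds x] 0 → P u v x = 0) {x₀ : V}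
    (hJ : ∀ᶠ x in nhds x₀, ∀ u v w : SmoothFn V, P (P u v) w x = P u (P v w) x - P v (P u w) x)
    (u f : SmoothFn V) (h0 : f x₀ = 0) (h1 : fderiv ℝ f x₀ = 0) : P u f x₀ = 0 := by
  -- In dimension zero the punctured neighbourhoods are empty and say nothing about x₀, but there f
  -- vanishes identically.
  rcases subsingleton_or_nontrivial V with hV | hV
  · refine hloc u f x₀ (Filter.Eventually.of_forall fun y => ?_)
    rw [Subsingleton.elim y x₀, h0]; rfl
  obtain ⟨K, hK⟩ := exists_order_of_isLocal hP hloc x₀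
  obtain ⟨O, hO, hO1, hO2⟩ := eventually_nhds_iff.1
    ((eventually_nhdsWithin_iff.1 hK).and hJ)
  have hz : ∀ φ ψ w : SmoothFn V, mulComm ℝ φ (mulComm ℝ ψ (P u)) w x₀ = 0 := by
    intro φ ψ w
    have hW : IsOpen (O ∩ {x₀}ᶜ) := hO1.inter isOpen_compl_singleton
    have hne := Module.punctured_nhds_neBot ℝ V x₀
    -- The second commutator vanishes at all nearby points other than x₀, hence at x₀ by continuity.
    have hc : Filter.Tendsto (fun x => mulComm ℝ φ (mulComm ℝ ψ (P u)) w x)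
        (nhdsWithin x₀ {x₀}ᶜ) (nhds (mulComm ℝ φ (mulComm ℝ ψ (P u)) w x₀)) :=
      (SmoothFn.contDiff _).continuous.continuousAt.tendsto.mono_left nhdsWithin_le_nhds
    have h0 : ∀ᶠ x in nhdsWithin x₀ {x₀}ᶜ, mulComm ℝ φ (mulComm ℝ ψ (P u)) w x = 0 := by
      filter_upwards [self_mem_nhdsWithin, mem_nhdsWithin_of_mem_nhds (hO1.mem_nhds hO2)]
        with x hx hxO
      exact mulComm_mulComm_apply_eq_zero_of_isOpen hP hloc hW
        (fun u v w x hx => (hO x hx.1).2 u v w) (fun x hx => (hO x hx.1).1 hx.2) φ ψ u w ⟨hxO, hx⟩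
    exact tendsto_nhds_unique (hc.congr' h0) tendsto_const_nhds
  -- Both factors in each summand of Hadamard's formula vanish at x₀, as g i x₀ is a partial
  -- derivative of f; an operator of first order kills such products.
  obtain ⟨g, hg, hg0⟩ := f.exists_hadamard x₀
  rw [hg, h0, map_zero, zero_add, map_sum]
  have hs : ∀ (s : Finset (Fin n)) (F : Fin n → SmoothFn V), (∀ i ∈ s, F i x₀ = 0) →
      (∑ i ∈ s, F i) x₀ = 0 := fun s F hF => by
    classical
    induction s using Finset.induction_on with
    | empty => simp
    | insert a s ha ih =>
      rw [Finset.sum_insert ha, ContMDiffMap.coe_add, Pi.add_apply, hF a (Finset.mem_insert_self _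
          _),
        ih fun i hi => hF i (Finset.mem_insert_of_mem hi), add_zero]
  refine hs _ _ fun i _ => ?_
  have h2 : g i x₀ = 0 := by rw [hg0, h1]; rfl
  rw [← mul_one ((coordFn i - _) * g i),
    ← mulComm_mulComm_apply_of_eq_zero (D := P u)
      (φ := coordFn i - algebraMap ℝ (SmoothFn V) (x₀ i)) (sub_self (x₀ i)) h2, hz]

end LocalBracket

noncomputable section

namespace OmniLie

/-! ### Local frames, cut off to global objects -/

section Frames

variable {n : ℕ} {M : Type*} [TopologicalSpace M] [ChartedSpace (EuclideanSpace ℝ (Fin n)) M]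
  {F : Type*} [NormedAddCommGroup F] [NormedSpace ℝ F]
  {E : M → Type*} [TopologicalSpace (TotalSpace F E)] [∀ m, TopologicalSpace (E m)]
  [∀ m, AddCommGroup (E m)] [∀ m, Module ℝ (E m)] [FiberBundle F E] [VectorBundle ℝ F E]
  [IsManifold (𝓡 n) ∞ M]

theorem contMDiff_mul_of_tsupport {f g : M → ℝ} {u : Set M} (hf : ContMDiff (𝓡 n) 𝓘(ℝ, ℝ) ∞ f)
    (hu : IsOpen u) (hfu : tsupport f ⊆ u) (hg : ContMDiffOn (𝓡 n) 𝓘(ℝ, ℝ) ∞ g u) :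
    ContMDiff (𝓡 n) 𝓘(ℝ, ℝ) ∞ (fun m => f m * g m) := by
  refine contMDiff_of_tsupport fun x hx => ?_
  have hxu : x ∈ u := hfu (tsupport_mul_subset_left hx)
  exact (hf x).smul (hg.contMDiffAt (hu.mem_nhds hxu))

theorem mvfderiv_congr_of_eventuallyEq {f g : M → ℝ} {p : M} (h : f =ᶠ[nhds p] g) :
    mvfderiv (𝓡 n) f p = mvfderiv (𝓡 n) g p := by
  ext x
  simp only [mvfderiv]
  rw [h.mfderiv_eq]
  rfl

/-- The trivialization of the tangent bundle at m₀ is the derivative of the chart at m₀. -/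
theorem mvfderiv_coord_localFrame (m₀ : M) {p : M}
    (hp : p ∈ (chartAt (EuclideanSpace ℝ (Fin n)) m₀).source) (i j : Fin n) :
    mvfderiv (𝓡 n) (fun q => chartAt (EuclideanSpace ℝ (Fin n)) m₀ q i) p
      ((trivializationAt (EuclideanSpace ℝ (Fin n)) (TangentSpace (𝓡 n) : M → Type _)
        m₀).localFrame (EuclideanSpace.basisFun (Fin n) ℝ).toBasis j p) = if i = j then 1 else 0 :=
            by
  have hM1 : IsManifold (𝓡 n) 1 M := IsManifold.of_le (n := ∞) (by simp)
  have hd : MDifferentiableAt (𝓡 n) 𝓘(ℝ, EuclideanSpace ℝ (Fin n)) (extChartAt (𝓡 n) m₀) p :=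
    mdifferentiableAt_extChartAt hp
  have h1 : (fun q => chartAt (EuclideanSpace ℝ (Fin n)) m₀ q i) =
      (EuclideanSpace.proj i : EuclideanSpace ℝ (Fin n) →L[ℝ] ℝ) ∘ extChartAt (𝓡 n) m₀ := by
    ext q
    simp
  have h2 : p ∈ (trivializationAt (EuclideanSpace ℝ (Fin n)) (TangentSpace (𝓡 n) : M → Type _)
        m₀).baseSet := by
    rwa [TangentBundle.trivializationAt_baseSet]
  rw [h1, mvfderiv_comp_apply _ ((ContinuousLinearMap.differentiableAt _).mdifferentiableAt) hd,
    ← TangentBundle.continuousLinearMapAt_trivializationAt hp,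
    Bundle.Trivialization.localFrame_apply_of_mem_baseSet _ _ h2]
  have h3 := Trivialization.continuousLinearMapAt_symmL (R := ℝ) (trivializationAt (EuclideanSpace
      ℝ (Fin n))
    (TangentSpace (𝓡 n) : M → Type _) m₀) h2 (EuclideanSpace.basisFun (Fin n) ℝ j)
  have h4 : (Bundle.Trivialization.basisAt (trivializationAt (EuclideanSpace ℝ (Fin n))
    (TangentSpace (𝓡 n) : M → Type _) m₀) (EuclideanSpace.basisFun (Fin n) ℝ).toBasis h2) j =
    Trivialization.symmL ℝ (trivializationAt (EuclideanSpace ℝ (Fin n))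
    (TangentSpace (𝓡 n) : M → Type _) m₀) p (EuclideanSpace.basisFun (Fin n) ℝ j) := by
    simp [Bundle.Trivialization.basisAt, -Trivialization.symmL_apply]
    exact (Trivialization.symmL_apply (R := ℝ) _ h2 _).symm
  rw [h4]
  refine (congrArg _ h3).trans ?_
  simp only [mvfderiv, ContinuousLinearMap.mfderiv_eq]
  show (EuclideanSpace.basisFun (Fin n) ℝ) j i = _
  simp [EuclideanSpace.basisFun_apply]

variable (n F E) in
/-- A nonvanishing section `s` near `m₀` with the coefficient operator `coeff`, and coordinates with
the dual vector fields; all of them are multiplied by cutoff functions, so as to be defined on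
`M`. -/
structure LineFrame (m₀ : M) where
  dom : Set M
  isOpen_dom : IsOpen dom
  mem_dom : m₀ ∈ dom
  cutoff : C^∞⟮𝓡 n, M; 𝓘(ℝ, ℝ), ℝ⟯
  cutoff_eq_one : ∀ p ∈ dom, cutoff p = 1
  sec : Sec n F E
  coeff : Sec n F E →ₗ[ℝ] C^∞⟮𝓡 n, M; 𝓘(ℝ, ℝ), ℝ⟯
  coeff_smul_sec : ∀ u p, coeff u p • sec p = cutoff p • u p
  coeff_smulSec : ∀ f u, coeff (smulSec f u) = f * coeff u
  coeff_eq_zero : ∀ (u : Sec n F E) p, u p = 0 → coeff u p = 0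
  sec_ne_zero : ∀ p ∈ dom, sec p ≠ 0
  fiberCoeff : ∀ p, E p →ₗ[ℝ] ℝ
  contMDiffOn_fiberCoeff : ContMDiffOn ((𝓡 n).prod 𝓘(ℝ, F)) 𝓘(ℝ, ℝ) ∞
    (fun e : TotalSpace F E => fiberCoeff e.1 e.2) (TotalSpace.proj ⁻¹' dom)
  eq_smul_sec : ∀ p ∈ dom, ∀ e : E p, e = fiberCoeff p e • sec p
  coord : Fin n → C^∞⟮𝓡 n, M; 𝓘(ℝ, ℝ), ℝ⟯
  vec : Fin n → ∀ p : M, TangentSpace (𝓡 n) p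
  contMDiff_vec : ∀ j, ContMDiff (𝓡 n) (𝓡 n).tangent ∞
    (fun m => (TotalSpace.mk' (EuclideanSpace ℝ (Fin n)) m (vec j m) : TangentBundle (𝓡 n) M))
  deriv_coord_vec : ∀ p ∈ dom, ∀ i j, mvfderiv (𝓡 n) (coord i) p (vec j p) = if i = j then 1 else 0
  chart : M → EuclideanSpace ℝ (Fin n)
  map_chart_nhds : ∀ p ∈ dom, Filter.map chart (nhds p) = nhds (chart p)
  pull : SmoothFn (EuclideanSpace ℝ (Fin n)) →ₗ[ℝ] C^∞⟮𝓡 n, M; 𝓘(ℝ, ℝ), ℝ⟯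
  push : C^∞⟮𝓡 n, M; 𝓘(ℝ, ℝ), ℝ⟯ →ₗ[ℝ] SmoothFn (EuclideanSpace ℝ (Fin n))
  pull_apply : ∀ f, ∀ p ∈ dom, pull f p = f (chart p)
  push_apply : ∀ h, ∀ p ∈ dom, push h (chart p) = h p
  push_local : ∀ x, (∀ h, push h x = 0) ∨ ∃ p, (∀ h : C^∞⟮𝓡 n, M; 𝓘(ℝ, ℝ), ℝ⟯, h p = 0 → push h x =
      0) ∧
    ∀ f : SmoothFn (EuclideanSpace ℝ (Fin n)), f =ᶠ[nhds x] 0 → pull f =ᶠ[nhds p] 0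
  fderiv_push : ∀ h : C^∞⟮𝓡 n, M; 𝓘(ℝ, ℝ), ℝ⟯, mvfderiv (𝓡 n) h m₀ = 0 →
    fderiv ℝ (push h) (chart m₀) = 0

theorem nonempty_lineFrame [T2Space M] [ContMDiffVectorBundle ∞ F E (𝓡 n)]
    (hE : Module.finrank ℝ F = 1) (m₀ : M) : Nonempty (LineFrame n F E m₀) := by
  have : ContMDiffVectorBundle 1 F E (𝓡 n) := ContMDiffVectorBundle.of_le (n := ∞) (by simp)
  have hM1 : IsManifold (𝓡 n) 1 M := IsManifold.of_le (n := ∞) (by simp)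
  have hMs : IsManifold (𝓡 n) (∞ + 1) M := by simpa
  have : FiniteDimensional ℝ F := Module.finite_of_finrank_eq_succ hE
  set e := trivializationAt F E m₀
  set t := trivializationAt (EuclideanSpace ℝ (Fin n)) (TangentSpace (𝓡 n) : M → Type _) m₀
  set c := chartAt (EuclideanSpace ℝ (Fin n)) m₀ with hc
  have htb : t.baseSet = c.source := TangentBundle.trivializationAt_baseSet m₀
  let b : Module.Basis Unit ℝ F := Module.basisUnique Unit hE
  let b' := (EuclideanSpace.basisFun (Fin n) ℝ).toBasis
  obtain ⟨f, -, hf⟩ := (SmoothBumpFunction.nhds_basis_tsupport (I := 𝓡 n) m₀).mem_iff.1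
    (e.open_baseSet.mem_nhds (FiberBundle.mem_baseSet_trivializationAt F E m₀))
  have hfs : tsupport f ⊆ c.source := f.tsupport_subset_chartAt_source
  have hf0 : ∀ {p}, p ∉ tsupport f → f p = 0 := fun hp => image_eq_zero_of_notMem_tsupport hp
  let φ : C^∞⟮𝓡 n, M; 𝓘(ℝ, ℝ), ℝ⟯ := ⟨f, f.contMDiff⟩
  set U := interior {p | f p = 1} ∩ (c.source ∩ e.baseSet) with hU
  have hU1 : ∀ p ∈ U, f =ᶠ[nhds p] 1 := fun p hp => mem_interior_iff_mem_nhds.1 hp.1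
  have hUs : ∀ p ∈ U, p ∈ c.source := fun p hp => hp.2.1
  have hUe : ∀ p ∈ U, p ∈ e.baseSet := fun p hp => hp.2.2
  have hUo : IsOpen U := isOpen_interior.inter (c.open_source.inter e.open_baseSet)
  have hframe : ∀ p ∈ e.baseSet, ∀ u : E p, u = e.localFrameCoeff (𝓡 n) b () p u • e.localFrame b
      () p := by
    classical
    intro p hp u
    have := e.eq_sum_localFrameCoeff_smul (I := 𝓡 n) (b := b)
      (s := Function.update (fun q => (0 : E q)) p u) hp
    simpa using this
  let pushFn : C^∞⟮𝓡 n, M; 𝓘(ℝ, ℝ), ℝ⟯ → EuclideanSpace ℝ (Fin n) → ℝ := fun h =>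
    c.target.indicator fun x => f (c.symm x) * h (c.symm x)
  have hpush : ∀ h p, p ∈ c.source → pushFn h (c p) = f p * h p := by
    intro h p hp
    simp only [pushFn]
    rw [Set.indicator_of_mem (c.map_source hp), c.left_inv hp]
  have hpushs : ∀ h, ContDiff ℝ ∞ (pushFn h) := by
    intro h
    rw [contDiff_iff_contDiffAt]
    intro x
    -- The image of the support is compact, hence closed, so extension by zero is smooth also at the
    -- boundary of the chart target.
    by_cases hx : x ∈ c '' tsupport f
    · obtain ⟨p, hp, rfl⟩ := hx
      have hxt : c p ∈ c.target := c.map_source (hfs hp)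
      have h1 : pushFn h =ᶠ[nhds (c p)] (fun q => f q * h q) ∘ c.symm := by
        filter_upwards [c.open_target.mem_nhds hxt] with y hy
        simp only [pushFn]
        rw [Set.indicator_of_mem hy]
        rfl
      refine ContDiffAt.congr_of_eventuallyEq ?_ h1
      rw [← contMDiffAt_iff_contDiffAt]
      refine ContMDiffAt.comp (I' := 𝓡 n) _ ((f.contMDiff _).mul (h.contMDiff _)) ?_
      exact (contMDiffOn_chart_symm (x := m₀)).contMDiffAt (c.open_target.mem_nhds hxt)
    · have hcl : IsClosed (c '' tsupport f) :=
        (f.hasCompactSupport.image_of_continuousOn (c.continuousOn.mono hfs)).isClosed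
      have h1 : pushFn h =ᶠ[nhds x] 0 := by
        filter_upwards [hcl.isOpen_compl.mem_nhds hx] with y hy
        simp only [pushFn]
        by_cases hyt : y ∈ c.target
        · rw [Set.indicator_of_mem hyt, hf0 fun h => hy ⟨_, h, c.right_inv hyt⟩]
          simp
        · rw [Set.indicator_of_notMem hyt]
          rfl
      exact contDiffAt_const.congr_of_eventuallyEq h1
  refine ⟨{
    dom := U
    isOpen_dom := hUo
    mem_dom := ⟨mem_interior_iff_mem_nhds.2 f.eventuallyEq_one, mem_chart_source _ _,
      FiberBundle.mem_baseSet_trivializationAt F E m₀⟩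
    -- Both `sec` and `coeff` carry a factor f.
    cutoff := φ * φ
    cutoff_eq_one := fun p hp => ?_
    sec := ⟨fun p => f p • e.localFrame b () p, ContMDiffOn.smul_section_of_tsupport
      f.contMDiff.contMDiffOn e.open_baseSet hf (e.contMDiffOn_localFrame_baseSet ∞ b ())⟩
    coeff :=
      { toFun := fun u => ⟨fun p => f p * e.localFrameCoeff (𝓡 n) b () p (u p),
          contMDiff_mul_of_tsupport f.contMDiff e.open_baseSet hf
            (contMDiffOn_baseSet_localFrameCoeff b u.contMDiff.contMDiffOn ())⟩
        map_add' := fun u v => by ext p; exact (congrArg _ (map_add _ _ _)).trans (mul_add _ _ _)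
        map_smul' := fun a u => by
          ext p; exact (congrArg _ (map_smul _ _ _)).trans (mul_left_comm _ _ _) }
    coeff_smul_sec := fun u p => ?_
    coeff_smulSec := fun g u => by
      ext p; exact (congrArg _ (map_smul _ _ _)).trans (mul_left_comm _ _ _)
    coeff_eq_zero := fun u p h => by
      refine (congrArg _ ((congrArg _ h).trans (map_zero _))).trans (mul_zero _)
    sec_ne_zero := fun p hp => ?_
    fiberCoeff := fun p => e.localFrameCoeff (𝓡 n) b () p
    contMDiffOn_fiberCoeff := ?_
    eq_smul_sec := fun p hp u => ?_
    coord := fun i => ⟨fun p => f p * c p i, ?_⟩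
    vec := fun j p => f p • t.localFrame b' j p
    contMDiff_vec := fun j => ContMDiffOn.smul_section_of_tsupport
      f.contMDiff.contMDiffOn t.open_baseSet (htb ▸ hfs) (t.contMDiffOn_localFrame_baseSet ∞ b' j)
    deriv_coord_vec := fun p hp i j => ?_
    chart := c
    map_chart_nhds := fun p hp => c.map_nhds_eq (hUs p hp)
    pull :=
      { toFun := fun g => ⟨fun p => f p * g (c p), ?_⟩
        map_add' := fun u v => by ext p; exact mul_add _ _ _
        map_smul' := fun a u => by ext p; exact mul_left_comm _ _ _ }
    push :=
      { toFun := fun h => ⟨pushFn h, (hpushs h).contMDiff⟩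
        map_add' := fun u v => ?_
        map_smul' := fun a u => ?_ }
    pull_apply := fun g p hp => ?_
    push_apply := fun h p hp => ?_
    push_local := fun x => ?_
    fderiv_push := fun h h0 => ?_ }⟩
  · show f p * f p = 1
    rw [(hU1 p hp).eq_of_nhds]
    simp
  · show (f p * e.localFrameCoeff (𝓡 n) b () p (u p)) • f p • e.localFrame b () p = (f p * f p) • u
      p
    by_cases hp : p ∈ e.baseSet
    · conv_rhs => rw [hframe p hp (u p)]
      simp only [smul_smul]
      ring_nf
    · rw [hf0 fun h => hp (hf h)]
      simp
  · show f p • e.localFrame b () p ≠ 0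
    rw [(hU1 p hp).eq_of_nhds, Pi.one_apply, one_smul,
      e.localFrame_apply_of_mem_baseSet b (hUe p hp)]
    exact (e.basisAt b (hUe p hp)).ne_zero ()
  · have h1 : ContMDiffOn ((𝓡 n).prod 𝓘(ℝ, F)) 𝓘(ℝ, F) ∞ (fun x : TotalSpace F E => (e x).2)
        e.source := fun x hx => (e.contMDiffOn (n := ∞) x hx).snd
    have h2 : ContMDiff 𝓘(ℝ, F) 𝓘(ℝ, ℝ) ∞ (fun v : F => b.repr v ()) :=
      (LinearMap.toContinuousLinearMap (b.coord ())).contMDiff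
    refine ((h2.comp_contMDiffOn h1).mono fun x hx => ?_).congr fun x hx => ?_
    · rw [e.mem_source]
      exact hUe _ hx
    · classical
      have := e.localFrameCoeff_eq_coeff (I := 𝓡 n) (b := b)
        (s := Function.update (fun q => (0 : E q)) x.1 x.2) (hUe _ hx) (i := ())
      simpa using this
  · refine (hframe p (hUe p hp) u).trans ?_
    show _ = _ • f p • e.localFrame b () p
    rw [(hU1 p hp).eq_of_nhds, Pi.one_apply, one_smul]
  · refine contMDiff_mul_of_tsupport f.contMDiff c.open_source hfs ?_
    exact (EuclideanSpace.proj i : EuclideanSpace ℝ (Fin n) →L[ℝ] ℝ).contMDiff.comp_contMDiffOn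
      (contMDiffOn_chart (x := m₀))
  · have h1 : (fun q => f q * c q i) =ᶠ[nhds p] fun q => c q i := by
      filter_upwards [hU1 p hp] with q hq
      rw [hq]; simp
    show mvfderiv (𝓡 n) (fun q => f q * c q i) p (f p • t.localFrame b' j p) = _
    rw [mvfderiv_congr_of_eventuallyEq h1, (hU1 p hp).eq_of_nhds, Pi.one_apply, one_smul]
    exact mvfderiv_coord_localFrame m₀ (hUs p hp) i j
  · refine contMDiff_mul_of_tsupport f.contMDiff c.open_source hfs ?_
    exact g.contMDiff.comp_contMDiffOn (contMDiffOn_chart (x := m₀))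
  · ext x
    show pushFn (u + v) x = pushFn u x + pushFn v x
    by_cases hx : x ∈ c.target
    · simp only [pushFn, Set.indicator_of_mem hx]
      exact mul_add _ _ _
    · simp only [pushFn, Set.indicator_of_notMem hx, add_zero]
  · ext x
    show pushFn (a • u) x = a • pushFn u x
    by_cases hx : x ∈ c.target
    · simp only [pushFn, Set.indicator_of_mem hx]
      exact mul_left_comm _ _ _
    · simp only [pushFn, Set.indicator_of_notMem hx, smul_zero]
  · show f p * g (c p) = g (c p)
    rw [(hU1 p hp).eq_of_nhds, Pi.one_apply, one_mul]
  · show pushFn h (c p) = h p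
    rw [hpush h p (hUs p hp), (hU1 p hp).eq_of_nhds, Pi.one_apply, one_mul]
  · by_cases hx : x ∈ c.target
    · refine Or.inr ⟨c.symm x, fun h h0 => ?_, fun g hg => ?_⟩
      · show pushFn h x = 0
        simp only [pushFn, Set.indicator_of_mem hx, h0, mul_zero]
      · have h1 : Filter.Tendsto c (nhds (c.symm x)) (nhds x) := by
          have := c.continuousAt (c.map_target hx)
          rwa [ContinuousAt, c.right_inv hx] at this
        filter_upwards [h1.eventually hg] with q hq
        show f q * g (c q) = 0
        rw [hq, Pi.zero_apply, mul_zero]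
    · refine Or.inl fun h => ?_
      show pushFn h x = 0
      simp only [pushFn, Set.indicator_of_notMem hx]
  · have hm : c m₀ ∈ c.target := c.map_source (mem_chart_source _ _)
    have h1 : pushFn h =ᶠ[nhds (c m₀)] h ∘ c.symm := by
      have h2 : Filter.Tendsto c.symm (nhds (c m₀)) (nhds m₀) := by
        have := c.symm.continuousAt hm
        rwa [ContinuousAt, c.left_inv (mem_chart_source _ _)] at this
      filter_upwards [h2.eventually f.eventuallyEq_one, c.open_target.mem_nhds hm] with y hy hyt
      simp only [pushFn, Set.indicator_of_mem hyt, hy]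
      simp
    show fderiv ℝ (pushFn h) (c m₀) = 0
    rw [h1.fderiv_eq]
    have h3 := MDifferentiableAt.mvfderiv ((h.contMDiff m₀).mdifferentiableAt (by simp))
    rw [h0] at h3
    simpa using! h3.symm

end Frames

end OmniLie

noncomputable section

namespace OmniLie

/-! ### The fibres of `𝔇E` and `𝔍E` for a line bundle -/

section Fibres

variable {n : ℕ} {M : Type*} [TopologicalSpace M] [ChartedSpace (EuclideanSpace ℝ (Fin n)) M]
  {F : Type*} [NormedAddCommGroup F] [NormedSpace ℝ F]
  {E : M → Type*} [TopologicalSpace (TotalSpace F E)] [∀ m, TopologicalSpace (E m)]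
  [∀ m, AddCommGroup (E m)] [∀ m, Module ℝ (E m)] [FiberBundle F E] [VectorBundle ℝ F E]
  [IsManifold (𝓡 n) ∞ M]

@[simp]
theorem smulSec_apply (f : C^∞⟮𝓡 n, M; 𝓘(ℝ, ℝ), ℝ⟯) (u : Sec n F E) (m : M) :
    smulSec f u m = f m • u m := rfl

omit [IsManifold (𝓡 n) ∞ M] in
theorem DFiber.ext {m : M} {δ ε : DFiber n F E m} (h : ∀ u, op δ u = op ε u)
    (h' : anchor δ = anchor ε) : δ = ε :=
  Subtype.ext (Prod.ext (LinearMap.ext h) h')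

theorem mdifferentiableAt_coe (f : C^∞⟮𝓡 n, M; 𝓘(ℝ, ℝ), ℝ⟯) (m : M) :
    MDifferentiableAt (𝓡 n) 𝓘(ℝ, ℝ) f m := (f.contMDiff m).mdifferentiableAt (by simp)

theorem mvfderiv_coe_mul (f g : C^∞⟮𝓡 n, M; 𝓘(ℝ, ℝ), ℝ⟯) (m : M) (x : TangentSpace (𝓡 n) m) :
    mvfderiv (𝓡 n) (f * g) m x = f m * mvfderiv (𝓡 n) g m x + g m * mvfderiv (𝓡 n) f m x := by
  have := mvfderiv_mul (mdifferentiableAt_coe f m) (mdifferentiableAt_coe g m)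
  exact DFunLike.congr_fun this x

theorem mvfderiv_coe_add (f g : C^∞⟮𝓡 n, M; 𝓘(ℝ, ℝ), ℝ⟯) (m : M) (x : TangentSpace (𝓡 n) m) :
    mvfderiv (𝓡 n) (f + g) m x = mvfderiv (𝓡 n) f m x + mvfderiv (𝓡 n) g m x := by
  have := mvfderiv_add (mdifferentiableAt_coe f m) (mdifferentiableAt_coe g m)
  exact DFunLike.congr_fun this x

theorem mvfderiv_coe_smul (c : ℝ) (f : C^∞⟮𝓡 n, M; 𝓘(ℝ, ℝ), ℝ⟯) (m : M)
    (x : TangentSpace (𝓡 n) m) :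
    mvfderiv (𝓡 n) (c • f) m x = c * mvfderiv (𝓡 n) f m x := by
  have := mvfderiv_smul (mdifferentiableAt_const (c := c)) (mdifferentiableAt_coe f m)
  refine (DFunLike.congr_fun this x).trans ?_
  simp [mvfderiv_const]

theorem mvfderiv_eq_zero_of_eventuallyEq_const {f : M → ℝ} {p : M} {c : ℝ}
    (h : ∀ᶠ q in nhds p, f q = c) : mvfderiv (𝓡 n) f p = 0 := by
  rw [mvfderiv_congr_of_eventuallyEq (g := fun _ => c) h, mvfderiv_const]

theorem exists_bump [T2Space M] {m : M} {U : Set M} (hU : U ∈ nhds m) :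
    ∃ ψ : C^∞⟮𝓡 n, M; 𝓘(ℝ, ℝ), ℝ⟯, ψ m = 1 ∧ ∀ p ∉ U, ψ p = 0 := by
  obtain ⟨f, -, hf⟩ := (SmoothBumpFunction.nhds_basis_tsupport (I := 𝓡 n) m).mem_iff.1 hU
  exact ⟨⟨f, f.contMDiff⟩, f.eq_one, fun p hp => image_eq_zero_of_notMem_tsupport fun h => hp (hf
      h)⟩

namespace LineFrame

variable {m₀ : M} (φ : LineFrame n F E m₀) {p : M}

theorem coeff_sec (hp : p ∈ φ.dom) : φ.coeff φ.sec p = 1 := by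
  have h := φ.coeff_smul_sec φ.sec p
  rw [φ.cutoff_eq_one p hp] at h
  exact smul_left_injective ℝ (φ.sec_ne_zero p hp) h

theorem coeff_smul_sec_of_mem (hp : p ∈ φ.dom) (u : Sec n F E) : φ.coeff u p • φ.sec p = u p := by
  rw [φ.coeff_smul_sec, φ.cutoff_eq_one p hp, one_smul]

theorem eventually_mem_dom (hp : p ∈ φ.dom) : ∀ᶠ q in nhds p, q ∈ φ.dom :=
  φ.isOpen_dom.mem_nhds hp

theorem mvfderiv_cutoff (hp : p ∈ φ.dom) : mvfderiv (𝓡 n) φ.cutoff p = 0 :=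
  mvfderiv_eq_zero_of_eventuallyEq_const ((φ.eventually_mem_dom hp).mono φ.cutoff_eq_one)

theorem mvfderiv_coeff_sec (hp : p ∈ φ.dom) : mvfderiv (𝓡 n) (φ.coeff φ.sec) p = 0 :=
  mvfderiv_eq_zero_of_eventuallyEq_const ((φ.eventually_mem_dom hp).mono fun _ h => φ.coeff_sec h)

theorem smulSec_coeff_sec (u : Sec n F E) : smulSec (φ.coeff u) φ.sec = smulSec φ.cutoff u := by
  ext p
  exact φ.coeff_smul_sec u p

/-- Apply the Leibniz rule to both sides of `smulSec_coeff_sec`; the cutoff is 1 with zero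
derivative at p. -/
theorem op_apply (hp : p ∈ φ.dom) (δ : DFiber n F E p) (u : Sec n F E) :
    op δ u = φ.coeff u p • op δ φ.sec + mvfderiv (𝓡 n) (φ.coeff u) p (anchor δ) • φ.sec p := by
  have h := congrArg (op δ) (φ.smulSec_coeff_sec u)
  rw [op_smulSec, op_smulSec, φ.cutoff_eq_one p hp, φ.mvfderiv_cutoff hp] at h
  simpa using h.symm

/-- The element of `(𝔇E)_p` with anchor `x` taking `φ.sec` to `e`. -/
def mkD (hp : p ∈ φ.dom) (e : E p) (x : TangentSpace (𝓡 n) p) : DFiber n F E p :=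
  ⟨({ toFun := fun u => φ.coeff u p • e + mvfderiv (𝓡 n) (φ.coeff u) p x • φ.sec p
      map_add' := fun u v => by
        have := mvfderiv_coe_add (φ.coeff u) (φ.coeff v) p x
        simp only [map_add, this]
        simp only [ContMDiffMap.coe_add, Pi.add_apply]
        module
      map_smul' := fun c u => by
        have := mvfderiv_coe_smul c (φ.coeff u) p x
        simp only [map_smul, this, RingHom.id_apply]
        simp only [ContMDiffMap.coe_smul, Pi.smul_apply, smul_eq_mul]
        module }, x), fun f u => by
    have h := mvfderiv_coe_mul f (φ.coeff u) p x
    have h2 := φ.coeff_smul_sec_of_mem hp u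
    simp only [φ.coeff_smulSec, h, LinearMap.coe_mk, AddHom.coe_mk, ← h2]
    simp only [ContMDiffMap.coe_mul, Pi.mul_apply]
    module⟩

theorem op_mkD (hp : p ∈ φ.dom) (e : E p) (x : TangentSpace (𝓡 n) p) (u : Sec n F E) :
    op (φ.mkD hp e x) u = φ.coeff u p • e + mvfderiv (𝓡 n) (φ.coeff u) p x • φ.sec p := rfl

theorem op_mkD_sec (hp : p ∈ φ.dom) (e : E p) (x : TangentSpace (𝓡 n) p) :
    op (φ.mkD hp e x) φ.sec = e := by
  rw [op_mkD, φ.coeff_sec hp, φ.mvfderiv_coeff_sec hp]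
  simp

/-- An element of `(𝔇E)_p` is determined by its value on `φ.sec` and its anchor. -/
def equivD (hp : p ∈ φ.dom) : DFiber n F E p ≃ₗ[ℝ] E p × TangentSpace (𝓡 n) p where
  toFun δ := (op δ φ.sec, anchor δ)
  map_add' δ ε := by simp
  map_smul' c δ := by simp
  invFun a := φ.mkD hp a.1 a.2
  left_inv δ := DFiber.ext (fun u => by rw [op_mkD, ← φ.op_apply hp]) rfl
  right_inv a := Prod.ext (φ.op_mkD_sec hp _ _) rfl

/-- The derivatives of the coordinates form a left inverse of the combinations of the vectors `vec i
p`, so equality of dimensions makes them injective. -/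
theorem eq_sum_vec (hp : p ∈ φ.dom) (x : TangentSpace (𝓡 n) p) :
    x = ∑ i, mvfderiv (𝓡 n) (φ.coord i) p x • φ.vec i p := by
  let L : TangentSpace (𝓡 n) p →ₗ[ℝ] (Fin n → ℝ) :=
    LinearMap.pi fun i => (mvfderiv (𝓡 n) (φ.coord i) p).toLinearMap
  have hL : ∀ y i, L y i = mvfderiv (𝓡 n) (φ.coord i) p y := fun _ _ => rfl
  have hv : ∀ a : Fin n → ℝ, L (∑ i, a i • φ.vec i p) = a := fun a => by
    ext i
    rw [hL, map_sum]
    simp only [map_smul, φ.deriv_coord_vec p hp]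
    simp
  have hd : FiniteDimensional ℝ (TangentSpace (𝓡 n) p) :=
    inferInstanceAs (FiniteDimensional ℝ (EuclideanSpace ℝ (Fin n)))
  have hr : Module.finrank ℝ (TangentSpace (𝓡 n) p) = Module.finrank ℝ (Fin n → ℝ) := by
    rw [Module.finrank_fin_fun]
    exact finrank_euclideanSpace_fin
  have hinj : Function.Injective L :=
    (LinearMap.injective_iff_surjective_of_finrank_eq_finrank hr).2 fun a => ⟨_, hv a⟩
  exact hinj (hv (L x)).symm

end LineFrame

end Fibres

end OmniLie

noncomputable section

namespace OmniLie

/-! ### Dual frames of `𝔇E` and `𝔍E` -/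

section DualFrame

variable {n : ℕ} {M : Type*} [TopologicalSpace M] [ChartedSpace (EuclideanSpace ℝ (Fin n)) M]
  {F : Type*} [NormedAddCommGroup F] [NormedSpace ℝ F]
  {E : M → Type*} [TopologicalSpace (TotalSpace F E)] [∀ m, TopologicalSpace (E m)]
  [∀ m, AddCommGroup (E m)] [∀ m, Module ℝ (E m)] [FiberBundle F E] [VectorBundle ℝ F E]
  [IsManifold (𝓡 n) ∞ M]

variable (n F E) in
/-- Each point has a `LineFrame` around it; this holds for line bundles. -/
class HasLineFrames : Prop where
  nonempty : ∀ m : M, Nonempty (LineFrame n F E m)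

/-- The product `f μ` of a smooth function and a section of `𝔍E`. -/
def smulJ (f : C^∞⟮𝓡 n, M; 𝓘(ℝ, ℝ), ℝ⟯) (μ : SecJ n F E) : SecJ n F E :=
  ⟨fun m => f m • μ.1 m, fun 𝔡 => (smulSec f ⟨_, μ.2 𝔡⟩).contMDiff⟩

/-- The product `f 𝔡` of a smooth function and a section of `𝔇E`. -/
def smulD (f : C^∞⟮𝓡 n, M; 𝓘(ℝ, ℝ), ℝ⟯) (𝔡 : SecD n F E) : SecD n F E :=
  ⟨fun m => f m • 𝔡.1 m, ContMDiff.smul_section f.contMDiff 𝔡.2.1,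
    fun u => (smulSec f ⟨_, 𝔡.2.2 u⟩).contMDiff⟩

/-- The value of a section of `𝔇E` at `m`. -/
def evalD (m : M) (𝔡 : SecD n F E) : DFiber n F E m := 𝔡.1 m

/-- The value of a section of `𝔍E` at `m`. -/
def evalJ (m : M) (μ : SecJ n F E) : JFiber n F E m := μ.1 m

variable (n F E) in
/-- The value of a section of `E` at `m`. -/
def evalSec (m : M) : Sec n F E →ₗ[ℝ] E m where
  toFun u := u m
  map_add' _ _ := rfl
  map_smul' _ _ := rfl

variable (n F E) in
/-- The `1`-jet at `m`, as a linear map. -/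
def jetHom (m : M) : Sec n F E →ₗ[ℝ] JFiber n F E m where
  toFun u := jet u m
  map_add' u v := by ext δ; exact map_add (op δ) u v
  map_smul' c u := by ext δ; exact map_smul (op δ) c u

theorem jetHom_apply (m : M) (u : Sec n F E) : jetHom n F E m u = jet u m := rfl

theorem pairing_jet {m : M} (u : Sec n F E) (δ : DFiber n F E m) : pairing (jet u m) δ = op δ u :=
  rfl

theorem evalJ_smulJ (m : M) (f : C^∞⟮𝓡 n, M; 𝓘(ℝ, ℝ), ℝ⟯) (μ : SecJ n F E) :
    evalJ m (smulJ f μ) = f m • evalJ m μ := rfl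

theorem evalD_smulD (m : M) (f : C^∞⟮𝓡 n, M; 𝓘(ℝ, ℝ), ℝ⟯) (𝔡 : SecD n F E) :
    evalD m (smulD f 𝔡) = f m • evalD m 𝔡 := rfl

theorem evalD_add (m : M) (𝔡 𝔯 : SecD n F E) : evalD m (𝔡 + 𝔯) = evalD m 𝔡 + evalD m 𝔯 := rfl

theorem SecD.ext_eval {𝔡 𝔯 : SecD n F E} (h : ∀ m : M, evalD m 𝔡 = evalD m 𝔯) : 𝔡 = 𝔯 :=
  Subtype.ext (funext h)

theorem SecJ.ext_eval {μ ν : SecJ n F E} (h : ∀ m : M, evalJ m μ = evalJ m ν) : μ = ν :=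
  Subtype.ext (funext h)

theorem pairing_ext {m : M} {μ ν : JFiber n F E m} (h : ∀ δ, pairing μ δ = pairing ν δ) : μ = ν :=
  Subtype.ext (LinearMap.ext h)

theorem pairing_sum_left {m : M} {k : ℕ} (c : Fin k → ℝ) (μ : Fin k → JFiber n F E m)
    (δ : DFiber n F E m) : pairing (∑ a, c a • μ a) δ = ∑ a, c a • pairing (μ a) δ := by
  rw [map_sum, LinearMap.sum_apply]
  simp only [map_smul, LinearMap.smul_apply]

theorem pairing_sum_right {m : M} {k : ℕ} (c : Fin k → ℝ) (μ : JFiber n F E m)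
    (δ : Fin k → DFiber n F E m) : pairing μ (∑ a, c a • δ a) = ∑ a, c a • pairing μ (δ a) := by
  rw [map_sum]
  simp only [map_smul]

variable (n F E) in
/-- The identity of `E` as a section of `𝔇E`. -/
def oneD : SecD n F E :=
  ⟨fun _ => glInc n F LinearMap.id,
    (0 : Cₛ^∞⟮𝓡 n; EuclideanSpace ℝ (Fin n), (TangentSpace (𝓡 n) : M → Type _)⟯).contMDiff,
    fun u => u.contMDiff⟩

theorem op_oneD (m : M) (u : Sec n F E) : op (evalD m (oneD n F E)) u = u m := rfl

theorem anchor_oneD (m : M) : anchor (evalD m (oneD n F E)) = 0 := rfl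

namespace LineFrame

variable {m₀ : M} (φ : LineFrame n F E m₀) {p : M}

/-- The section of `𝔇E` which extends the vector field `φ.vec i` and annihilates `φ.sec` on
`φ.dom`. -/
def vecD (i : Fin n) : SecD n F E :=
  ⟨fun p => ⟨({ toFun := fun u => mvfderiv (𝓡 n) (φ.coeff u) p (φ.vec i p) • φ.sec p
                map_add' := fun u v => by
                  have := mvfderiv_coe_add (φ.coeff u) (φ.coeff v) p (φ.vec i p)
                  simp only [map_add, this, add_smul]
                map_smul' := fun c u => by
                  have := mvfderiv_coe_smul c (φ.coeff u) p (φ.vec i p)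
                  simp only [map_smul, this, RingHom.id_apply, mul_smul] },
      φ.cutoff p • φ.vec i p), fun f u => by
        have h := mvfderiv_coe_mul f (φ.coeff u) p (φ.vec i p)
        have h2 := φ.coeff_smul_sec u p
        simp only [φ.coeff_smulSec, h, LinearMap.coe_mk, AddHom.coe_mk, map_smul, smul_eq_mul]
        rw [mul_comm (φ.cutoff p), mul_smul (_ : ℝ) (φ.cutoff p), ← h2]
        module⟩,
    ContMDiff.smul_section φ.cutoff.contMDiff (φ.contMDiff_vec i), fun u =>
      ContMDiff.smul_section (contMDiff_deriv (φ.coeff u).contMDiff (φ.contMDiff_vec i))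
        φ.sec.contMDiff⟩

theorem op_vecD (i : Fin n) (p : M) (u : Sec n F E) :
    op (evalD p (φ.vecD i)) u = mvfderiv (𝓡 n) (φ.coeff u) p (φ.vec i p) • φ.sec p := rfl

theorem anchor_vecD (i : Fin n) (hp : p ∈ φ.dom) : anchor (evalD p (φ.vecD i)) = φ.vec i p := by
  show φ.cutoff p • φ.vec i p = _
  rw [φ.cutoff_eq_one p hp, one_smul]

/-- A frame of `𝔇E` on `φ.dom`. -/
def frameD : Fin (n + 1) → SecD n F E := Fin.cons (oneD n F E) φ.vecD

/-- The section `y_i s` of `E`. -/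
def coordSec (i : Fin n) : Sec n F E := smulSec (φ.coord i) φ.sec

/-- The frame of `𝔍E` on `φ.dom` dual to `φ.frameD`. -/
def frameJ : Fin (n + 1) → SecJ n F E :=
  Fin.cons (dd φ.sec) fun i => dd (φ.coordSec i) + smulJ (-φ.coord i) (dd φ.sec)

theorem pairing_frameJ_zero (p : M) (δ : DFiber n F E p) :
    pairing (evalJ p (φ.frameJ 0)) δ = op δ φ.sec := rfl

theorem pairing_frameJ_succ (p : M) (i : Fin n) (δ : DFiber n F E p) :
    pairing (evalJ p (φ.frameJ i.succ)) δ =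
      mvfderiv (𝓡 n) (φ.coord i) p (anchor δ) • φ.sec p := by
  have h : op δ (φ.coordSec i) = _ := op_smulSec δ (φ.coord i) φ.sec
  show op δ (φ.coordSec i) + (-φ.coord i p) • op δ φ.sec = _
  rw [h, neg_smul, ← sub_eq_add_neg, add_sub_cancel_left]

theorem pairing_frameJ_frameD (hp : p ∈ φ.dom) (a b : Fin (n + 1)) :
    pairing (evalJ p (φ.frameJ a)) (evalD p (φ.frameD b)) = if a = b then φ.sec p else 0 := by
  induction a using Fin.cases with
  | zero =>
    rw [pairing_frameJ_zero]
    induction b using Fin.cases with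
    | zero => rfl
    | succ j =>
      rw [if_neg (Fin.succ_ne_zero j).symm]
      show op (evalD p (φ.vecD j)) φ.sec = 0
      rw [op_vecD, φ.mvfderiv_coeff_sec hp]
      simp
  | succ i =>
    rw [pairing_frameJ_succ]
    induction b using Fin.cases with
    | zero =>
      rw [if_neg (Fin.succ_ne_zero i)]
      show mvfderiv (𝓡 n) (φ.coord i) p (anchor (evalD p (oneD n F E))) • φ.sec p = 0
      rw [anchor_oneD, map_zero, zero_smul]
    | succ j =>
      show mvfderiv (𝓡 n) (φ.coord i) p (anchor (evalD p (φ.vecD j))) • φ.sec p = _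
      rw [φ.anchor_vecD j hp, φ.deriv_coord_vec p hp]
      simp

theorem eq_sum_frameD (hp : p ∈ φ.dom) (δ : DFiber n F E p) (c : Fin (n + 1) → ℝ)
    (hc : ∀ a, pairing (evalJ p (φ.frameJ a)) δ = c a • φ.sec p) :
    δ = ∑ a, c a • evalD p (φ.frameD a) := by
  apply (φ.equivD hp).injective
  have h0 := hc 0
  rw [pairing_frameJ_zero] at h0
  have hi : ∀ i : Fin n, mvfderiv (𝓡 n) (φ.coord i) p (anchor δ) = c i.succ := fun i => by
    have := hc i.succ
    rw [pairing_frameJ_succ] at this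
    exact smul_left_injective ℝ (φ.sec_ne_zero p hp) this
  have e1 : ∀ ε, φ.equivD hp ε = (op ε φ.sec, anchor ε) := fun _ => rfl
  have e2 : evalD p (φ.frameD 0) = evalD p (oneD n F E) := rfl
  have e3 : ∀ i : Fin n, evalD p (φ.frameD i.succ) = evalD p (φ.vecD i) := fun _ => rfl
  rw [Fin.sum_univ_succ, e2, e1, e1]
  simp only [e3]
  refine Prod.ext ?_ ?_
  · simp only [map_add, map_sum, map_smul, LinearMap.add_apply, LinearMap.sum_apply,
      LinearMap.smul_apply, op_vecD, op_oneD, φ.mvfderiv_coeff_sec hp, h0]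
    simp
  · simp only [map_add, map_sum, map_smul, φ.anchor_vecD _ hp, anchor_oneD, smul_zero, zero_add]
    rw [φ.eq_sum_vec hp (anchor δ)]
    simp only [hi]

/-- Rank one is essential here: all values are multiples of `φ.sec p`, so the two families of
coefficients can be interchanged. -/
theorem pairing_eq_sum (hp : p ∈ φ.dom) (ν : JFiber n F E p) (δ : DFiber n F E p)
    (c b : Fin (n + 1) → ℝ) (hc : ∀ a, pairing ν (evalD p (φ.frameD a)) = c a • φ.sec p)
    (hb : ∀ a, pairing (evalJ p (φ.frameJ a)) δ = b a • φ.sec p) :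
    pairing ν δ = ∑ a, c a • pairing (evalJ p (φ.frameJ a)) δ :=
  calc pairing ν δ = _ := congrArg (pairing ν) (φ.eq_sum_frameD hp δ b hb)
    _ = _ := pairing_sum_right _ _ _
    _ = _ := Finset.sum_congr rfl fun a _ => (congrArg (b a • ·) (hc a)).trans
        ((smul_comm (b a) (c a) (φ.sec p)).trans (congrArg (c a • ·) (hb a).symm))

theorem eq_sum_frameJ (hp : p ∈ φ.dom) (ν : JFiber n F E p) (c : Fin (n + 1) → ℝ)
    (hc : ∀ a, pairing ν (evalD p (φ.frameD a)) = c a • φ.sec p) :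
    ν = ∑ a, c a • evalJ p (φ.frameJ a) :=
  pairing_ext fun δ => (φ.pairing_eq_sum hp ν δ c
    (fun a => φ.fiberCoeff p (pairing (evalJ p (φ.frameJ a)) δ)) hc
    fun a => φ.eq_smul_sec p hp _).trans (pairing_sum_left _ _ _).symm

theorem sum_frameJ_eq_zero (hp : p ∈ φ.dom) {c : Fin (n + 1) → ℝ}
    (hc : ∑ a, c a • evalJ p (φ.frameJ a) = 0) (b : Fin (n + 1)) : c b = 0 := by
  have h : pairing (∑ a, c a • evalJ p (φ.frameJ a)) (evalD p (φ.frameD b)) = 0 := by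
    rw [hc, map_zero, LinearMap.zero_apply]
  rw [pairing_sum_left] at h
  simp only [φ.pairing_frameJ_frameD hp, smul_ite, smul_zero, Finset.sum_ite_eq', Finset.mem_univ,
    if_true] at h
  exact (smul_eq_zero.1 h).resolve_right (φ.sec_ne_zero p hp)

theorem exists_smul_eq (hp : p ∈ φ.dom) (Φ : E p →ₗ[ℝ] E p) : ∃ c : ℝ, Φ = c • LinearMap.id := by
  refine ⟨φ.fiberCoeff p (Φ (φ.sec p)), LinearMap.ext fun e => ?_⟩
  conv_lhs => rw [φ.eq_smul_sec p hp e, map_smul, φ.eq_smul_sec p hp (Φ (φ.sec p))]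
  conv_rhs => rw [φ.eq_smul_sec p hp e]
  simp only [LinearMap.smul_apply, LinearMap.id_apply]
  exact smul_comm _ _ _

theorem jet_eq_zero (hp : p ∈ φ.dom) {u : Sec n F E} (h : jet u p = 0) :
    φ.coeff u p = 0 ∧ mvfderiv (𝓡 n) (φ.coeff u) p = 0 := by
  have h1 : ∀ δ : DFiber n F E p, op δ u = 0 := fun δ => by
    rw [← pairing_jet, h, map_zero, LinearMap.zero_apply]
  constructor
  · have := h1 (φ.mkD hp (φ.sec p) 0)
    simpa [op_mkD, φ.sec_ne_zero p hp] using this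
  · ext x
    have := h1 (φ.mkD hp 0 x)
    simpa [op_mkD, φ.sec_ne_zero p hp] using this

end LineFrame

end DualFrame

end OmniLie

noncomputable section

namespace OmniLie

/-! ### Tensoriality -/

section Tensorial

variable {n : ℕ} {M : Type*} [TopologicalSpace M] [ChartedSpace (EuclideanSpace ℝ (Fin n)) M]
  {F : Type*} [NormedAddCommGroup F] [NormedSpace ℝ F]
  {E : M → Type*} [TopologicalSpace (TotalSpace F E)] [∀ m, TopologicalSpace (E m)]
  [∀ m, AddCommGroup (E m)] [∀ m, Module ℝ (E m)] [FiberBundle F E] [VectorBundle ℝ F E]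
  [IsManifold (𝓡 n) ∞ M]

theorem pairSec_apply (μ : SecJ n F E) (𝔡 : SecD n F E) (m : M) :
    pairSec μ 𝔡 m = pairing (evalJ m μ) (evalD m 𝔡) := rfl

theorem smulJ_congr {f : C^∞⟮𝓡 n, M; 𝓘(ℝ, ℝ), ℝ⟯} {μ ν : SecJ n F E}
    (h : ∀ p, f p = 0 ∨ evalJ p μ = evalJ p ν) : smulJ f μ = smulJ f ν :=
  SecJ.ext_eval fun p => (h p).elim
    (fun h0 => by rw [evalJ_smulJ, evalJ_smulJ, h0, zero_smul, zero_smul])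
    fun h0 => by rw [evalJ_smulJ, evalJ_smulJ, h0]

theorem smulD_congr {f : C^∞⟮𝓡 n, M; 𝓘(ℝ, ℝ), ℝ⟯} {μ ν : SecD n F E}
    (h : ∀ p, f p = 0 ∨ evalD p μ = evalD p ν) : smulD f μ = smulD f ν :=
  SecD.ext_eval fun p => (h p).elim
    (fun h0 => by rw [evalD_smulD, evalD_smulD, h0, zero_smul, zero_smul])
    fun h0 => by rw [evalD_smulD, evalD_smulD, h0]

/-- A map on `Γ(𝔇E)` which is additive and `C^∞(M)`-linear at `m`. -/
structure IsTensorialD {W : Type*} [AddCommGroup W] [Module ℝ W] (m : M) (G : SecD n F E → W) :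
    Prop where
  add : ∀ 𝔡 𝔯, G (𝔡 + 𝔯) = G 𝔡 + G 𝔯
  smul : ∀ f 𝔡, G (smulD f 𝔡) = f m • G 𝔡

/-- A map on `Γ(𝔍E)` which is additive and `C^∞(M)`-linear at `m`. -/
structure IsTensorialJ {W : Type*} [AddCommGroup W] [Module ℝ W] (m : M) (G : SecJ n F E → W) :
    Prop where
  add : ∀ μ ν, G (μ + ν) = G μ + G ν
  smul : ∀ f μ, G (smulJ f μ) = f m • G μ

theorem IsTensorialD.exists_eq_sum {W : Type*} [AddCommGroup W] [Module ℝ W] {m : M}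
    {G : SecD n F E → W} (hG : IsTensorialD m G) {k : ℕ} (c : Fin k → C^∞⟮𝓡 n, M; 𝓘(ℝ, ℝ), ℝ⟯)
    (w : Fin k → SecD n F E) : ∃ 𝔡 : SecD n F E,
      (∀ p, evalD p 𝔡 = ∑ a, c a p • evalD p (w a)) ∧ G 𝔡 = ∑ a, c a m • G (w a) := by
  induction k with
  | zero =>
    refine ⟨0, fun p => rfl, ?_⟩
    have h := hG.add 0 0
    rw [add_zero] at h
    simpa using h
  | succ k ih =>
    refine (ih (fun a => c a.succ) (fun a => w a.succ)).elim fun 𝔡 h =>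
      ⟨smulD (c 0) (w 0) + 𝔡, fun p => ?_, ?_⟩
    · exact (congrArg (c 0 p • evalD p (w 0) + ·) (h.1 p)).trans
        (Fin.sum_univ_succ fun a => c a p • evalD p (w a)).symm
    · exact (hG.add _ _).trans ((congrArg₂ (· + ·) (hG.smul (c 0) (w 0)) h.2).trans
        (Fin.sum_univ_succ fun a => c a m • G (w a)).symm)

theorem IsTensorialJ.exists_eq_sum {W : Type*} [AddCommGroup W] [Module ℝ W] {m : M}
    {G : SecJ n F E → W} (hG : IsTensorialJ m G) {k : ℕ} (c : Fin k → C^∞⟮𝓡 n, M; 𝓘(ℝ, ℝ), ℝ⟯)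
    (w : Fin k → SecJ n F E) : ∃ μ : SecJ n F E,
      (∀ p, evalJ p μ = ∑ a, c a p • evalJ p (w a)) ∧ G μ = ∑ a, c a m • G (w a) := by
  induction k with
  | zero =>
    refine ⟨0, fun p => rfl, ?_⟩
    have h := hG.add 0 0
    rw [add_zero] at h
    simpa using h
  | succ k ih =>
    refine (ih (fun a => c a.succ) (fun a => w a.succ)).elim fun 𝔡 h =>
      ⟨smulJ (c 0) (w 0) + 𝔡, fun p => ?_, ?_⟩
    · exact (congrArg (c 0 p • evalJ p (w 0) + ·) (h.1 p)).trans
        (Fin.sum_univ_succ fun a => c a p • evalJ p (w a)).symm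
    · exact (hG.add _ _).trans ((congrArg₂ (· + ·) (hG.smul (c 0) (w 0)) h.2).trans
        (Fin.sum_univ_succ fun a => c a m • G (w a)).symm)

/-- The frame expansion holds only on `φ.dom`. After multiplication by a bump function it holds on
M, and the bump function disappears at m. -/
theorem IsTensorialJ.eq_sum [T2Space M] {W : Type*} [AddCommGroup W] [Module ℝ W] {m : M}
    {G : SecJ n F E → W} (hG : IsTensorialJ m G) (φ : LineFrame n F E m) (μ : SecJ n F E) :
    G μ = ∑ a, φ.coeff (pairSec μ (φ.frameD a)) m • G (φ.frameJ a) := by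
  refine (exists_bump (n := n) (φ.isOpen_dom.mem_nhds φ.mem_dom)).elim fun ψ hψ => ?_
  refine (hG.exists_eq_sum (fun a => φ.coeff (pairSec μ (φ.frameD a))) φ.frameJ).elim
    fun ν hν => ?_
  have h1 : smulJ ψ μ = smulJ ψ ν := smulJ_congr fun p => (em (p ∈ φ.dom)).symm.imp (hψ.2 p) fun hp
      =>
    (φ.eq_sum_frameJ hp (evalJ p μ) (fun a => φ.coeff (pairSec μ (φ.frameD a)) p)
      fun a => (φ.coeff_smul_sec_of_mem hp (pairSec μ (φ.frameD a))).symm).trans (hν.1 p).symm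
  have h2 := hG.smul ψ μ
  rw [h1, hG.smul, hψ.1, one_smul, one_smul] at h2
  rw [← h2, hν.2]

theorem IsTensorialD.eq_sum [T2Space M] {W : Type*} [AddCommGroup W] [Module ℝ W] {m : M}
    {G : SecD n F E → W} (hG : IsTensorialD m G) (φ : LineFrame n F E m) (𝔡 : SecD n F E) :
    G 𝔡 = ∑ a, φ.coeff (pairSec (φ.frameJ a) 𝔡) m • G (φ.frameD a) := by
  refine (exists_bump (n := n) (φ.isOpen_dom.mem_nhds φ.mem_dom)).elim fun ψ hψ => ?_
  refine (hG.exists_eq_sum (fun a => φ.coeff (pairSec (φ.frameJ a) 𝔡)) φ.frameD).elim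
    fun ν hν => ?_
  have h1 : smulD ψ 𝔡 = smulD ψ ν := smulD_congr fun p => (em (p ∈ φ.dom)).symm.imp (hψ.2 p) fun hp
      =>
    (φ.eq_sum_frameD hp (evalD p 𝔡) (fun a => φ.coeff (pairSec (φ.frameJ a) 𝔡) p)
      fun a => (φ.coeff_smul_sec_of_mem hp (pairSec (φ.frameJ a) 𝔡)).symm).trans (hν.1 p).symm
  have h2 := hG.smul ψ 𝔡
  rw [h1, hG.smul, hψ.1, one_smul, one_smul] at h2
  rw [← h2, hν.2]

theorem LineFrame.coeff_congr {m p : M} (φ : LineFrame n F E m) (hp : p ∈ φ.dom) {u v : Sec n F E}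
    (h : u p = v p) : φ.coeff u p = φ.coeff v p :=
  smul_left_injective ℝ (φ.sec_ne_zero p hp)
    ((φ.coeff_smul_sec_of_mem hp u).trans (h.trans (φ.coeff_smul_sec_of_mem hp v).symm))

variable [HasLineFrames n F E]

/-- Endomorphisms of a line are scalars, so the defining condition of 𝔍E is automatic. -/
theorem mem_JFiber {m : M} (ν : DFiber n F E m →ₗ[ℝ] E m) : ν ∈ JFiber n F E m := by
  refine (HasLineFrames.nonempty (n := n) (F := F) (E := E) m).elim fun φ => ?_
  intro Φ
  obtain ⟨c, rfl⟩ := φ.exists_smul_eq φ.mem_dom Φ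
  have h : glInc n F (c • LinearMap.id : E m →ₗ[ℝ] E m) = c • glInc n F LinearMap.id :=
    DFiber.ext (fun u => rfl) (smul_zero c).symm
  rw [h, map_smul]
  rfl

/-- At m the frame of 𝔍E consists of jets of the global sections s and y_i s - y_i(m) s. -/
theorem jet_surjective (m : M) : Function.Surjective (jetHom n F E m) := by
  refine (HasLineFrames.nonempty (n := n) (F := F) (E := E) m).elim fun φ => ?_
  rw [← LinearMap.range_eq_top, eq_top_iff]
  intro ν _
  rw [φ.eq_sum_frameJ φ.mem_dom ν _ fun a => φ.eq_smul_sec m φ.mem_dom _]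
  refine Submodule.sum_mem _ fun a _ => Submodule.smul_mem _ _ ?_
  induction a using Fin.cases with
  | zero => exact LinearMap.mem_range_self _ φ.sec
  | succ i =>
    exact Submodule.add_mem _ (LinearMap.mem_range_self _ (φ.coordSec i))
      (Submodule.smul_mem _ _ (LinearMap.mem_range_self _ φ.sec))

theorem eq_zero_of_pairing_eq_zero {m : M} {δ : DFiber n F E m}
    (h : ∀ μ : JFiber n F E m, pairing μ δ = 0) : δ = 0 := by
  refine (HasLineFrames.nonempty (n := n) (F := F) (E := E) m).elim fun φ => ?_
  rw [φ.eq_sum_frameD φ.mem_dom δ 0 fun a => by rw [h, Pi.zero_apply, zero_smul]]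
  simp

/-- The anchor is determined by the operator, because jets exhaust 𝔍E and separate the elements of
𝔇E. -/
theorem op_injective (m : M) : Function.Injective (op : DFiber n F E m → _) := by
  intro δ ε h
  rw [← sub_eq_zero]
  refine eq_zero_of_pairing_eq_zero fun μ => ?_
  obtain ⟨u, rfl⟩ := jet_surjective m μ
  rw [jetHom_apply, pairing_jet, map_sub, h, sub_self, LinearMap.zero_apply]

/-- An operator of first order factors through the jets at m, and on a line bundle every linear map
(𝔍E)_m → E_m is the pairing with an element of (𝔇E)_m, written down in the dual frame. -/
theorem exists_op_eq {m : M} (D : Sec n F E →ₗ[ℝ] E m) (h : ∀ v, jet v m = 0 → D v = 0) :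
    ∃ δ : DFiber n F E m, op δ = D := by
  refine (HasLineFrames.nonempty (n := n) (F := F) (E := E) m).elim fun φ => ?_
  have hs : ∀ a, ∃ u, jetHom n F E m u = evalJ m (φ.frameJ a) := fun a => jet_surjective m _
  choose u hu using hs
  refine ⟨∑ a, φ.fiberCoeff m (D (u a)) • evalD m (φ.frameD a), LinearMap.ext fun v => ?_⟩
  have hb : ∀ a, op (evalD m (φ.frameD a)) v = _ := fun a => φ.eq_smul_sec m φ.mem_dom _
  have h1 := φ.eq_sum_frameJ φ.mem_dom (jet v m) _ hb
  have h2 : D (v - ∑ a, φ.fiberCoeff m (op (evalD m (φ.frameD a)) v) • u a) = 0 := by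
    apply h
    rw [← jetHom_apply, map_sub, map_sum, sub_eq_zero]
    simp only [map_smul, hu]
    exact h1
  rw [map_sub, map_sum, sub_eq_zero] at h2
  rw [h2, map_sum, LinearMap.sum_apply]
  refine Finset.sum_congr rfl fun a _ => ?_
  rw [map_smul, map_smul, LinearMap.smul_apply]
  conv_lhs => rw [hb a]
  conv_rhs => rw [φ.eq_smul_sec m φ.mem_dom (D (u a))]
  exact smul_comm _ _ _

theorem jet_eq_zero_of_eventuallyEq [T2Space M] {m : M} {u : Sec n F E}
    (h : ∀ᶠ p in nhds m, u p = 0) : jet u m = 0 := by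
  refine (exists_bump (n := n) h).elim fun ψ hψ => ?_
  have hz : smulSec ψ u = 0 := by
    ext p
    by_cases hp : u p = 0
    · exact (congrArg (ψ p • ·) hp).trans (smul_zero _)
    · exact (congrArg (· • u p) (hψ.2 p hp)).trans (zero_smul _ _)
  refine pairing_ext fun δ => ?_
  have := op_smulSec δ ψ u
  rw [hz, map_zero, hψ.1, one_smul, h.self_of_nhds, smul_zero, add_zero] at this
  rw [pairing_jet, ← this, map_zero, LinearMap.zero_apply]

theorem evalSec_surjective (m : M) : Function.Surjective (evalSec n F E m) := fun e => by
  refine (HasLineFrames.nonempty (n := n) (F := F) (E := E) m).elim fun φ => ?_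
  exact ⟨φ.fiberCoeff m e • φ.sec, (φ.eq_smul_sec m φ.mem_dom e).symm⟩

theorem evalD_surjective (m : M) (δ : DFiber n F E m) : ∃ 𝔡 : SecD n F E, evalD m 𝔡 = δ := by
  refine (HasLineFrames.nonempty (n := n) (F := F) (E := E) m).elim fun φ => ?_
  have h0 : IsTensorialD m (fun _ : SecD n F E => (0 : ℝ)) :=
    ⟨fun _ _ => (add_zero 0).symm, fun _ _ => (smul_zero _).symm⟩
  refine (h0.exists_eq_sum (fun a => ContMDiffMap.const (φ.fiberCoeff m (pairing
    (evalJ m (φ.frameJ a)) δ))) φ.frameD).elim fun 𝔡 h => ⟨𝔡, (h.1 m).trans ?_⟩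
  exact (φ.eq_sum_frameD φ.mem_dom δ _ fun a => φ.eq_smul_sec m φ.mem_dom _).symm

variable [T2Space M]

/-- A tensorial map on `Γ(𝔍E)` vanishes if it vanishes on jets. -/
theorem IsTensorialJ.eq_zero {W : Type*} [AddCommGroup W] [Module ℝ W] {m : M}
    {G : SecJ n F E → W} (hG : IsTensorialJ m G) (hd : ∀ u, G (dd u) = 0) (μ : SecJ n F E) :
    G μ = 0 := by
  refine (HasLineFrames.nonempty (n := n) (F := F) (E := E) m).elim fun φ => ?_
  rw [hG.eq_sum φ]
  refine Finset.sum_eq_zero fun a _ => ?_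
  induction a using Fin.cases with
  | zero => exact (congrArg _ (hd φ.sec)).trans (smul_zero _)
  | succ i =>
    refine (congrArg _ (?_ : G (dd (φ.coordSec i) + smulJ (-φ.coord i) (dd φ.sec)) = 0)).trans
      (smul_zero _)
    rw [hG.add, hG.smul, hd, hd, smul_zero, add_zero]

/-- A tensorial map on `Γ(𝔇E)` depends on the value at `m` only. -/
theorem IsTensorialD.congr {W : Type*} [AddCommGroup W] [Module ℝ W] {m : M}
    {G : SecD n F E → W} (hG : IsTensorialD m G) {𝔡 𝔯 : SecD n F E}
    (h : evalD m 𝔡 = evalD m 𝔯) : G 𝔡 = G 𝔯 := by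
  refine (HasLineFrames.nonempty (n := n) (F := F) (E := E) m).elim fun φ => ?_
  rw [hG.eq_sum φ, hG.eq_sum φ 𝔯]
  refine Finset.sum_congr rfl fun a _ => ?_
  rw [φ.coeff_congr φ.mem_dom (u := pairSec (φ.frameJ a) 𝔡) (v := pairSec (φ.frameJ a) 𝔯)]
  rw [pairSec_apply, pairSec_apply, h]

/-- Sections of 𝔍E may thus be prescribed by a tensorial pairing; this constructs the jet component
of the Dorfman bracket. -/
theorem exists_pairSec_eq (G : SecD n F E → Sec n F E)
    (hG : ∀ m, IsTensorialD m fun 𝔡 => G 𝔡 m) : ∃ μ : SecJ n F E, ∀ 𝔡, pairSec μ 𝔡 = G 𝔡 := by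
  choose σ hσ using evalD_surjective (n := n) (F := F) (E := E)
  have key : ∀ (m : M) (δ : DFiber n F E m) (𝔡 : SecD n F E), evalD m 𝔡 = δ →
      G (σ m δ) m = G 𝔡 m := fun m δ 𝔡 h => (hG m).congr ((hσ m δ).trans h.symm)
  let ν : ∀ m : M, JFiber n F E m := fun m =>
    ⟨{ toFun := fun δ => G (σ m δ) m
       map_add' := fun δ ε => (key m _ (σ m δ + σ m ε) (by
          rw [evalD_add, hσ, hσ])).trans ((hG m).add _ _)
       map_smul' := fun c δ => (key m _ (smulD (ContMDiffMap.const c) (σ m δ)) (by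
          rw [evalD_smulD, hσ]; rfl)).trans ((hG m).smul _ _) }, mem_JFiber _⟩
  have hν : ∀ (m : M) (𝔡 : SecD n F E), pairing (ν m) (evalD m 𝔡) = G 𝔡 m :=
    fun m 𝔡 => key m _ 𝔡 rfl
  refine ⟨⟨ν, fun 𝔡 => ?_⟩, fun 𝔡 => ContMDiffSection.ext fun m => hν m 𝔡⟩
  have : (fun m => TotalSpace.mk' F m (pairing (ν m) (𝔡.1 m))) =
      fun m => TotalSpace.mk' F m (G 𝔡 m) := funext fun m => congrArg _ (hν m 𝔡)
  rw [this]
  exact (G 𝔡).contMDiff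

end Tensorial

end OmniLie

noncomputable section

namespace OmniLie

/-! ### Local Lie algebra brackets are bidifferential operators of first order -/

section LocalBracket

variable {n : ℕ} {M : Type*} [TopologicalSpace M] [ChartedSpace (EuclideanSpace ℝ (Fin n)) M]
  {F : Type*} [NormedAddCommGroup F] [NormedSpace ℝ F]
  {E : M → Type*} [TopologicalSpace (TotalSpace F E)] [∀ m, TopologicalSpace (E m)]
  [∀ m, AddCommGroup (E m)] [∀ m, Module ℝ (E m)] [FiberBundle F E] [VectorBundle ℝ F E]
  [IsManifold (𝓡 n) ∞ M]

namespace LocalLieAlgebra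

variable (B : LocalLieAlgebra n F E)

theorem skew (u v : Sec n F E) : B.bracket u v = - B.bracket v u := by
  have h := B.self (u + v)
  simp only [map_add, LinearMap.add_apply, B.self, zero_add, add_zero] at h
  rw [eq_neg_iff_add_eq_zero, add_comm]
  exact h

theorem bracket_apply_eq_zero {u v : Sec n F E} {m : M} (h : ∀ᶠ p in nhds m, v p = 0) :
    B.bracket u v m = 0 := by
  by_contra hc
  have h1 : m ∈ supp v := (B.isLocal u v (subset_closure hc)).2
  rw [supp, mem_closure_iff_nhds] at h1
  obtain ⟨p, hp, hp'⟩ := h1 _ h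
  exact hp' hp

theorem bracket_congr {u u' v v' : Sec n F E} {m : M} (hu : ∀ᶠ p in nhds m, u p = u' p)
    (hv : ∀ᶠ p in nhds m, v p = v' p) : B.bracket u v m = B.bracket u' v' m := by
  have key : ∀ (w : Sec n F E) {x y : Sec n F E}, (∀ᶠ p in nhds m, x p = y p) →
      B.bracket w x m = B.bracket w y m := fun w x y h => by
    have h1 := B.bracket_apply_eq_zero (u := w) (v := x - y) (m := m) (h.mono fun p hp => by
      rw [ContMDiffSection.coe_sub, Pi.sub_apply, hp, sub_self])
    rwa [map_sub, ContMDiffSection.coe_sub, Pi.sub_apply, sub_eq_zero] at h1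
  rw [key u hv, B.skew u, B.skew u', ContMDiffSection.coe_neg, ContMDiffSection.coe_neg,
    Pi.neg_apply, Pi.neg_apply, key v' hu]

end LocalLieAlgebra

namespace LineFrame

variable {m₀ : M} (φ : LineFrame n F E m₀)

/-- The section of `E` with coefficient `f` in the chart. -/
def pullSec : SmoothFn (EuclideanSpace ℝ (Fin n)) →ₗ[ℝ] Sec n F E where
  toFun f := smulSec (φ.pull f) φ.sec
  map_add' f g := by
    rw [map_add]
    ext p
    exact add_smul _ _ _
  map_smul' c f := by
    rw [map_smul]
    ext p
    exact mul_smul _ _ _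

/-- The coefficient of a section of `E`, as a function on the chart. -/
def pushSec : Sec n F E →ₗ[ℝ] SmoothFn (EuclideanSpace ℝ (Fin n)) := φ.push ∘ₗ φ.coeff

theorem pushSec_chart {p : M} (hp : p ∈ φ.dom) (u : Sec n F E) :
    φ.pushSec u (φ.chart p) = φ.coeff u p := φ.push_apply _ p hp

theorem pullSec_pushSec {p : M} (hp : p ∈ φ.dom) (u : Sec n F E) :
    φ.pullSec (φ.pushSec u) p = u p := by
  show φ.pull (φ.pushSec u) p • φ.sec p = u p
  rw [φ.pull_apply _ p hp, φ.pushSec_chart hp, φ.coeff_smul_sec_of_mem hp]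

/-- A local Lie bracket, read in the chart. -/
def localBracket (B : LocalLieAlgebra n F E) :
    SmoothFn (EuclideanSpace ℝ (Fin n)) →ₗ[ℝ] SmoothFn (EuclideanSpace ℝ (Fin n)) →ₗ[ℝ]
      SmoothFn (EuclideanSpace ℝ (Fin n)) :=
  (B.bracket.compl₁₂ φ.pullSec φ.pullSec).compr₂ φ.pushSec

theorem localBracket_apply (B : LocalLieAlgebra n F E)
    (f g : SmoothFn (EuclideanSpace ℝ (Fin n))) :
    φ.localBracket B f g = φ.pushSec (B.bracket (φ.pullSec f) (φ.pullSec g)) := rfl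

theorem localBracket_eq_zero (B : LocalLieAlgebra n F E)
    (f g : SmoothFn (EuclideanSpace ℝ (Fin n))) (x : EuclideanSpace ℝ (Fin n))
    (h : g =ᶠ[nhds x] 0) : φ.localBracket B f g x = 0 := by
  rw [localBracket_apply]
  obtain h0 | ⟨p, hp, hq⟩ := φ.push_local x
  · exact h0 _
  · refine hp _ (φ.coeff_eq_zero _ _ (B.bracket_apply_eq_zero ?_))
    filter_upwards [hq g h] with q hq
    show φ.pull g q • φ.sec q = 0
    rw [hq, Pi.zero_apply, zero_smul]

theorem bracket_localBracket (B : LocalLieAlgebra n F E) {p : M} (hp : p ∈ φ.dom)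
    (f g : SmoothFn (EuclideanSpace ℝ (Fin n))) (w : Sec n F E) :
    B.bracket w (φ.pullSec (φ.localBracket B f g)) p =
      B.bracket w (B.bracket (φ.pullSec f) (φ.pullSec g)) p :=
  B.bracket_congr (Filter.Eventually.of_forall fun _ => rfl)
    ((φ.eventually_mem_dom hp).mono fun _ hq => φ.pullSec_pushSec hq _)

/-- Pushing and pulling back is the identity only on `φ.dom`, but by locality the germ at p is all
that matters. -/
theorem localBracket_jacobi (B : LocalLieAlgebra n F E) {p : M} (hp : p ∈ φ.dom)
    (f g h : SmoothFn (EuclideanSpace ℝ (Fin n))) :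
    φ.localBracket B (φ.localBracket B f g) h (φ.chart p) =
      φ.localBracket B f (φ.localBracket B g h) (φ.chart p) -
        φ.localBracket B g (φ.localBracket B f h) (φ.chart p) := by
  have key : ∀ f g h : SmoothFn (EuclideanSpace ℝ (Fin n)),
      φ.localBracket B f (φ.localBracket B g h) (φ.chart p) =
        φ.coeff (B.bracket (φ.pullSec f) (B.bracket (φ.pullSec g) (φ.pullSec h))) p :=
    fun f g h => by
      rw [localBracket_apply, φ.pushSec_chart hp]
      exact φ.coeff_congr hp (φ.bracket_localBracket B hp g h _)
  have key' : φ.localBracket B (φ.localBracket B f g) h (φ.chart p) =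
      φ.coeff (B.bracket (B.bracket (φ.pullSec f) (φ.pullSec g)) (φ.pullSec h)) p := by
    rw [localBracket_apply, φ.pushSec_chart hp]
    refine φ.coeff_congr hp ?_
    rw [B.skew, B.skew (B.bracket _ _), ContMDiffSection.coe_neg, ContMDiffSection.coe_neg,
      Pi.neg_apply, Pi.neg_apply, φ.bracket_localBracket B hp]
  rw [key, key, key', B.jacobi (φ.pullSec f), map_add, ContMDiffMap.coe_add, Pi.add_apply,
    add_sub_cancel_right]

theorem bracket_eq_zero_of_jet_eq_zero {m₀ : M} (φ : LineFrame n F E m₀) (B : LocalLieAlgebra n F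
    E) (u : Sec n F E)
    {v : Sec n F E} (h : jet v m₀ = 0) : B.bracket u v m₀ = 0 := by
  have hv := φ.jet_eq_zero φ.mem_dom h
  have h1 : φ.localBracket B (φ.pushSec u) (φ.pushSec v) (φ.chart m₀) = 0 := by
    refine apply_eq_zero_of_fderiv_eq_zero (P := φ.localBracket B) (fun f => ?_)
      (fun f g x hg => φ.localBracket_eq_zero B f g x hg) ?_ _ _ ?_ ?_
    · rw [localBracket_apply, B.self, map_zero]
    · rw [← φ.map_chart_nhds m₀ φ.mem_dom, Filter.eventually_map]
      filter_upwards [φ.eventually_mem_dom φ.mem_dom] with p hp f g h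
      exact φ.localBracket_jacobi B hp f g h
    · rw [φ.pushSec_chart φ.mem_dom, hv.1]
    · exact φ.fderiv_push _ hv.2
  rw [localBracket_apply, φ.pushSec_chart φ.mem_dom] at h1
  have h2 : B.bracket (φ.pullSec (φ.pushSec u)) (φ.pullSec (φ.pushSec v)) m₀ = B.bracket u v m₀ :=
    B.bracket_congr ((φ.eventually_mem_dom φ.mem_dom).mono fun _ hq => φ.pullSec_pushSec hq _)
      ((φ.eventually_mem_dom φ.mem_dom).mono fun _ hq => φ.pullSec_pushSec hq _)
  rw [← h2, ← φ.coeff_smul_sec_of_mem φ.mem_dom, h1, zero_smul]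

end LineFrame

end LocalBracket

end OmniLie

noncomputable section

namespace OmniLie

/-! ### The bundle map of a local Lie algebra -/

section BundleMapOfBracket

variable {n : ℕ} {M : Type*} [TopologicalSpace M] [ChartedSpace (EuclideanSpace ℝ (Fin n)) M]
  {F : Type*} [NormedAddCommGroup F] [NormedSpace ℝ F]
  {E : M → Type*} [TopologicalSpace (TotalSpace F E)] [∀ m, TopologicalSpace (E m)]
  [∀ m, AddCommGroup (E m)] [∀ m, Module ℝ (E m)] [FiberBundle F E] [VectorBundle ℝ F E]
  [IsManifold (𝓡 n) ∞ M]

variable [HasLineFrames n F E]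

/-- The anchor of a family of elements of `(𝔇E)_m` is smooth if the action on `Γ(E)` is. -/
theorem mem_secD_of_contMDiff_op (𝔡 : ∀ m : M, DFiber n F E m)
    (h : ∀ u : Sec n F E, ContMDiff (𝓡 n) ((𝓡 n).prod 𝓘(ℝ, F)) ∞
      (fun m => TotalSpace.mk' F m (op (𝔡 m) u))) : 𝔡 ∈ SecD n F E := by
  refine ⟨fun m => ?_, h⟩
  refine (HasLineFrames.nonempty (n := n) (F := F) (E := E) m).elim fun φ => ?_
  -- By the Leibniz rule 𝔡(y_i s) - y_i 𝔡(s) = α(𝔡)(y_i) s, so the components of the anchor are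
  -- smooth.
  let w : Fin n → Sec n F E := fun i =>
    ⟨fun p => op (𝔡 p) (φ.coordSec i), h _⟩ - smulSec (φ.coord i) ⟨fun p => op (𝔡 p) φ.sec, h _⟩
  have hw : ∀ i, ∀ p ∈ φ.dom, φ.coeff (w i) p = mvfderiv (𝓡 n) (φ.coord i) p (anchor (𝔡 p)) := by
    intro i p hp
    refine smul_left_injective ℝ (φ.sec_ne_zero p hp) ((φ.coeff_smul_sec_of_mem hp (w i)).trans ?_)
    have h1 : op (𝔡 p) (φ.coordSec i) = _ := op_smulSec (𝔡 p) (φ.coord i) φ.sec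
    show op (𝔡 p) (φ.coordSec i) - φ.coord i p • op (𝔡 p) φ.sec = _
    rw [h1, add_sub_cancel_left]
  have hs : ContMDiff (𝓡 n) (𝓡 n).tangent ∞ (fun p =>
      (TotalSpace.mk' (EuclideanSpace ℝ (Fin n)) p (∑ i, φ.coeff (w i) p • φ.vec i p) :
        TangentBundle (𝓡 n) M)) :=
    ContMDiff.sum_section fun i _ =>
      ContMDiff.smul_section (φ.coeff (w i)).contMDiff (φ.contMDiff_vec i)
  refine (hs m).congr_of_eventuallyEq ((φ.eventually_mem_dom φ.mem_dom).mono fun p hp => ?_)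
  show TotalSpace.mk' (EuclideanSpace ℝ (Fin n)) p (anchor (𝔡 p)) = TotalSpace.mk' _ p _
  congr 1
  rw [φ.eq_sum_vec hp (anchor (𝔡 p))]
  exact Finset.sum_congr rfl fun i _ => by rw [hw i p hp]

namespace LocalLieAlgebra

variable [T2Space M] (B : LocalLieAlgebra n F E)

theorem bracket_eq_zero_right (u : Sec n F E) {v : Sec n F E} {m : M} (h : jet v m = 0) :
    B.bracket u v m = 0 :=
  (HasLineFrames.nonempty (n := n) (F := F) (E := E) m).elim fun φ =>
    φ.bracket_eq_zero_of_jet_eq_zero B u h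

theorem bracket_congr_left {u u' : Sec n F E} (v : Sec n F E) {m : M} (h : jet u m = jet u' m) :
    B.bracket u v m = B.bracket u' v m := by
  have h1 : jet (u - u') m = 0 := by
    rw [← jetHom_apply, map_sub, jetHom_apply, jetHom_apply, h, sub_self]
  have h2 := B.bracket_eq_zero_right v h1
  rw [map_sub, ContMDiffSection.coe_sub, Pi.sub_apply, sub_eq_zero] at h2
  rw [B.skew u, B.skew u', ContMDiffSection.coe_neg, ContMDiffSection.coe_neg, Pi.neg_apply,
    Pi.neg_apply, h2]

theorem exists_op_eq_bracket (u : Sec n F E) (m : M) :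
    ∃ δ : DFiber n F E m, ∀ v, op δ v = B.bracket u v m :=
  (exists_op_eq (evalSec n F E m ∘ₗ B.bracket u) fun _ h => B.bracket_eq_zero_right u h).imp
    fun _ h v => LinearMap.congr_fun h v

/-- The element `[u, ·]` of `(𝔇E)_m`. -/
def adFiber (u : Sec n F E) (m : M) : DFiber n F E m := (B.exists_op_eq_bracket u m).choose

theorem op_adFiber (u v : Sec n F E) (m : M) : op (B.adFiber u m) v = B.bracket u v m :=
  (B.exists_op_eq_bracket u m).choose_spec v

theorem adFiber_add {u v w : Sec n F E} {m : M}
    (h : jetHom n F E m w = jetHom n F E m u + jetHom n F E m v) :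
    B.adFiber w m = B.adFiber u m + B.adFiber v m := by
  rw [← map_add] at h
  refine op_injective m (LinearMap.ext fun x => ?_)
  rw [map_add, LinearMap.add_apply, op_adFiber, op_adFiber, op_adFiber,
    B.bracket_congr_left x h, map_add]
  rfl

theorem adFiber_smul {u w : Sec n F E} {m : M} {c : ℝ}
    (h : jetHom n F E m w = c • jetHom n F E m u) : B.adFiber w m = c • B.adFiber u m := by
  rw [← map_smul] at h
  refine op_injective m (LinearMap.ext fun x => ?_)
  rw [map_smul, LinearMap.smul_apply, op_adFiber, op_adFiber, B.bracket_congr_left x h, map_smul]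
  rfl

/-- The section `[u, ·]` of `𝔇E`. -/
def ad (u : Sec n F E) : SecD n F E :=
  ⟨B.adFiber u, mem_secD_of_contMDiff_op _ fun v => by
    simp only [op_adFiber]
    exact (B.bracket u v).contMDiff⟩

theorem op_ad (u v : Sec n F E) (m : M) : op (evalD m (B.ad u)) v = B.bracket u v m :=
  B.op_adFiber u v m

/-- The bundle map `𝔍E → 𝔇E` with `𝕕u ↦ [u, ·]`, at `m`. -/
def jetToD (m : M) : JFiber n F E m →ₗ[ℝ] DFiber n F E m where
  toFun μ := B.adFiber (jet_surjective m μ).choose m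
  map_add' μ ν := B.adFiber_add (((jet_surjective m (μ + ν)).choose_spec).trans
    (congrArg₂ (· + ·) (jet_surjective m μ).choose_spec (jet_surjective m ν).choose_spec).symm)
  map_smul' c μ := B.adFiber_smul (((jet_surjective m (c • μ)).choose_spec).trans
    (congrArg (c • ·) (jet_surjective m μ).choose_spec).symm)

theorem op_jetToD_jet (u v : Sec n F E) (m : M) :
    op (B.jetToD m (jet u m)) v = B.bracket u v m := by
  refine (B.op_adFiber _ v m).trans (B.bracket_congr_left v ?_)
  exact (jet_surjective m (jet u m)).choose_spec

theorem jetToD_jet (u : Sec n F E) (m : M) : B.jetToD m (jet u m) = evalD m (B.ad u) :=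
  op_injective m (LinearMap.ext fun v => by rw [op_jetToD_jet, op_ad])

/-- On the right μ enters through its pairing with a smooth section of 𝔇E, from which the smoothness
of π is evident. -/
theorem op_jetToD (m : M) (μ : JFiber n F E m) (v : Sec n F E) :
    op (B.jetToD m μ) v = - pairing μ (evalD m (B.ad v)) := by
  obtain ⟨u, rfl⟩ := jet_surjective m μ
  rw [jetHom_apply, op_jetToD_jet, pairing_jet, op_ad, B.skew, ContMDiffSection.coe_neg,
    Pi.neg_apply]

/-- The bundle map `𝔍E → 𝔇E` of a local Lie algebra, with `𝕕u ↦ [u, ·]`. -/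
def toBundleMap : BundleMap n F E where
  toFun := B.jetToD
  smooth μ := mem_secD_of_contMDiff_op _ fun v => by
    simp only [op_jetToD]
    exact (-pairSec μ (B.ad v)).contMDiff

theorem pairing_jetToD (m : M) (μ ν : JFiber n F E m) :
    pairing ν (B.jetToD m μ) = - pairing μ (B.jetToD m ν) := by
  obtain ⟨v, rfl⟩ := jet_surjective m ν
  rw [jetHom_apply, pairing_jet, op_jetToD, jetToD_jet]

end LocalLieAlgebra

end BundleMapOfBracket

end OmniLie

noncomputable section

namespace OmniLie

/-! ### Graphs of bundle maps and the operations on sections -/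

section Graph

variable {n : ℕ} {M : Type*} [TopologicalSpace M] [ChartedSpace (EuclideanSpace ℝ (Fin n)) M]
  {F : Type*} [NormedAddCommGroup F] [NormedSpace ℝ F]
  {E : M → Type*} [TopologicalSpace (TotalSpace F E)] [∀ m, TopologicalSpace (E m)]
  [∀ m, AddCommGroup (E m)] [∀ m, Module ℝ (E m)] [FiberBundle F E] [VectorBundle ℝ F E]
  [IsManifold (𝓡 n) ∞ M]

namespace BundleMap

/-- The action of a bundle map on sections. -/
def mapSec (P : BundleMap n F E) (μ : SecJ n F E) : SecD n F E :=
  ⟨fun m => P.toFun m (μ.1 m), P.smooth μ⟩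

theorem mapSec_add (P : BundleMap n F E) (μ ν : SecJ n F E) :
    P.mapSec (μ + ν) = P.mapSec μ + P.mapSec ν :=
  SecD.ext_eval fun m => (P.toFun m).map_add (evalJ m μ) (evalJ m ν)

theorem mapSec_smulJ (P : BundleMap n F E) (f : C^∞⟮𝓡 n, M; 𝓘(ℝ, ℝ), ℝ⟯) (μ : SecJ n F E) :
    P.mapSec (smulJ f μ) = smulD f (P.mapSec μ) :=
  SecD.ext_eval fun m => (P.toFun m).map_smul (f m) (evalJ m μ)

theorem mem_graph (P : BundleMap n F E) {m : M} {a : Omni n F E m} :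
    a ∈ P.graph m ↔ P.toFun m a.2 = a.1 := by
  constructor
  · rintro ⟨μ, rfl⟩
    rfl
  · intro h
    exact ⟨a.2, Prod.ext h rfl⟩

end BundleMap

theorem LineFrame.linearIndependent_frameJ {m p : M} (φ : LineFrame n F E m) (hp : p ∈ φ.dom) :
    LinearIndependent ℝ fun a => evalJ p (φ.frameJ a) :=
  Fintype.linearIndependent_iff.2 fun _ hc b => φ.sum_frameJ_eq_zero hp hc b

theorem LineFrame.span_frameJ {m p : M} (φ : LineFrame n F E m) (hp : p ∈ φ.dom) :
    Submodule.span ℝ (Set.range fun a => evalJ p (φ.frameJ a)) = ⊤ := by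
  refine eq_top_iff.2 fun ν _ => ?_
  rw [φ.eq_sum_frameJ hp ν _ fun a => φ.eq_smul_sec p hp _]
  exact Submodule.sum_mem _ fun a _ => Submodule.smul_mem _ _ (Submodule.subset_span ⟨a, rfl⟩)

theorem BundleMap.isSubbundle_graph [HasLineFrames n F E] (P : BundleMap n F E) :
    IsSubbundle P.graph := fun m => by
  refine (HasLineFrames.nonempty (n := n) (F := F) (E := E) m).elim fun φ => ?_
  refine ⟨φ.dom, φ.isOpen_dom.mem_nhds φ.mem_dom, n + 1,
    fun a => (P.mapSec (φ.frameJ a), φ.frameJ a), fun p hp => ⟨?_, ?_⟩⟩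
  · exact (φ.linearIndependent_frameJ hp).map' ((P.toFun p).prod LinearMap.id)
      (LinearMap.ker_eq_bot.2 fun μ ν h => congrArg Prod.snd h)
  · have h := (LinearMap.range_eq_map ((P.toFun p).prod LinearMap.id)).symm
    rw [← φ.span_frameJ hp, Submodule.map_span, ← Set.range_comp] at h
    exact h

/-- An element x of a larger isotropic subspace is orthogonal to all P ν + ν. By skewness this reads
⟨ν, P x.2 - x.1⟩ = 0 for all ν, so x lies on the graph. -/
theorem BundleMap.maximal_isotropic_graph [HasLineFrames n F E] (P : BundleMap n F E) {m : M}
    (hP : ∀ μ ν : JFiber n F E m, pairing ν (P.toFun m μ) = - pairing μ (P.toFun m ν)) :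
    Maximal IsIsotropic (P.graph m) := by
  refine ⟨fun a ha b hb => ?_, fun N hN hle x hx => ?_⟩
  · rw [P.mem_graph] at ha hb
    rw [symmForm, ← ha, ← hb, hP, neg_add_cancel, smul_zero]
  · rw [P.mem_graph]
    refine (sub_eq_zero.1 (eq_zero_of_pairing_eq_zero fun ν => ?_)).symm
    have h1 := hN x hx (P.toFun m ν, ν) (hle (P.mem_graph.2 rfl))
    rw [symmForm, smul_eq_zero] at h1
    rw [map_sub, hP, sub_neg_eq_add]
    exact h1.resolve_left (by norm_num)

theorem act_add_left (𝔡 𝔯 : SecD n F E) (u : Sec n F E) : act (𝔡 + 𝔯) u = act 𝔡 u + act 𝔯 u := by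
  ext m
  exact LinearMap.congr_fun (map_add op (evalD m 𝔡) (evalD m 𝔯)) u

theorem act_smulD (f : C^∞⟮𝓡 n, M; 𝓘(ℝ, ℝ), ℝ⟯) (𝔡 : SecD n F E) (u : Sec n F E) :
    act (smulD f 𝔡) u = smulSec f (act 𝔡 u) := by
  ext m
  exact LinearMap.congr_fun (map_smul op (f m) (evalD m 𝔡)) u

theorem act_bracketD (𝔡 𝔯 : SecD n F E) (u : Sec n F E) :
    act (bracketD 𝔡 𝔯) u = act 𝔡 (act 𝔯 u) - act 𝔯 (act 𝔡 u) := by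
  ext m
  rfl

variable [HasLineFrames n F E]

theorem SecD.ext_act {𝔡 𝔯 : SecD n F E} (h : ∀ u, act 𝔡 u = act 𝔯 u) : 𝔡 = 𝔯 :=
  SecD.ext_eval fun m => op_injective m (LinearMap.ext fun u => DFunLike.congr_fun (h u) m)

theorem bracketD_add_right (𝔡 𝔯 𝔱 : SecD n F E) :
    bracketD 𝔡 (𝔯 + 𝔱) = bracketD 𝔡 𝔯 + bracketD 𝔡 𝔱 := by
  refine SecD.ext_act fun u => ?_
  rw [act_add_left, act_bracketD, act_bracketD, act_bracketD, act_add_left, act_add_left, map_add]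
  abel

theorem bracketD_add_left (𝔡 𝔯 𝔱 : SecD n F E) :
    bracketD (𝔡 + 𝔯) 𝔱 = bracketD 𝔡 𝔱 + bracketD 𝔯 𝔱 := by
  refine SecD.ext_act fun u => ?_
  rw [act_add_left, act_bracketD, act_bracketD, act_bracketD, act_add_left, act_add_left, map_add]
  abel

theorem bracketD_smulD_right (f : C^∞⟮𝓡 n, M; 𝓘(ℝ, ℝ), ℝ⟯) (𝔡 𝔱 : SecD n F E) :
    bracketD 𝔡 (smulD f 𝔱) = smulD f (bracketD 𝔡 𝔱) + smulD (anchorDeriv 𝔡 f) 𝔱 := by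
  refine SecD.ext_act fun u => ?_
  rw [act_add_left, act_bracketD, act_smulD, act_smulD, act_smulD, act_smulD, act_smulSec,
    act_bracketD]
  ext m
  simp only [ContMDiffSection.coe_add, ContMDiffSection.coe_sub, Pi.add_apply, Pi.sub_apply,
    smulSec_apply]
  module

theorem bracketD_smulD_left (f : C^∞⟮𝓡 n, M; 𝓘(ℝ, ℝ), ℝ⟯) (𝔡 𝔱 : SecD n F E) :
    bracketD (smulD f 𝔡) 𝔱 = smulD f (bracketD 𝔡 𝔱) + smulD (-anchorDeriv 𝔱 f) 𝔡 := by
  refine SecD.ext_act fun u => ?_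
  rw [act_add_left, act_bracketD, act_smulD, act_smulD, act_smulD, act_smulD, act_smulSec,
    act_bracketD]
  ext m
  have h : (-anchorDeriv 𝔱 f) m = - anchorDeriv 𝔱 f m := rfl
  simp only [ContMDiffSection.coe_add, ContMDiffSection.coe_sub, Pi.add_apply, Pi.sub_apply,
    smulSec_apply, h]
  module

theorem pairSec_add_right (μ : SecJ n F E) (𝔡 𝔯 : SecD n F E) :
    pairSec μ (𝔡 + 𝔯) = pairSec μ 𝔡 + pairSec μ 𝔯 := by
  ext m
  exact map_add (pairing (evalJ m μ)) (evalD m 𝔡) (evalD m 𝔯)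

theorem pairSec_smulD (μ : SecJ n F E) (f : C^∞⟮𝓡 n, M; 𝓘(ℝ, ℝ), ℝ⟯) (𝔡 : SecD n F E) :
    pairSec μ (smulD f 𝔡) = smulSec f (pairSec μ 𝔡) := by
  ext m
  exact map_smul (pairing (evalJ m μ)) (f m) (evalD m 𝔡)

theorem pairSec_add_left (μ ν : SecJ n F E) (𝔡 : SecD n F E) :
    pairSec (μ + ν) 𝔡 = pairSec μ 𝔡 + pairSec ν 𝔡 := by
  ext m
  exact LinearMap.congr_fun (map_add pairing (evalJ m μ) (evalJ m ν)) (evalD m 𝔡)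

theorem pairSec_smulJ (f : C^∞⟮𝓡 n, M; 𝓘(ℝ, ℝ), ℝ⟯) (μ : SecJ n F E) (𝔡 : SecD n F E) :
    pairSec (smulJ f μ) 𝔡 = smulSec f (pairSec μ 𝔡) := by
  ext m
  exact LinearMap.congr_fun (map_smul pairing (f m) (evalJ m μ)) (evalD m 𝔡)

theorem pairSec_dd (u : Sec n F E) (𝔡 : SecD n F E) : pairSec (dd u) 𝔡 = act 𝔡 u := rfl

theorem isTensorialD_lieDerivative (𝔡 : SecD n F E) (μ : SecJ n F E) (m : M) :
    IsTensorialD m fun 𝔱 => lieDerivative 𝔡 μ 𝔱 m := by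
  constructor
  · intro 𝔱 𝔰
    simp only [lieDerivative, bracketD_add_right, map_add]
    simp only [ContMDiffSection.coe_add, ContMDiffSection.coe_sub, Pi.add_apply, Pi.sub_apply]
    abel
  · intro f 𝔱
    simp only [lieDerivative, pairSec_smulD, bracketD_smulD_right, pairSec_add_right, act_smulSec]
    simp only [ContMDiffSection.coe_add, ContMDiffSection.coe_sub, Pi.add_apply, Pi.sub_apply,
      smulSec_apply]
    module

theorem exists_isDorfmanBracket [T2Space M] (X Y : SecOmni n F E) :
    ∃ Z : SecOmni n F E, IsDorfmanBracket X Y Z := by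
  have h := exists_pairSec_eq (fun 𝔱 => lieDerivative X.1 Y.2 𝔱 - lieDerivative Y.1 X.2 𝔱 +
    pairSec (dd (pairSec X.2 Y.1)) 𝔱) fun m => by
      have h1 := isTensorialD_lieDerivative X.1 Y.2 m
      have h2 := isTensorialD_lieDerivative Y.1 X.2 m
      constructor
      · intro 𝔱 𝔰
        have e1 := h1.add 𝔱 𝔰
        have e2 := h2.add 𝔱 𝔰
        simp only [ContMDiffSection.coe_add, ContMDiffSection.coe_sub, Pi.add_apply, Pi.sub_apply,
          e1, e2, pairSec_add_right]
        abel
      · intro f 𝔱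
        have e1 := h1.smul f 𝔱
        have e2 := h2.smul f 𝔱
        simp only [ContMDiffSection.coe_add, ContMDiffSection.coe_sub, Pi.add_apply, Pi.sub_apply,
          e1, e2, pairSec_smulD, smulSec_apply]
        module
  exact h.elim fun ζ hζ => ⟨(bracketD X.1 Y.1, ζ), rfl, hζ⟩

end Graph

end OmniLie

noncomputable section

namespace OmniLie

/-! ### The Dirac structure of a local Lie algebra -/

section DiracOfBracket

variable {n : ℕ} {M : Type*} [TopologicalSpace M] [ChartedSpace (EuclideanSpace ℝ (Fin n)) M]
  {F : Type*} [NormedAddCommGroup F] [NormedSpace ℝ F]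
  {E : M → Type*} [TopologicalSpace (TotalSpace F E)] [∀ m, TopologicalSpace (E m)]
  [∀ m, AddCommGroup (E m)] [∀ m, Module ℝ (E m)] [FiberBundle F E] [VectorBundle ℝ F E]
  [IsManifold (𝓡 n) ∞ M]

variable [HasLineFrames n F E] [T2Space M] (B : LocalLieAlgebra n F E)

namespace LocalLieAlgebra

theorem mapSec_dd (u : Sec n F E) : B.toBundleMap.mapSec (dd u) = B.ad u :=
  SecD.ext_eval fun m => B.jetToD_jet u m

theorem act_ad (u v : Sec n F E) : act (B.ad u) v = B.bracket u v := by
  ext m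
  exact B.op_ad u v m

theorem pairSec_mapSec (μ ν : SecJ n F E) :
    pairSec ν (B.toBundleMap.mapSec μ) = -pairSec μ (B.toBundleMap.mapSec ν) := by
  ext m
  exact B.pairing_jetToD m (evalJ m μ) (evalJ m ν)

theorem pairSec_ad (μ : SecJ n F E) (w : Sec n F E) :
    pairSec μ (B.ad w) = -act (B.toBundleMap.mapSec μ) w := by
  rw [← mapSec_dd, pairSec_mapSec, pairSec_dd]

/-- The obstruction to `𝔍E → 𝔇E` being compatible with brackets, paired with `𝕕w`. -/
def bracketDefect (w : Sec n F E) (μ ν : SecJ n F E) : Sec n F E :=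
  act (B.ad w) (pairSec μ (B.toBundleMap.mapSec ν))
    - pairSec ν (bracketD (B.toBundleMap.mapSec μ) (B.ad w))
    + pairSec μ (bracketD (B.toBundleMap.mapSec ν) (B.ad w))

theorem bracketDefect_comm (w : Sec n F E) (μ ν : SecJ n F E) :
    B.bracketDefect w μ ν = -B.bracketDefect w ν μ := by
  unfold bracketDefect
  rw [B.pairSec_mapSec μ ν, map_neg]
  abel

theorem bracketDefect_add (w : Sec n F E) (μ μ' ν : SecJ n F E) :
    B.bracketDefect w (μ + μ') ν = B.bracketDefect w μ ν + B.bracketDefect w μ' ν := by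
  have h1 := (congrArg (pairSec ν) ((congrArg (fun X => bracketD X (B.ad w))
    (B.toBundleMap.mapSec_add μ μ')).trans (bracketD_add_left _ _ _))).trans
    (pairSec_add_right _ _ _)
  have h2 := pairSec_add_left μ μ' (bracketD (B.toBundleMap.mapSec ν) (B.ad w))
  have h3 := (congrArg (act (B.ad w)) (pairSec_add_left μ μ' (B.toBundleMap.mapSec ν))).trans
    (map_add _ _ _)
  refine (congrArg₂ (· + ·) (congrArg₂ (· - ·) h3 h1) h2).trans ?_
  unfold bracketDefect
  abel

/-- The two terms in which f is differentiated along α([w, ·]) cancel because π is skew. -/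
theorem bracketDefect_smulJ (w : Sec n F E) (f : C^∞⟮𝓡 n, M; 𝓘(ℝ, ℝ), ℝ⟯) (μ ν : SecJ n F E) :
    B.bracketDefect w (smulJ f μ) ν = smulSec f (B.bracketDefect w μ ν) := by
  have h1 := (congrArg (pairSec ν) ((congrArg (fun X => bracketD X (B.ad w))
    (B.toBundleMap.mapSec_smulJ f μ)).trans (bracketD_smulD_left _ _ _))).trans
    ((pairSec_add_right _ _ _).trans (congrArg₂ (· + ·) (pairSec_smulD _ _ _)
    ((pairSec_smulD _ _ _).trans (congrArg (smulSec _) (B.pairSec_mapSec μ ν)))))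
  have h2 := pairSec_smulJ f μ (bracketD (B.toBundleMap.mapSec ν) (B.ad w))
  have h3 := (congrArg (act (B.ad w)) (pairSec_smulJ f μ (B.toBundleMap.mapSec ν))).trans
    (act_smulSec _ _ _)
  refine (congrArg₂ (· + ·) (congrArg₂ (· - ·) h3 h1) h2).trans ?_
  unfold bracketDefect
  generalize pairSec μ (B.toBundleMap.mapSec ν) = a
  generalize pairSec ν (bracketD (B.toBundleMap.mapSec μ) (B.ad w)) = b
  generalize pairSec μ (bracketD (B.toBundleMap.mapSec ν) (B.ad w)) = c
  generalize act (B.ad w) a = d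
  generalize anchorDeriv (B.ad w) f = g
  ext p
  show f p • d p + g p • a p - (f p • b p + (- g p) • (- a p)) + f p • c p =
    f p • (d p - b p + c p)
  module

theorem isTensorialJ_bracketDefect (w : Sec n F E) (ν : SecJ n F E) (m : M) :
    IsTensorialJ m fun μ => B.bracketDefect w μ ν m :=
  ⟨fun μ μ' => DFunLike.congr_fun (B.bracketDefect_add w μ μ' ν) m,
    fun f μ => DFunLike.congr_fun (B.bracketDefect_smulJ w f μ ν) m⟩

/-- On jets of sections the defect is the Jacobi identity for w, u, v. -/
theorem bracketDefect_dd (w u v : Sec n F E) : B.bracketDefect w (dd u) (dd v) = 0 := by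
  have h := B.jacobi w u v
  unfold bracketDefect
  rw [mapSec_dd, mapSec_dd, pairSec_dd, pairSec_dd, pairSec_dd, act_bracketD, act_bracketD]
  simp only [act_ad]
  rw [B.skew (B.bracket w u) v] at h
  rw [B.skew v u, B.skew w v] at *
  simp only [map_neg] at *
  rw [h]
  abel

theorem bracketDefect_eq_zero (w : Sec n F E) (μ ν : SecJ n F E) : B.bracketDefect w μ ν = 0 := by
  ext m
  refine (B.isTensorialJ_bracketDefect w ν m).eq_zero (fun u => ?_) μ
  show B.bracketDefect w (dd u) ν m = 0
  rw [B.bracketDefect_comm]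
  refine neg_eq_zero.2 ((B.isTensorialJ_bracketDefect w (dd u) m).eq_zero (fun v => ?_) ν)
  show B.bracketDefect w (dd v) (dd u) m = 0
  rw [B.bracketDefect_dd]
  rfl

/-- Acting with π(ζ) on w is, up to sign, pairing ζ with [w, ·]. So it suffices to evaluate the
Dorfman formula on 𝔱 = `B.ad w`, and the discrepancy is `bracketDefect`. -/
theorem mapSec_eq_bracketD {𝔡 𝔯 : SecD n F E} {μ ν ζ : SecJ n F E}
    (hμ : 𝔡 = B.toBundleMap.mapSec μ) (hν : 𝔯 = B.toBundleMap.mapSec ν)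
    (h : ∀ 𝔱 : SecD n F E, pairSec ζ 𝔱 =
      lieDerivative 𝔡 ν 𝔱 - lieDerivative 𝔯 μ 𝔱 + pairSec (dd (pairSec μ 𝔯)) 𝔱) :
    B.toBundleMap.mapSec ζ = bracketD 𝔡 𝔯 := by
  subst hμ hν
  refine SecD.ext_act fun w => ?_
  have h1 := (B.pairSec_ad ζ w).symm.trans ((h (B.ad w)).trans (congrArg₂ (· + ·) (congrArg₂ (· - ·)
    (congrArg (fun x => act (B.toBundleMap.mapSec μ) x -
      pairSec ν (bracketD (B.toBundleMap.mapSec μ) (B.ad w))) (B.pairSec_ad ν w))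
    (congrArg (fun x => act (B.toBundleMap.mapSec ν) x -
      pairSec μ (bracketD (B.toBundleMap.mapSec ν) (B.ad w))) (B.pairSec_ad μ w)))
    (pairSec_dd _ _)))
  have h2 := B.bracketDefect_eq_zero w μ ν
  unfold bracketDefect at h2
  simp only [map_neg] at h1
  refine (neg_eq_iff_eq_neg.1 h1).trans (Eq.trans ?_ (act_bracketD _ _ _).symm)
  rw [← sub_eq_zero, ← neg_eq_zero, ← h2]
  abel

theorem isDirac_graph : IsDirac B.toBundleMap.graph where
  subbundle := BundleMap.isSubbundle_graph _
  maximal_isotropic m := BundleMap.maximal_isotropic_graph _ fun μ ν => B.pairing_jetToD m μ ν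
  closed X Y hX hY := by
    have h1 : X.1 = B.toBundleMap.mapSec X.2 :=
      SecD.ext_eval fun m => ((BundleMap.mem_graph _).1 (hX m)).symm
    have h2 : Y.1 = B.toBundleMap.mapSec Y.2 :=
      SecD.ext_eval fun m => ((BundleMap.mem_graph _).1 (hY m)).symm
    refine (exists_isDorfmanBracket X Y).elim fun Z hZ => ⟨Z, hZ, fun m => ?_⟩
    refine (BundleMap.mem_graph _).2 ?_
    exact congrArg (evalD m) ((B.mapSec_eq_bracketD h1 h2 hZ.2).trans hZ.1.symm)

end LocalLieAlgebra

end DiracOfBracket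

end OmniLie

noncomputable section

namespace OmniLie

/-! ### The local Lie algebra of a Dirac structure -/

section BracketOfDirac

variable {n : ℕ} {M : Type*} [TopologicalSpace M] [ChartedSpace (EuclideanSpace ℝ (Fin n)) M]
  {F : Type*} [NormedAddCommGroup F] [NormedSpace ℝ F]
  {E : M → Type*} [TopologicalSpace (TotalSpace F E)] [∀ m, TopologicalSpace (E m)]
  [∀ m, AddCommGroup (E m)] [∀ m, Module ℝ (E m)] [FiberBundle F E] [VectorBundle ℝ F E]
  [IsManifold (𝓡 n) ∞ M]

theorem act_smul_left (c : ℝ) (𝔡 : SecD n F E) (u : Sec n F E) : act (c • 𝔡) u = c • act 𝔡 u := by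
  ext m
  exact LinearMap.congr_fun (map_smul op c (evalD m 𝔡)) u

namespace BundleMap

variable (P : BundleMap n F E)

theorem mapSec_dd_add (u v : Sec n F E) :
    P.mapSec (dd (u + v)) = P.mapSec (dd u) + P.mapSec (dd v) :=
  SecD.ext_eval fun m => (congrArg (P.toFun m) (map_add (jetHom n F E m) u v)).trans
    (map_add (P.toFun m) (jet u m) (jet v m))

theorem mapSec_dd_smul (c : ℝ) (u : Sec n F E) :
    P.mapSec (dd (c • u)) = c • P.mapSec (dd u) :=
  SecD.ext_eval fun m => (congrArg (P.toFun m) (map_smul (jetHom n F E m) c u)).trans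
    (map_smul (P.toFun m) c (jet u m))

/-- The operation `(u, v) ↦ P(𝕕u) v` on `Γ(E)`. -/
def secBracket : Sec n F E →ₗ[ℝ] Sec n F E →ₗ[ℝ] Sec n F E where
  toFun u := act (P.mapSec (dd u))
  map_add' u v := LinearMap.ext fun w =>
    (congrArg (fun X => act X w) (P.mapSec_dd_add u v)).trans (act_add_left _ _ w)
  map_smul' c u := LinearMap.ext fun w =>
    (congrArg (fun X => act X w) (P.mapSec_dd_smul c u)).trans (act_smul_left c _ w)

theorem secBracket_apply (u v : Sec n F E) : P.secBracket u v = act (P.mapSec (dd u)) v := rfl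

theorem pairing_comm_of_isDirac (h : IsDirac P.graph) (m : M) (μ ν : JFiber n F E m) :
    pairing ν (P.toFun m μ) = -pairing μ (P.toFun m ν) := by
  have h1 := (h.maximal_isotropic m).prop (P.toFun m μ, μ) (P.mem_graph.2 rfl)
    (P.toFun m ν, ν) (P.mem_graph.2 rfl)
  exact eq_neg_of_add_eq_zero_left ((smul_eq_zero.1 h1).resolve_left (by norm_num))

theorem secBracket_comm (h : IsDirac P.graph) (u v : Sec n F E) :
    P.secBracket u v = -P.secBracket v u := by
  ext m
  exact P.pairing_comm_of_isDirac h m (jet u m) (jet v m)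

/-- In the Dorfman bracket of the graph sections over 𝕕u and 𝕕v the commutator terms cancel by
skewness. The jet component is the jet of [u, v], and closedness of L_P identifies the 𝔇E component
as its image under P. -/
theorem mapSec_dd_secBracket [HasLineFrames n F E] (h : IsDirac P.graph) (u v : Sec n F E) :
    P.mapSec (dd (P.secBracket u v)) = bracketD (P.mapSec (dd u)) (P.mapSec (dd v)) := by
  refine (h.closed (P.mapSec (dd u), dd u) (P.mapSec (dd v), dd v) (fun m => P.mem_graph.2 rfl)
    (fun m => P.mem_graph.2 rfl)).elim fun Z hZ => ?_
  have h1 : Z.2 = dd (P.secBracket u v) := by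
    refine SecJ.ext_eval fun m => pairing_ext fun δ => ?_
    refine (evalD_surjective m δ).elim fun 𝔱 h𝔱 => ?_
    have h2 := hZ.1.2 𝔱
    have h3 : pairSec Z.2 𝔱 = act 𝔱 (P.secBracket u v) := by
      refine h2.trans ?_
      show act (P.mapSec (dd u)) (act 𝔱 v) - act (bracketD (P.mapSec (dd u)) 𝔱) v
        - (act (P.mapSec (dd v)) (act 𝔱 u) - act (bracketD (P.mapSec (dd v)) 𝔱) u)
        + act 𝔱 (P.secBracket v u) = _
      rw [act_bracketD, act_bracketD, ← secBracket_apply, ← secBracket_apply, ← secBracket_apply,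
        ← secBracket_apply, P.secBracket_comm h v u, map_neg]
      abel
    rw [← h𝔱]
    exact DFunLike.congr_fun h3 m
  have h4 : P.mapSec Z.2 = Z.1 := SecD.ext_eval fun m => P.mem_graph.1 (hZ.2 m)
  exact (congrArg P.mapSec h1.symm).trans (h4.trans hZ.1.1)

theorem supp_secBracket_subset_left [HasLineFrames n F E] [T2Space M] (u v : Sec n F E) :
    supp (P.secBracket u v) ⊆ supp u := by
  refine closure_minimal (fun m hm => ?_) isClosed_closure
  by_contra hc
  refine hm ?_
  have hu : jet u m = 0 := jet_eq_zero_of_eventuallyEq (by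
    filter_upwards [isClosed_closure.isOpen_compl.mem_nhds hc] with p hp
    by_contra h0
    exact hp (subset_closure h0))
  exact (congrArg (fun μ => op (P.toFun m μ) v) hu).trans
    (LinearMap.congr_fun ((congrArg op (map_zero (P.toFun m))).trans (map_zero op)) v)

/-- The local Lie algebra structure `[u, v] = P(𝕕u) v` given by a Dirac structure `L_P`. -/
def toLocalLieAlgebra [HasLineFrames n F E] [T2Space M] (h : IsDirac P.graph) :
    LocalLieAlgebra n F E where
  bracket := P.secBracket
  self u := by
    ext m
    have h1 : P.secBracket u u m = -P.secBracket u u m :=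
      DFunLike.congr_fun (P.secBracket_comm h u u) m
    refine (smul_eq_zero.1 ((two_smul ℝ _).trans ?_)).resolve_left (two_ne_zero' ℝ)
    exact eq_neg_iff_add_eq_zero.1 h1
  jacobi u v w := by
    have h1 := congrArg (fun X => act X w) (P.mapSec_dd_secBracket h u v)
    have h2 : P.secBracket (P.secBracket u v) w = P.secBracket u (P.secBracket v w) -
      P.secBracket v (P.secBracket u w) := h1.trans (act_bracketD _ _ _)
    rw [h2]
    abel
  isLocal u v := Set.subset_inter (P.supp_secBracket_subset_left u v) (by
    have h1 : supp (P.secBracket u v) = supp (P.secBracket v u) := by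
      rw [P.secBracket_comm h u v]
      unfold supp
      congr 1
      ext m
      show -P.secBracket v u m ≠ 0 ↔ _
      rw [neg_ne_zero]
      rfl
    rw [h1]
    exact P.supp_secBracket_subset_left v u)

end BundleMap

namespace LocalLieAlgebra

theorem ext_bracket {B B' : LocalLieAlgebra n F E} (h : B.bracket = B'.bracket) : B = B' := by
  obtain ⟨⟨_, _, _⟩, _⟩ := B
  obtain ⟨⟨_, _, _⟩, _⟩ := B'
  obtain rfl := h
  rfl

variable [HasLineFrames n F E] [T2Space M]

theorem toFun_eq_of_graph_eq {B : LocalLieAlgebra n F E} {P : BundleMap n F E}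
    (h : B.toBundleMap.graph = P.graph) (m : M) (μ : JFiber n F E m) :
    P.toFun m μ = B.jetToD m μ := by
  have h1 : ((B.jetToD m μ, μ) : Omni n F E m) ∈ P.graph m := by
    rw [← h]
    exact (BundleMap.mem_graph _).2 rfl
  exact P.mem_graph.1 h1

end LocalLieAlgebra

theorem BundleMap.graph_toBundleMap_toLocalLieAlgebra [HasLineFrames n F E] [T2Space M]
    (P : BundleMap n F E) (h : IsDirac P.graph) :
    (P.toLocalLieAlgebra h).toBundleMap.graph = P.graph := by
  have h1 : ∀ m, (P.toLocalLieAlgebra h).jetToD m = P.toFun m := fun m => by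
    refine LinearMap.ext fun μ => ?_
    refine (jet_surjective m μ).elim fun u hu => ?_
    refine op_injective m (LinearMap.ext fun v => ?_)
    rw [← hu]
    exact (P.toLocalLieAlgebra h).op_jetToD_jet u v m
  funext m
  exact congrArg (fun f => LinearMap.range (LinearMap.prod f LinearMap.id)) (h1 m)

end BracketOfDirac

end OmniLie

noncomputable section

namespace OmniLie

/-! ### Lie algebroids -/

section Algebroid

variable {n : ℕ} {M : Type*} [TopologicalSpace M] [ChartedSpace (EuclideanSpace ℝ (Fin n)) M]
  {F : Type*} [NormedAddCommGroup F] [NormedSpace ℝ F]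
  {E : M → Type*} [TopologicalSpace (TotalSpace F E)] [∀ m, TopologicalSpace (E m)]
  [∀ m, AddCommGroup (E m)] [∀ m, Module ℝ (E m)] [FiberBundle F E] [VectorBundle ℝ F E]
  [IsManifold (𝓡 n) ∞ M]

theorem eq_of_mvfderiv_eq {m : M} {x y : TangentSpace (𝓡 n) m}
    (φ : LineFrame n F E m)
    (h : ∀ f : C^∞⟮𝓡 n, M; 𝓘(ℝ, ℝ), ℝ⟯, mvfderiv (𝓡 n) f m x = mvfderiv (𝓡 n) f m y) : x = y := by
  rw [φ.eq_sum_vec φ.mem_dom x, φ.eq_sum_vec φ.mem_dom y]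
  exact Finset.sum_congr rfl fun i _ => by rw [h]

/-- Together with the next lemma, this identifies the image of 𝕖 with the jets of sections vanishing
at m. -/
theorem jet_eq_jetInc {m : M} (φ : LineFrame n F E m) {u : Sec n F E} (h : u m = 0) :
    jet u m = jetInc ((LinearMap.toSpanSingleton ℝ (E m) (φ.sec m)).comp
      (mvfderiv (𝓡 n) (φ.coeff u) m).toLinearMap) := by
  refine pairing_ext fun δ => ?_
  show op δ u = mvfderiv (𝓡 n) (φ.coeff u) m (anchor δ) • φ.sec m
  rw [φ.op_apply φ.mem_dom, φ.coeff_eq_zero u m h, zero_smul, zero_add]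

theorem apply_eq_zero_of_jet_eq_jetInc {m : M} {u : Sec n F E}
    {y : TangentSpace (𝓡 n) m →ₗ[ℝ] E m} (h : jet u m = jetInc y) : u m = 0 := by
  have h1 := congrArg (fun μ => pairing μ (glInc n F (LinearMap.id : E m →ₗ[ℝ] E m))) h
  exact h1.trans (map_zero y)

variable [HasLineFrames n F E]

/-- A bundle map `E → TM` is smooth if it takes smooth sections to smooth sections. -/
theorem contMDiff_fiberwise {ρ : ∀ m : M, E m →ₗ[ℝ] TangentSpace (𝓡 n) m}
    (h : ∀ u : Sec n F E, ContMDiff (𝓡 n) (𝓡 n).tangent ∞ (fun m =>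
      (TotalSpace.mk' (EuclideanSpace ℝ (Fin n)) m (ρ m (u m)) : TangentBundle (𝓡 n) M))) :
    ContMDiff ((𝓡 n).prod 𝓘(ℝ, F)) (𝓡 n).tangent ∞ (fun e : TotalSpace F E =>
      (TotalSpace.mk' (EuclideanSpace ℝ (Fin n)) e.1 (ρ e.1 e.2) : TangentBundle (𝓡 n) M)) := by
  intro e₀
  refine (HasLineFrames.nonempty (n := n) (F := F) (E := E) e₀.1).elim fun φ => ?_
  have hproj : ContMDiff ((𝓡 n).prod 𝓘(ℝ, F)) (𝓡 n) ∞ (TotalSpace.proj : TotalSpace F E → M) :=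
    contMDiff_proj E
  have h1 := ((h φ.sec).comp hproj) e₀
  rw [contMDiffAt_totalSpace] at h1 ⊢
  refine ⟨hproj e₀, ?_⟩
  have hdom : TotalSpace.proj ⁻¹' φ.dom ∈ nhds e₀ :=
    (φ.isOpen_dom.preimage (FiberBundle.continuous_proj F E)).mem_nhds φ.mem_dom
  have h2 : ContMDiffAt ((𝓡 n).prod 𝓘(ℝ, F)) 𝓘(ℝ, ℝ) ∞
      (fun e : TotalSpace F E => φ.fiberCoeff e.1 e.2) e₀ :=
    (φ.contMDiffOn_fiberCoeff e₀ φ.mem_dom).contMDiffAt hdom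
  refine (h2.smul h1.2).congr_of_eventuallyEq ?_
  set t := trivializationAt (EuclideanSpace ℝ (Fin n)) (TangentSpace (𝓡 n) : M → Type _) e₀.1
  have hb : TotalSpace.proj ⁻¹' t.baseSet ∈ nhds e₀ :=
    (t.open_baseSet.preimage (FiberBundle.continuous_proj F E)).mem_nhds
      (show e₀.1 ∈ t.baseSet from FiberBundle.mem_baseSet_trivializationAt _ _ _)
  filter_upwards [hdom, hb] with e he hbe
  have h3 : ρ e.1 e.2 = φ.fiberCoeff e.1 e.2 • ρ e.1 (φ.sec e.1) := by
    rw [← map_smul, ← φ.eq_smul_sec e.1 he e.2]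
  show (t ⟨e.1, ρ e.1 e.2⟩).2 = φ.fiberCoeff e.1 e.2 • (t ⟨e.1, ρ e.1 (φ.sec e.1)⟩).2
  rw [h3]
  exact (t.linear ℝ hbe).map_smul _ _

namespace LocalLieAlgebra

variable [T2Space M] (B : LocalLieAlgebra n F E)

/-- Compare the Leibniz rules of the algebroid and of [u, ·] ∈ 𝔇E on f s, with s nonzero at m. -/
theorem anchor_ad_of_lieAlgebroid {A : LieAlgebroid n F E} (h : A.bracket = B.bracket)
    (u : Sec n F E) (m : M) : anchor (evalD m (B.ad u)) = A.rho m (u m) := by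
  refine (HasLineFrames.nonempty (n := n) (F := F) (E := E) m).elim fun φ => ?_
  refine eq_of_mvfderiv_eq φ fun f => ?_
  have h1 := A.leibniz u φ.sec f m
  have h2 := op_smulSec (evalD m (B.ad u)) f φ.sec
  rw [op_ad, op_ad, ← h, h1] at h2
  exact (smul_left_injective ℝ (φ.sec_ne_zero m φ.mem_dom) (add_left_cancel h2)).symm

theorem anchor_jetToD_jetInc {A : LieAlgebroid n F E} (h : A.bracket = B.bracket) (m : M)
    (y : TangentSpace (𝓡 n) m →ₗ[ℝ] E m) : anchor (B.jetToD m (jetInc y)) = 0 := by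
  refine (jet_surjective (n := n) (F := F) (E := E) m (jetInc y)).elim fun u hu => ?_
  have hu' : jet u m = jetInc y := hu
  rw [← hu', B.jetToD_jet, B.anchor_ad_of_lieAlgebroid h, apply_eq_zero_of_jet_eq_jetInc hu',
    map_zero]

theorem anchor_ad_congr
    (h : ∀ (m : M) (y : TangentSpace (𝓡 n) m →ₗ[ℝ] E m), anchor (B.jetToD m (jetInc y)) = 0)
    {u v : Sec n F E} {m : M} (huv : u m = v m) :
    anchor (evalD m (B.ad u)) = anchor (evalD m (B.ad v)) := by
  refine (HasLineFrames.nonempty (n := n) (F := F) (E := E) m).elim fun φ => ?_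
  have h0 : (u - v) m = 0 := sub_eq_zero.2 huv
  have h1 : anchor (B.jetToD m (jet (u - v) m)) = 0 :=
    (congrArg (fun μ => anchor (B.jetToD m μ)) (jet_eq_jetInc φ h0)).trans (h m _)
  have h2 : jet (u - v) m = jet u m - jet v m := map_sub (jetHom n F E m) u v
  rw [h2, map_sub, map_sub, jetToD_jet, jetToD_jet] at h1
  exact sub_eq_zero.1 h1

/-- An anchor `E → TM`, given by `e ↦ α([u, ·])(m)` for some `u` with `u(m) = e`. -/
def rhoFiber (m : M) : E m →ₗ[ℝ] TangentSpace (𝓡 n) m :=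
  anchor ∘ₗ B.jetToD m ∘ₗ jetHom n F E m ∘ₗ ((evalSec n F E m).exists_rightInverse_of_surjective
    (LinearMap.range_eq_top.2 (evalSec_surjective m))).choose

/-- The linear choice of extensions made in `rhoFiber` is irrelevant, by `anchor_ad_congr`. -/
theorem rhoFiber_apply
    (h : ∀ (m : M) (y : TangentSpace (𝓡 n) m →ₗ[ℝ] E m), anchor (B.jetToD m (jetInc y)) = 0)
    (u : Sec n F E) (m : M) : B.rhoFiber m (u m) = anchor (evalD m (B.ad u)) := by
  have hσ := ((evalSec n F E m).exists_rightInverse_of_surjective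
    (LinearMap.range_eq_top.2 (evalSec_surjective m))).choose_spec
  exact (congrArg anchor (B.jetToD_jet _ m)).trans
    (B.anchor_ad_congr h (LinearMap.congr_fun hσ (u m)))

theorem ad_bracket (u v : Sec n F E) : B.ad (B.bracket u v) = bracketD (B.ad u) (B.ad v) :=
  SecD.ext_act fun w => by
    have h := B.jacobi u v w
    rw [act_bracketD, act_ad, act_ad, act_ad, act_ad, act_ad, h, add_sub_cancel_right]

/-- The Lie algebroid structure of a local Lie algebra with `α ∘ π ∘ 𝕖 = 0`. -/
def toLieAlgebroid
    (h : ∀ (m : M) (y : TangentSpace (𝓡 n) m →ₗ[ℝ] E m), anchor (B.jetToD m (jetInc y)) = 0) :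
    LieAlgebroid n F E where
  toSectionLieBracket := B.toSectionLieBracket
  rho := B.rhoFiber
  smooth_rho := contMDiff_fiberwise fun u => by
    have h1 := (B.ad u).2.1
    refine h1.congr fun m => ?_
    rw [B.rhoFiber_apply h]
    rfl
  leibniz u v f m := by
    rw [B.rhoFiber_apply h, ← op_ad, ← op_ad, op_smulSec]
  rho_bracket u v m := by
    -- The Jacobi identity gives `ad_bracket`, and the anchor of a commutator is by construction the
    -- Lie bracket of the anchors.
    have h1 : ∀ w : Sec n F E, (fun p => B.rhoFiber p (w p)) = fun p => anchor ((B.ad w).1 p) :=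
      fun w => funext fun p => B.rhoFiber_apply h w p
    rw [B.rhoFiber_apply h, h1, h1, ad_bracket]
    rfl

end LocalLieAlgebra

end Algebroid

end OmniLie

theorem mainTheorem2 {n : ℕ} {M : Type*} [TopologicalSpace M] [T2Space M]
    [SecondCountableTopology M] [ChartedSpace (EuclideanSpace ℝ (Fin n)) M]
    [IsManifold (𝓡 n) ∞ M]
    {F : Type*} [NormedAddCommGroup F] [NormedSpace ℝ F]
    (E : M → Type*) [TopologicalSpace (TotalSpace F E)] [∀ m, TopologicalSpace (E m)]
    [∀ m, AddCommGroup (E m)] [∀ m, Module ℝ (E m)] [FiberBundle F E] [VectorBundle ℝ F E]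
    [ContMDiffVectorBundle ∞ F E (𝓡 n)] (hE : Module.finrank ℝ F = 1) :
    ∃ Φ : OmniLie.LocalLieAlgebra n F E ≃
        {L : ∀ m : M, Submodule ℝ (OmniLie.Omni n F E m) //
          OmniLie.IsDirac L ∧ ∃ P : OmniLie.BundleMap n F E, L = P.graph},
      ∀ (B : OmniLie.LocalLieAlgebra n F E) (P : OmniLie.BundleMap n F E),
        (Φ B).1 = P.graph →
          (∀ (u v : OmniLie.Sec n F E) (m : M),
            B.bracket u v m = OmniLie.op (P.toFun m (OmniLie.jet u m)) v) ∧
          ((∃ A : OmniLie.LieAlgebroid n F E, A.bracket = B.bracket) ↔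
            ∀ (m : M) (y : TangentSpace (𝓡 n) m →ₗ[ℝ] E m),
              OmniLie.anchor (P.toFun m (OmniLie.jetInc y)) = 0) := by
  have : OmniLie.HasLineFrames n F E := ⟨OmniLie.nonempty_lineFrame hE⟩
  let Ψ : OmniLie.LocalLieAlgebra n F E → {L : ∀ m : M, Submodule ℝ (OmniLie.Omni n F E m) //
      OmniLie.IsDirac L ∧ ∃ P : OmniLie.BundleMap n F E, L = P.graph} :=
    fun B => ⟨B.toBundleMap.graph, B.isDirac_graph, B.toBundleMap, rfl⟩
  have key : ∀ (B : OmniLie.LocalLieAlgebra n F E) (P : OmniLie.BundleMap n F E),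
      (Ψ B).1 = P.graph → ∀ (u v : OmniLie.Sec n F E) (m : M),
        B.bracket u v m = OmniLie.op (P.toFun m (OmniLie.jet u m)) v := fun B P h u v m => by
    rw [B.toFun_eq_of_graph_eq h, B.op_jetToD_jet]
  have hΨ : Function.Bijective Ψ := by
    refine ⟨fun B B' h => OmniLie.LocalLieAlgebra.ext_bracket ?_, fun L => ?_⟩
    · refine LinearMap.ext fun u => LinearMap.ext fun v => ContMDiffSection.ext fun m => ?_
      rw [key B B.toBundleMap rfl, key B' B.toBundleMap (congrArg Subtype.val h.symm)]
    · refine L.2.2.elim fun P hP => ?_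
      have hd : OmniLie.IsDirac P.graph := hP ▸ L.2.1
      have h1 : (P.toLocalLieAlgebra hd).toBundleMap.graph = P.graph :=
        P.graph_toBundleMap_toLocalLieAlgebra hd
      exact ⟨P.toLocalLieAlgebra hd, Subtype.ext (h1.trans hP.symm)⟩
  refine ⟨Equiv.ofBijective Ψ hΨ, fun B P h => ⟨key B P h, ?_⟩⟩
  have hP : ∀ m μ, P.toFun m μ = B.jetToD m μ := B.toFun_eq_of_graph_eq h
  constructor
  · rintro ⟨A, hA⟩ m y
    rw [hP]
    exact B.anchor_jetToD_jetInc hA m y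
  · intro h0
    exact ⟨B.toLieAlgebroid fun m y => by rw [← hP]; exact h0 m y, rfl⟩
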